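/- Let $n\ge 2$, let $\xi\sim P$ be a random variable, let $f(\cdot;\xi):\mathbb R^n\to\mathbb R$ be twice differentiable for every $\xi$, and let $F(x)=\mathbb E_\xi f(x;\xi)$ be bounded below. Let $L_0,M_0,\delta>0$ and $L_1,G_0,G_1,M_1,K_0,K_1\ge 0$ and assume that for all $x,x'\in\mathbb R^n$ (with Euclidean and spectral norms): 1. ($(L_0,L_1)$-smoothness) $F$ is differentiable and $\|\nabla F(x)-\nabla F(x')\|\le (L_0+L_1\|\nabla F(x)\|)\|x-x'\|$ whenever $L_1\|x-x'\|\le 1$; 2. (gradient variance) $\mathbb E_\xi\nabla f(x;\xi)=\nabla F(x)$ and $\mathbb E_\xi\|\nabla f(x;\xi)-\nabla F(x)\|^2\le G_0^2+G_1^2\|\nabla F(x)\|^2$; 3. (second-order generalized smoothness and Hessian variance) $F$ is twice differentiable, $\|\nabla^2F(x)-\nabla^2F(x')\|\le (M_0+M_1\|\nabla F(x)\|)\|x-x'\|$ whenever $\|x-x'\|\le\delta$, $\mathbb E_\xi\nabla^2 f(x;\xi)=\nabla^2F(x)$ and $\mathbb E_\xi\|\nabla^2 f(x;\xi)-\nabla^2F(x)\|^2\le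 K_0^2+K_1^2\|\nabla F(x)\|^2$; 4. (averaged smoothness of the components) $\mathbb E_\xi\|\nabla f(x;\xi)-\nabla f(x';\xi)\|\le (L_0+L_1\|\nabla F(x)\|)\|x-x'\|$. Write $f(x;\mathcal S)=|\mathcal S|^{-1}\sum_{\xi\in\mathcal S}f(x;\xi)$ for a batch $\mathcal S$ of samples. For $\epsilon>0$ and $x_0\in\mathbb R^n$ the variance-reduced second-order trust region method (SOTRGS-VR) runs as follows, for $t=0,\dots,T-1$, with fresh i.i.d. samples from $P$ in every iteration. If $q\mid t$, draw a batch $\mathcal S_1$ and set $g_t=\nabla f(x_t;\mathcal S_1)$; otherwise draw a batch $\mathcal S_3$ and set $g_t=g_{t-1}+\nabla f(x_t;\mathcal S_3)-\nabla f(x_{t-1};\mathcal S_3)$. Draw a batch $\mathcal S_2$ and set $H_t=\nabla^2f(x_t;\mathcal S_2)$. Let $d_{t+1}$ be a global minimizer of $F(x_t)+g_t^Td+\tfrac12 d^TH_td$ over $\|d\|\le\Delta$, and set $x_{t+1}=x_t+d_{t+1}$. The parameters are $\Delta=\sqrt\epsilon$, $|\mathcal S_1|=\lceil\epsilon^{-2}\rceil$,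 $|\mathcal S_2|=\lceil 22\log(n)\epsilon^{-1}\rceil$, $|\mathcal S_3|=\lceil\epsilon^{-3/2}\rceil$, $q=\lceil\epsilon^{-1/2}\rceil$. Put $\Delta_F=F(x_0)-\inf F$. There is an $\epsilon_0>0$ depending only on $L_1,G_1,M_1,K_1,\delta$, and for all $a,b>0$ there is a constant $C>0$ depending only on $a,b$ and the constants $L_0,L_1,G_0,G_1,M_0,M_1,K_0,K_1,\delta$ (not on $n$, $P$, $f$, $x_0$, $\epsilon$, $T$), such that for every $0<\epsilon\le\epsilon_0$ and every integer $T\ge 1$ with $T\ge a\,\Delta_F\,\epsilon^{-3/2}$, $$\mathbb E\|\nabla F(x_{\bar t+1})\|\le C\epsilon,\qquad \mathbb E[\lambda_{\min}(\nabla^2F(x_{\bar t+1}))]\ge -C\sqrt\epsilon ,$$ where $\bar t$ is uniformly distributed on $\{0,\dots,T-1\}$ and independent of the iterates. Moreover, if also $T\le b\,\Delta_F\,\epsilon^{-3/2}$ and $\epsilon\le\Delta_F$, then the total number of samples drawn is at most $C\bigl(\Delta_F\epsilon^{-3}+\log(n)\,\Delta_F\epsilon^{-5/2}\bigr)$; that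 is, the sample complexity is $O(\Delta_F\epsilon^{-3}+\Delta_F\epsilon^{-5/2})$ up to the factor $\log n$ from $|\mathcal S_2|$. -/

import Mathlib

open MeasureTheory ProbabilityTheory
open scoped RealInnerProductSpace

namespace TrustRegion

/-- `ℝⁿ` with the Euclidean norm. -/
abbrev E (n : ℕ) : Type := EuclideanSpace ℝ (Fin n)

/-- The Hessian `∇²F(x)`, the derivative of the gradient, as a linear operator on `ℝⁿ`
(its norm is the spectral norm). -/
noncomputable def hessian {n : ℕ} (F : E n → ℝ) (x : E n) : E n →L[ℝ] E n :=
  fderiv ℝ (gradient F) x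

/-- `F` is twice differentiable on `ℝⁿ`. -/
def TwiceDifferentiable {n : ℕ} (F : E n → ℝ) : Prop :=
  Differentiable ℝ F ∧ Differentiable ℝ (gradient F)

/-- The smallest eigenvalue of a (symmetric) operator. -/
noncomputable def lambdaMin {n : ℕ} (A : E n →L[ℝ] E n) : ℝ :=
  sInf {c : ℝ | Module.End.HasEigenvalue (A : E n →ₗ[ℝ] E n) c}

/-- The objective `F(x) = 𝔼_ξ f(x; ξ)`, `ξ ∼ P`, is bounded below, and every component
`f(·; ξ)` is twice differentiable. -/
structure IsStochasticObjective {n : ℕ} {Ξ : Type*} [MeasurableSpace Ξ] (P : Measure Ξ)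
    (f : E n → Ξ → ℝ) (F : E n → ℝ) : Prop where
  measurable : ∀ x, Measurable (f x)
  twiceDifferentiable : ∀ s, TwiceDifferentiable (fun x => f x s)
  integrable : ∀ x, Integrable (f x) P
  eq_integral : ∀ x, F x = ∫ s, f x s ∂P
  bddBelow : BddBelow (Set.range F)

/-- `(L₀, L₁)`-smoothness. The constraint `‖x - x'‖ ≤ 1 / L₁` is written multiplicatively, so that
it is void for `L₁ = 0`. -/
def GeneralizedSmooth {n : ℕ} (F : E n → ℝ) (L₀ L₁ : ℝ) : Prop :=
  Differentiable ℝ F ∧ ∀ x x' : E n, L₁ * ‖x - x'‖ ≤ 1 →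
    ‖gradient F x - gradient F x'‖ ≤ (L₀ + L₁ * ‖gradient F x‖) * ‖x - x'‖

/-- The stochastic gradient is unbiased with `(G₀, G₁)`-bounded variance. -/
structure GradientVarianceBounded {n : ℕ} {Ξ : Type*} [MeasurableSpace Ξ] (P : Measure Ξ)
    (f : E n → Ξ → ℝ) (F : E n → ℝ) (G₀ G₁ : ℝ) : Prop where
  integrable : ∀ x, Integrable (fun s => gradient (fun y => f y s) x) P
  unbiased : ∀ x, ∫ s, gradient (fun y => f y s) x ∂P = gradient F x
  integrable_sq : ∀ x,
    Integrable (fun s => ‖gradient (fun y => f y s) x - gradient F x‖ ^ 2) P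
  variance_le : ∀ x,
    ∫ s, ‖gradient (fun y => f y s) x - gradient F x‖ ^ 2 ∂P
      ≤ G₀ ^ 2 + G₁ ^ 2 * ‖gradient F x‖ ^ 2

/-- Second-order generalized smoothness. -/
def SecondOrderGeneralizedSmooth {n : ℕ} (F : E n → ℝ) (δ M₀ M₁ : ℝ) : Prop :=
  TwiceDifferentiable F ∧ ∀ x x' : E n, ‖x - x'‖ ≤ δ →
    ‖hessian F x - hessian F x'‖ ≤ (M₀ + M₁ * ‖gradient F x‖) * ‖x - x'‖

/-- The stochastic Hessian is unbiased with `(K₀, K₁)`-bounded variance. -/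
structure HessianVarianceBounded {n : ℕ} {Ξ : Type*} [MeasurableSpace Ξ] (P : Measure Ξ)
    (f : E n → Ξ → ℝ) (F : E n → ℝ) (K₀ K₁ : ℝ) : Prop where
  integrable : ∀ x, Integrable (fun s => hessian (fun y => f y s) x) P
  unbiased : ∀ x, ∫ s, hessian (fun y => f y s) x ∂P = hessian F x
  integrable_sq : ∀ x,
    Integrable (fun s => ‖hessian (fun y => f y s) x - hessian F x‖ ^ 2) P
  variance_le : ∀ x,
    ∫ s, ‖hessian (fun y => f y s) x - hessian F x‖ ^ 2 ∂P
      ≤ K₀ ^ 2 + K₁ ^ 2 * ‖gradient F x‖ ^ 2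

/-- Averaged smoothness of the components. -/
def AveragedSmooth {n : ℕ} {Ξ : Type*} [MeasurableSpace Ξ] (P : Measure Ξ)
    (f : E n → Ξ → ℝ) (F : E n → ℝ) (L₀ L₁ : ℝ) : Prop :=
  ∀ x x' : E n,
    ∫ s, ‖gradient (fun y => f y s) x - gradient (fun y => f y s) x'‖ ∂P
      ≤ (L₀ + L₁ * ‖gradient F x‖) * ‖x - x'‖

/-- The batch function `f(x; S) = |S|⁻¹ ∑_{ξ ∈ S} f(x; ξ)` of a batch of `m` samples. -/
noncomputable def batchFun {n : ℕ} {Ξ : Type*} (f : E n → Ξ → ℝ) {m : ℕ} (S : Fin m → Ξ)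
    (x : E n) : ℝ :=
  (m : ℝ)⁻¹ * ∑ j, f x (S j)

/-- The quadratic model `m(d) = c + gᵀd + ½ dᵀBd`. -/
noncomputable def model {n : ℕ} (c : ℝ) (g : E n) (B : E n →L[ℝ] E n) (d : E n) : ℝ :=
  c + ⟪g, d⟫ + 1 / 2 * ⟪d, B d⟫

/-- `d` is a global solution of the trust region subproblem `min m(d)` subject to `‖d‖ ≤ Δ`. -/
def IsTrustRegionStep {n : ℕ} (c : ℝ) (g : E n) (B : E n →L[ℝ] E n) (Δ : ℝ) (d : E n) : Prop :=
  ‖d‖ ≤ Δ ∧ ∀ d' : E n, ‖d'‖ ≤ Δ → model c g B d ≤ model c g B d'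

/-- The parameters of the variance-reduced method: trust radius, sizes of the batches
`S₁` (gradient, at the start of an epoch), `S₂` (Hessian), `S₃` (gradient differences),
and epoch length `q`. -/
structure Params where
  radius : ℝ
  S₁ : ℕ
  S₂ : ℕ
  S₃ : ℕ
  q : ℕ

/-- The number of gradient samples drawn in iteration `t`. -/
def Params.gradBatch (p : Params) (t : ℕ) : ℕ :=
  if t % p.q = 0 then p.S₁ else p.S₃

/-- The total number of samples (for gradients and for Hessians) drawn in `T` iterations. -/
def Params.totalSamples (p : Params) (T : ℕ) : ℕ :=
  ∑ t ∈ Finset.range T, (p.gradBatch t + p.S₂)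

/-- The parameters `Δ = √ε`, `|S₁| = ε⁻²`, `|S₂| = 22 log(n) ε⁻¹`, `|S₃| = ε^(-3/2)`,
`q = ε^(-1/2)`, the integers being rounded up. -/
noncomputable def soParams (n : ℕ) (ε : ℝ) : Params where
  radius := √ε
  S₁ := ⌈ε ^ (-2 : ℝ)⌉₊
  S₂ := ⌈22 * Real.log n * ε⁻¹⌉₊
  S₃ := ⌈ε ^ (-3 / 2 : ℝ)⌉₊
  q := ⌈ε ^ (-1 / 2 : ℝ)⌉₊

/-- A run of `T` iterations of the variance-reduced second-order trust region method, started at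
`x₀`, on a probability space `(Ω, μ)`. The filtration `ℱ` records the randomness: `ℱ t` is what is
known before iteration `t`. In iteration `t` the fresh i.i.d. samples `gradSample t`
and `hessSample t` with law `P` are drawn. Any (measurable, possibly randomized) choice among the
global solutions of the subproblem is allowed. -/
structure Run {n : ℕ} {Ξ Ω : Type*} [MeasurableSpace Ξ] [mΩ : MeasurableSpace Ω]
    (P : Measure Ξ) (f : E n → Ξ → ℝ) (F : E n → ℝ) (x₀ : E n) (p : Params) (T : ℕ)
    (μ : Measure Ω) where
  /-- the history -/
  ℱ : Filtration ℕ mΩ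
  /-- the batch `S₁` or `S₃` of iteration `t` -/
  gradSample : (t : ℕ) → Fin (p.gradBatch t) → Ω → Ξ
  /-- the batch `S₂` of iteration `t` -/
  hessSample : (t : ℕ) → Fin p.S₂ → Ω → Ξ
  /-- the iterates -/
  x : ℕ → Ω → E n
  /-- the gradient estimators -/
  g : ℕ → Ω → E n
  /-- the Hessian estimators -/
  H : ℕ → Ω → (E n →L[ℝ] E n)
  gradSample_measurable : ∀ t < T, ∀ j, Measurable[ℱ (t + 1)] (gradSample t j)
  hessSample_measurable : ∀ t < T, ∀ j, Measurable[ℱ (t + 1)] (hessSample t j)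
  gradSample_law : ∀ t < T, ∀ j, μ.map (gradSample t j) = P
  hessSample_law : ∀ t < T, ∀ j, μ.map (hessSample t j) = P
  /-- the samples of one iteration are mutually independent -/
  samples_iIndep : ∀ t < T,
    iIndepFun (fun i : Fin (p.gradBatch t) ⊕ Fin p.S₂ =>
      Sum.elim (gradSample t) (hessSample t) i) μ
  /-- the samples of one iteration are jointly independent of the past -/
  samples_indep_past : ∀ t < T,
    Indep (⨆ i : Fin (p.gradBatch t) ⊕ Fin p.S₂,
      MeasurableSpace.comap (Sum.elim (gradSample t) (hessSample t) i) inferInstance) (ℱ t) μ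
  x_measurable : ∀ t ≤ T, Measurable[ℱ t] (x t)
  x_zero : ∀ ω, x 0 ω = x₀
  g_restart : ∀ t < T, t % p.q = 0 → ∀ ω,
    g t ω = gradient (batchFun f (fun j => gradSample t j ω)) (x t ω)
  g_spider : ∀ t, t + 1 < T → (t + 1) % p.q ≠ 0 → ∀ ω,
    g (t + 1) ω = g t ω
      + gradient (batchFun f (fun j => gradSample (t + 1) j ω)) (x (t + 1) ω)
      - gradient (batchFun f (fun j => gradSample (t + 1) j ω)) (x t ω)
  H_eq : ∀ t < T, ∀ ω, H t ω = hessian (batchFun f (fun j => hessSample t j ω)) (x t ω)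
  /-- `x_{t+1} = x_t + d_{t+1}` with a solution `d_{t+1}` of the subproblem with `B_t = H_t` -/
  step : ∀ t < T, ∀ ω,
    IsTrustRegionStep (F (x t ω)) (g t ω) (H t ω) p.radius (x (t + 1) ω - x t ω)

end TrustRegion

/-!
The optimality conditions of the trust region subproblem, compared with the second-order Taylor
expansion of `F` at `x_t`, show that `Δ ‖∇F(x_{t+1})‖` and `-Δ² λ_min(∇²F(x_{t+1}))` are both at
most `2 (F(x_t) - F(x_{t+1}))` plus an error linear in `‖g_t - ∇F(x_t)‖` and `‖H_t - ∇²F(x_t)‖`.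

The Hessian error is averaged over `|S₂|` samples: by symmetrization and the trace moment method
for matrix Rademacher sums its mean square gains the factor `log n / |S₂|`.

For the gradient error, the increment of the estimator along a step is the integral of the Hessian
noise along the segment, so that its conditional variance is at most `Δ²` times that of the Hessian.
The increments are martingale differences and the error within an epoch grows only in mean square.
Conditioning on the past, each error is weighted by the local noise level, an affine function of
`‖∇F‖`. The iterates move by at most `2` during an epoch, so by `(L₀, L₁)`-smoothness the noise
level varies by a bounded factor, and dividing by it turns second moments into first ones: the
expected error of step `t` is `O(Δ³)` times an affine function of `𝔼 ‖∇F(x_{t+1})‖`.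

After summation over `t` this last term is absorbed into the left-hand side for small `Δ`, and the
decrease of `F` telescopes.
-/

namespace TrustRegion

section Subproblem

variable {V : Type*} [NormedAddCommGroup V] [InnerProductSpace ℝ V]

theorem nonneg_of_forall_add_mul_nonneg {a b : ℝ} (h : ∀ s : ℝ, 0 < s → s ≤ 1 → 0 ≤ a + s * b) :
    0 ≤ a := by
  have hlim : Filter.Tendsto (fun s : ℝ => a + s * b) (nhdsWithin 0 (Set.Ioi 0)) (nhds a) := by
    have hcont : Continuous fun s : ℝ => a + s * b := by fun_prop
    simpa using (hcont.tendsto 0).mono_left nhdsWithin_le_nhds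
  refine ge_of_tendsto hlim ?_
  filter_upwards [Ioc_mem_nhdsGT one_pos] with s hs using h s hs.1 hs.2

theorem exists_eq_neg_smul_of_forall_inner_sub_nonneg {Δ : ℝ} {d r : V} (hΔ : 0 < Δ)
    (hd : ‖d‖ ≤ Δ) (h : ∀ w, ‖w‖ ≤ Δ → 0 ≤ ⟪r, w - d⟫) :
    ∃ lam : ℝ, 0 ≤ lam ∧ r = -(lam • d) ∧ lam * ‖d‖ ^ 2 = lam * Δ ^ 2 := by
  have hinner : ⟪r, d⟫ ≤ -(Δ * ‖r‖) := by
    rcases eq_or_ne r 0 with rfl | hr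
    · simp
    have hr' : ‖r‖ ≠ 0 := norm_ne_zero_iff.mpr hr
    have hw : ‖-((Δ / ‖r‖) • r)‖ ≤ Δ := by
      rw [norm_neg, norm_smul, Real.norm_of_nonneg (by positivity), div_mul_cancel₀ _ hr']
    have hmin := h _ hw
    have hself : ⟪r, (Δ / ‖r‖) • r⟫ = Δ * ‖r‖ := by
      rw [inner_smul_right, real_inner_self_eq_norm_sq]
      field_simp
    rw [inner_sub_right, inner_neg_right, hself] at hmin
    linarith
  -- Equality in the Cauchy–Schwarz inequality for `⟪r, d⟫`.
  have hzero : Δ • r + ‖r‖ • d = 0 := by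
    rw [← norm_eq_zero, ← sq_eq_zero_iff]
    refine le_antisymm ?_ (sq_nonneg _)
    have hexp : ‖Δ • r + ‖r‖ • d‖ ^ 2
        = Δ ^ 2 * ‖r‖ ^ 2 + 2 * (Δ * ‖r‖) * ⟪r, d⟫ + ‖r‖ ^ 2 * ‖d‖ ^ 2 := by
      rw [norm_add_sq_real, norm_smul, norm_smul, real_inner_smul_left, real_inner_smul_right,
        Real.norm_of_nonneg hΔ.le, norm_norm]
      ring
    have hcross := mul_le_mul_of_nonneg_left hinner (by positivity : 0 ≤ 2 * (Δ * ‖r‖))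
    have hdΔ : ‖r‖ ^ 2 * ‖d‖ ^ 2 ≤ ‖r‖ ^ 2 * Δ ^ 2 := by gcongr
    linarith
  have hr : r = -((‖r‖ / Δ) • d) := by
    rw [eq_neg_iff_add_eq_zero, ← smul_right_inj hΔ.ne', smul_add, smul_smul,
      mul_div_cancel₀ _ hΔ.ne', smul_zero, hzero]
  refine ⟨‖r‖ / Δ, by positivity, hr, ?_⟩
  have hnorm : ‖r‖ * ‖d‖ = ‖r‖ * Δ := by
    have := congrArg norm (eq_neg_of_add_eq_zero_left hzero)
    rw [norm_neg, norm_smul, norm_smul, norm_norm, Real.norm_of_nonneg hΔ.le] at this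
    linarith
  rcases mul_eq_mul_left_iff.mp hnorm with h' | h' <;> simp [h']

theorem inner_apply_self_nonneg_of_ball {B : V →L[ℝ] V} {Δ : ℝ} {d : V} (hd : ‖d‖ < Δ)
    (h : ∀ w, ‖w‖ ≤ Δ → 0 ≤ ⟪w - d, B (w - d)⟫) (v : V) : 0 ≤ ⟪v, B v⟫ := by
  have hcont : Continuous fun s : ℝ => ‖d + s • v‖ := by fun_prop
  have hfeas : ∀ᶠ s : ℝ in nhdsWithin 0 (Set.Ioi 0), ‖d + s • v‖ < Δ :=
    nhdsWithin_le_nhds (hcont.continuousAt.eventually_lt continuousAt_const (by simpa using hd))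
  obtain ⟨s, hs, hspos : 0 < s⟩ := (hfeas.and self_mem_nhdsWithin).exists
  have := h _ hs.le
  simp only [add_sub_cancel_left, map_smul, real_inner_smul_left, real_inner_smul_right] at this
  exact nonneg_of_mul_nonneg_right (nonneg_of_mul_nonneg_right this hspos) hspos

theorem inner_apply_self_add_nonneg_of_sphere {B : V →L[ℝ] V} {lam : ℝ} {d : V} (hd : d ≠ 0)
    (h : ∀ w, ‖w‖ = ‖d‖ → 0 ≤ -(lam * ⟪d, w - d⟫) + 1 / 2 * ⟪w - d, B (w - d)⟫) (v : V) :
    0 ≤ ⟪v, B v⟫ + lam * ‖v‖ ^ 2 := by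
  -- A line through `d` that is not tangent to the sphere meets it again at `d + s • v`.
  have hsecant : ∀ v, ⟪d, v⟫ ≠ 0 → 0 ≤ ⟪v, B v⟫ + lam * ‖v‖ ^ 2 := by
    intro v hv
    have hv0 : v ≠ 0 := by rintro rfl; simp at hv
    set s := -(2 * ⟪d, v⟫ / ‖v‖ ^ 2)
    have hs : s ≠ 0 := neg_ne_zero.mpr (div_ne_zero (by simpa using hv) (by positivity))
    have hsv : s * ⟪d, v⟫ = -(s ^ 2 * ‖v‖ ^ 2) / 2 := by
      simp only [s]
      field_simp
    have hw : ‖d + s • v‖ = ‖d‖ := by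
      rw [← sq_eq_sq₀ (norm_nonneg _) (norm_nonneg _), norm_add_sq_real, real_inner_smul_right,
        norm_smul, mul_pow, Real.norm_eq_abs, sq_abs, hsv]
      ring
    have hmin := h _ hw
    simp only [add_sub_cancel_left, map_smul, real_inner_smul_left, real_inner_smul_right,
      hsv] at hmin
    have : 0 ≤ s ^ 2 / 2 * (⟪v, B v⟫ + lam * ‖v‖ ^ 2) := by linarith
    exact nonneg_of_mul_nonneg_right this (by positivity)
  by_cases hv : ⟪d, v⟫ = 0
  · have hcont : Continuous fun η : ℝ => ⟪v + η • d, B (v + η • d)⟫ + lam * ‖v + η • d‖ ^ 2 := by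
      fun_prop
    have hlim := (hcont.tendsto 0).mono_left (nhdsWithin_le_nhds (s := {0}ᶜ))
    simp only [zero_smul, add_zero] at hlim
    refine ge_of_tendsto hlim ?_
    filter_upwards [self_mem_nhdsWithin] with η hη
    refine hsecant _ ?_
    rw [inner_add_right, hv, real_inner_smul_right, zero_add]
    exact mul_ne_zero hη (inner_self_ne_zero.mpr hd)
  · exact hsecant v hv

/-- `lam` is a Lagrange multiplier of the constraint `‖d‖ ≤ Δ` in the trust region subproblem with
gradient `g` and matrix `B`: the Moré–Sorensen optimality conditions hold at `d`. Complementarity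
`lam * (‖d‖ - Δ) = 0` is expressed with the squares, in which it is used. -/
structure IsMultiplier (g : V) (B : V →L[ℝ] V) (Δ : ℝ) (d : V) (lam : ℝ) : Prop where
  nonneg : 0 ≤ lam
  stationary : B d + g = -(lam • d)
  complementary : lam * ‖d‖ ^ 2 = lam * Δ ^ 2
  posSemidef : ∀ v, 0 ≤ ⟪v, B v⟫ + lam * ‖v‖ ^ 2

variable {n : ℕ} {c Δ : ℝ} {g d : E n} {B : E n →L[ℝ] E n}

theorem model_sub_model (hB : (B : E n →ₗ[ℝ] E n).IsSymmetric) (w : E n) :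
    model c g B w - model c g B d = ⟪B d + g, w - d⟫ + 1 / 2 * ⟪w - d, B (w - d)⟫ := by
  have hwd : ⟪B d, w⟫ = ⟪d, B w⟫ := hB d w
  have hdd : ⟪B d, d⟫ = ⟪d, B d⟫ := hB d d
  have hdw : ⟪w, B d⟫ = ⟪d, B w⟫ := by rw [real_inner_comm, hwd]
  simp only [model, map_sub, inner_sub_left, inner_sub_right, inner_add_left, hwd, hdd, hdw]
  ring

theorem IsTrustRegionStep.inner_sub_nonneg (h : IsTrustRegionStep c g B Δ d)
    (hB : (B : E n →ₗ[ℝ] E n).IsSymmetric) {w : E n} (hw : ‖w‖ ≤ Δ) :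
    0 ≤ ⟪B d + g, w - d⟫ := by
  refine nonneg_of_forall_add_mul_nonneg (b := 1 / 2 * ⟪w - d, B (w - d)⟫) fun s hs hs1 => ?_
  have hfeas : ‖d + s • (w - d)‖ ≤ Δ := by
    have := (convex_closedBall (0 : E n) Δ).add_smul_sub_mem (x := d) (y := w)
      (by simpa using h.1) (by simpa using hw) ⟨hs.le, hs1⟩
    simpa using this
  have hmodel := model_sub_model (c := c) (g := g) (d := d) hB (d + s • (w - d))
  simp only [add_sub_cancel_left, map_smul, real_inner_smul_left, real_inner_smul_right] at hmodel
  have : 0 ≤ s * (⟪B d + g, w - d⟫ + s * (1 / 2 * ⟪w - d, B (w - d)⟫)) := by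
    linarith [h.2 _ hfeas]
  exact nonneg_of_mul_nonneg_right this hs

theorem IsTrustRegionStep.exists_isMultiplier (h : IsTrustRegionStep c g B Δ d) (hΔ : 0 < Δ)
    (hB : (B : E n →ₗ[ℝ] E n).IsSymmetric) : ∃ lam, IsMultiplier g B Δ d lam := by
  obtain ⟨lam, hlam, hstat, hcomp⟩ :=
    exists_eq_neg_smul_of_forall_inner_sub_nonneg hΔ h.1 fun _ => h.inner_sub_nonneg hB
  have hmin : ∀ w, ‖w‖ ≤ Δ → 0 ≤ -(lam * ⟪d, w - d⟫) + 1 / 2 * ⟪w - d, B (w - d)⟫ := by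
    intro w hw
    have := model_sub_model (c := c) (g := g) (d := d) hB w
    rw [hstat, inner_neg_left, real_inner_smul_left] at this
    linarith [h.2 w hw]
  refine ⟨lam, hlam, hstat, hcomp, fun v => ?_⟩
  rcases h.1.lt_or_eq with hlt | heq
  · have hlam0 : lam = 0 := (mul_eq_mul_left_iff.mp hcomp).resolve_left
      (pow_lt_pow_left₀ hlt (norm_nonneg _) two_ne_zero).ne
    subst hlam0
    have := inner_apply_self_nonneg_of_ball (B := B) hlt (fun w hw => by linarith [hmin w hw]) v
    simpa using this
  · exact inner_apply_self_add_nonneg_of_sphere (norm_pos_iff.mp (heq ▸ hΔ))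
      (fun w hw => hmin w (hw.trans heq).le) v

end Subproblem
section SmallestEigenvalue

theorem neg_norm_mul_norm_sq_le_inner {V : Type*} [NormedAddCommGroup V] [InnerProductSpace ℝ V]
    (A : V →L[ℝ] V) (v : V) : -‖A‖ * ‖v‖ ^ 2 ≤ ⟪v, A v⟫ := by
  have hcs := neg_le_of_abs_le (abs_real_inner_le_norm v (A v))
  nlinarith [mul_le_mul_of_nonneg_left (A.le_opNorm v) (norm_nonneg v)]

variable {n : ℕ} [NeZero n] {A B : E n →L[ℝ] E n}

theorem lambdaMin_mul_norm_sq_le_inner (hA : (A : E n →ₗ[ℝ] E n).IsSymmetric) (v : E n) :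
    lambdaMin A * ‖v‖ ^ 2 ≤ ⟪v, A v⟫ := by
  rcases eq_or_ne v 0 with rfl | hv
  · simp
  rw [← le_div_iff₀ (by positivity)]
  have hbdd : BddBelow (Set.range fun x : { x : E n // x ≠ 0 } =>
      (RCLike.re ⟪(A : E n →ₗ[ℝ] E n) x, (x : E n)⟫ / ‖(x : E n)‖ ^ 2 : ℝ)) := by
    refine ⟨-‖A‖, ?_⟩
    rintro _ ⟨x, rfl⟩
    exact neg_le_of_abs_le (A.rayleighQuotient_le_norm (x : E n))
  calc lambdaMin A
      ≤ ⨅ x : { x : E n // x ≠ 0 },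
          RCLike.re ⟪(A : E n →ₗ[ℝ] E n) x, (x : E n)⟫ / ‖(x : E n)‖ ^ 2 :=
        csInf_le (Module.End.finite_hasEigenvalue _).bddBelow
          hA.hasEigenvalue_iInf_of_finiteDimensional
    _ ≤ ⟪v, A v⟫ / ‖v‖ ^ 2 :=
        (ciInf_le hbdd ⟨v, hv⟩).trans_eq (by simp [real_inner_comm])

theorem le_lambdaMin (hA : (A : E n →ₗ[ℝ] E n).IsSymmetric) {c : ℝ}
    (h : ∀ v, c * ‖v‖ ^ 2 ≤ ⟪v, A v⟫) : c ≤ lambdaMin A := by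
  refine le_csInf ⟨_, hA.hasEigenvalue_iInf_of_finiteDimensional⟩ fun b hb => ?_
  obtain ⟨w, hw⟩ := hb.exists_hasEigenvector
  have hAw : A w = b • w := hw.apply_eq_smul
  have hcw := h w
  rw [hAw, inner_smul_right, real_inner_self_eq_norm_sq] at hcw
  have hwpos : 0 < ‖w‖ := norm_pos_iff.mpr hw.2
  exact le_of_mul_le_mul_right hcw (by positivity)

theorem lambdaMin_sub_norm_sub_le (hA : (A : E n →ₗ[ℝ] E n).IsSymmetric)
    (hB : (B : E n →ₗ[ℝ] E n).IsSymmetric) : lambdaMin A - ‖A - B‖ ≤ lambdaMin B := by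
  refine le_lambdaMin hB fun v => ?_
  have hAv := lambdaMin_mul_norm_sq_le_inner hA v
  have hBA := neg_norm_mul_norm_sq_le_inner (B - A) v
  rw [norm_sub_rev, _root_.sub_apply, inner_sub_right] at hBA
  linarith

theorem abs_lambdaMin_sub_lambdaMin_le (hA : (A : E n →ₗ[ℝ] E n).IsSymmetric)
    (hB : (B : E n →ₗ[ℝ] E n).IsSymmetric) : |lambdaMin A - lambdaMin B| ≤ ‖A - B‖ := by
  have hAB := lambdaMin_sub_norm_sub_le hA hB
  have hBA := lambdaMin_sub_norm_sub_le hB hA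
  rw [norm_sub_rev] at hBA
  exact abs_le.mpr ⟨by linarith, by linarith⟩

end SmallestEigenvalue

section SecondOrderCalculus

variable {n : ℕ} {F : E n → ℝ} {L₀ L₁ M₀ M₁ δ Δ : ℝ}

theorem TwiceDifferentiable.hasGradientAt (h : TwiceDifferentiable F) (x : E n) :
    HasGradientAt F (gradient F x) x :=
  (h.1 x).hasGradientAt

theorem TwiceDifferentiable.hasFDerivAt_gradient (h : TwiceDifferentiable F) (x : E n) :
    HasFDerivAt (gradient F) (hessian F x) x :=
  (h.2 x).hasFDerivAt

theorem TwiceDifferentiable.continuous_gradient (h : TwiceDifferentiable F) :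
    Continuous (gradient F) :=
  h.2.continuous

theorem TwiceDifferentiable.isSymmetric_hessian (h : TwiceDifferentiable F) (x : E n) :
    (hessian F x : E n →ₗ[ℝ] E n).IsSymmetric := by
  intro v w
  have hF : ∀ y, HasFDerivAt F (innerSL ℝ (gradient F y)) y := fun y =>
    (h.hasGradientAt y).hasFDerivAt
  have hgrad : HasFDerivAt (fun y => innerSL ℝ (gradient F y)) ((innerSL ℝ).comp (hessian F x)) x :=
    (innerSL ℝ).hasFDerivAt.comp x (h.hasFDerivAt_gradient x)
  have hsymm := second_derivative_symmetric hF hgrad v w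
  simp only [ContinuousLinearMap.comp_apply, innerSL_apply_apply] at hsymm
  simp only [ContinuousLinearMap.coe_coe]
  rw [hsymm, real_inner_comm]

theorem SecondOrderGeneralizedSmooth.norm_gradient_add_sub_le
    (h : SecondOrderGeneralizedSmooth F δ M₀ M₁) (hM₀ : 0 ≤ M₀) (hM₁ : 0 ≤ M₁) {d : E n}
    (hd : ‖d‖ ≤ δ) (x : E n) :
    ‖gradient F (x + d) - gradient F x - hessian F x d‖
      ≤ (M₀ + M₁ * ‖gradient F x‖) * ‖d‖ ^ 2 := by
  have hhess : ∀ y ∈ Metric.closedBall x ‖d‖,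
      ‖hessian F y - hessian F x‖ ≤ (M₀ + M₁ * ‖gradient F x‖) * ‖d‖ := by
    intro y hy
    rw [mem_closedBall_iff_norm'] at hy
    rw [norm_sub_rev]
    exact (h.2 x y (hy.trans hd)).trans (by gcongr)
  have := (convex_closedBall x ‖d‖).norm_image_sub_le_of_norm_hasFDerivWithin_le'
    (x := x) (y := x + d) (fun y _ => (h.1.hasFDerivAt_gradient y).hasFDerivWithinAt) hhess
    (by simp) (by simp)
  rwa [add_sub_cancel_left, mul_assoc, ← sq] at this

theorem TwiceDifferentiable.hasFDerivAt_sub_model (h : TwiceDifferentiable F) (x y : E n) :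
    HasFDerivAt (fun y => F (x + y) - model (F x) (gradient F x) (hessian F x) y)
      (innerSL ℝ (gradient F (x + y) - gradient F x - hessian F x y)) y := by
  have hF : HasFDerivAt (fun y => F (x + y)) (innerSL ℝ (gradient F (x + y))) y :=
    (hasFDerivAt_comp_add_left x).mpr (h.hasGradientAt (x + y)).hasFDerivAt
  have hlin : HasFDerivAt (fun y => ⟪gradient F x, y⟫) (innerSL ℝ (gradient F x)) y :=
    (innerSL ℝ (gradient F x)).hasFDerivAt
  have hquad := (hasFDerivAt_id y).inner ℝ ((hessian F x).hasFDerivAt (x := y))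
  refine (hF.sub ((hlin.const_add (F x)).add (hquad.const_mul (1 / 2)))).congr_fderiv ?_
  ext v
  have hsymm : ⟪hessian F x y, v⟫ = ⟪y, hessian F x v⟫ := h.isSymmetric_hessian x y v
  have hcomm : ⟪v, hessian F x y⟫ = ⟪y, hessian F x v⟫ := by rw [real_inner_comm, hsymm]
  simp only [id_eq, _root_.sub_apply, _root_.add_apply, innerSL_apply_apply, _root_.smul_apply,
    ContinuousLinearMap.comp_apply, ContinuousLinearMap.prod_apply, fderivInnerCLM_apply,
    ContinuousLinearMap.id_apply, smul_eq_mul, inner_sub_left, hsymm, hcomm]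
  ring

theorem SecondOrderGeneralizedSmooth.abs_sub_model_le
    (h : SecondOrderGeneralizedSmooth F δ M₀ M₁) (hM₀ : 0 ≤ M₀) (hM₁ : 0 ≤ M₁) {d : E n}
    (hd : ‖d‖ ≤ δ) (x : E n) :
    |F (x + d) - model (F x) (gradient F x) (hessian F x) d|
      ≤ (M₀ + M₁ * ‖gradient F x‖) * ‖d‖ ^ 3 := by
  have hder : ∀ y ∈ Metric.closedBall (0 : E n) ‖d‖,
      ‖innerSL ℝ (gradient F (x + y) - gradient F x - hessian F x y)‖
        ≤ (M₀ + M₁ * ‖gradient F x‖) * ‖d‖ ^ 2 := by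
    intro y hy
    rw [mem_closedBall_zero_iff] at hy
    rw [innerSL_apply_norm]
    exact (h.norm_gradient_add_sub_le hM₀ hM₁ (hy.trans hd) x).trans (by gcongr)
  have := (convex_closedBall (0 : E n) ‖d‖).norm_image_sub_le_of_norm_hasFDerivWithin_le
    (x := 0) (y := d) (fun y _ => (h.1.hasFDerivAt_sub_model x y).hasFDerivWithinAt) hder
    (by simp) (by simp)
  have hmodel : model (F x) (gradient F x) (hessian F x) 0 = F x := by simp [model]
  rwa [add_zero, sub_zero, hmodel, sub_self, sub_zero, Real.norm_eq_abs, mul_assoc,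
    ← pow_succ] at this

theorem GeneralizedSmooth.norm_gradient_le (h : GeneralizedSmooth F L₀ L₁) (hL₀ : 0 ≤ L₀)
    (hL₁ : 0 ≤ L₁) (hΔ : L₁ * Δ ≤ 1) {x y : E n} (hxy : ‖x - y‖ ≤ Δ) :
    ‖gradient F y‖ ≤ (1 + L₁ * Δ) * ‖gradient F x‖ + L₀ * Δ := by
  have hlip := h.2 x y ((mul_le_mul_of_nonneg_left hxy hL₁).trans hΔ)
  have hmono : (L₀ + L₁ * ‖gradient F x‖) * ‖x - y‖ ≤ (L₀ + L₁ * ‖gradient F x‖) * Δ := by gcongr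
  have htri := norm_sub_norm_le (gradient F y) (gradient F x)
  rw [norm_sub_rev] at htri
  linarith

theorem SecondOrderGeneralizedSmooth.continuous_hessian
    (h : SecondOrderGeneralizedSmooth F δ M₀ M₁) (hδ : 0 < δ) : Continuous (hessian F) := by
  refine continuous_iff_continuousAt.mpr fun x =>
    continuousAt_of_locally_lipschitz hδ (M₀ + M₁ * ‖gradient F x‖) fun y hy => ?_
  rw [dist_eq_norm, norm_sub_rev] at hy
  rw [dist_eq_norm, dist_eq_norm, norm_sub_rev, norm_sub_rev y]
  exact h.2 x y hy.le

theorem SecondOrderGeneralizedSmooth.continuous_lambdaMin_hessian [NeZero n]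
    (h : SecondOrderGeneralizedSmooth F δ M₀ M₁) (hδ : 0 < δ) :
    Continuous fun x => lambdaMin (hessian F x) := by
  refine continuous_iff_continuousAt.mpr fun x => tendsto_iff_norm_sub_tendsto_zero.mpr ?_
  have hhess := tendsto_iff_norm_sub_tendsto_zero.mp ((h.continuous_hessian hδ).tendsto x)
  exact squeeze_zero (fun _ => norm_nonneg _) (fun y => abs_lambdaMin_sub_lambdaMin_le
    (h.1.isSymmetric_hessian y) (h.1.isSymmetric_hessian x)) hhess

end SecondOrderCalculus
section StepProgress

variable {n : ℕ} {F : E n → ℝ} {M₀ M₁ δ Δ lam : ℝ} {x y g : E n} {H : E n →L[ℝ] E n}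

/-- The part of the progress guarantee of a trust region step from `x` that is not decrease of `F`:
the errors of the gradient estimator `g` and of the Hessian estimator `H`, and the error of the
second-order Taylor expansion. -/
noncomputable def stepError (F : E n → ℝ) (M₀ M₁ Δ : ℝ) (x g : E n) (H : E n →L[ℝ] E n) : ℝ :=
  3 * Δ * ‖g - gradient F x‖ + 2 * Δ ^ 2 * ‖H - hessian F x‖
    + 3 * Δ ^ 3 * (M₀ + M₁ * ‖gradient F x‖)

theorem IsMultiplier.mul_sq_le (hlam : IsMultiplier g H Δ (y - x) lam)
    (h : SecondOrderGeneralizedSmooth F δ M₀ M₁) (hM₀ : 0 ≤ M₀) (hM₁ : 0 ≤ M₁) (hΔδ : Δ ≤ δ)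
    (hd : ‖y - x‖ ≤ Δ) :
    lam * Δ ^ 2 / 2 ≤ F x - F y + Δ * ‖g - gradient F x‖ + Δ ^ 2 * ‖H - hessian F x‖ / 2
      + (M₀ + M₁ * ‖gradient F x‖) * Δ ^ 3 := by
  set d := y - x
  have htaylor : F y - model (F x) (gradient F x) (hessian F x) d
      ≤ (M₀ + M₁ * ‖gradient F x‖) * Δ ^ 3 := by
    have := le_of_abs_le (h.abs_sub_model_le hM₀ hM₁ (hd.trans hΔδ) x)
    rw [add_sub_cancel] at this
    exact this.trans (by gcongr)
  have hmodel : model (F x) (gradient F x) (hessian F x) d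
      = F x - lam * Δ ^ 2 - 1 / 2 * ⟪d, H d⟫ - ⟪g - gradient F x, d⟫
        - 1 / 2 * ⟪d, (H - hessian F x) d⟫ := by
    have hstat : ⟪d, H d⟫ + ⟪g, d⟫ = -(lam * Δ ^ 2) := by
      rw [real_inner_comm, ← inner_add_left, hlam.stationary, inner_neg_left, real_inner_smul_left,
        real_inner_self_eq_norm_sq, hlam.complementary]
    simp only [model, inner_sub_left, inner_sub_right, _root_.sub_apply]
    linarith
  have hpsd := hlam.posSemidef d
  rw [hlam.complementary] at hpsd
  have hgrad : -(Δ * ‖g - gradient F x‖) ≤ ⟪g - gradient F x, d⟫ := by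
    have hcs := neg_le_of_abs_le (abs_real_inner_le_norm (g - gradient F x) d)
    nlinarith [mul_le_mul_of_nonneg_left hd (norm_nonneg (g - gradient F x))]
  have hhess : -(Δ ^ 2 * ‖H - hessian F x‖) ≤ ⟪d, (H - hessian F x) d⟫ := by
    have hnorm : ‖H - hessian F x‖ * ‖d‖ ^ 2 ≤ ‖H - hessian F x‖ * Δ ^ 2 := by gcongr
    linarith [neg_norm_mul_norm_sq_le_inner (H - hessian F x) d]
  linarith

theorem IsMultiplier.norm_gradient_le (hlam : IsMultiplier g H Δ (y - x) lam)
    (h : SecondOrderGeneralizedSmooth F δ M₀ M₁) (hM₀ : 0 ≤ M₀) (hM₁ : 0 ≤ M₁) (hΔδ : Δ ≤ δ)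
    (hd : ‖y - x‖ ≤ Δ) :
    ‖gradient F y‖ ≤ (M₀ + M₁ * ‖gradient F x‖) * Δ ^ 2 + ‖g - gradient F x‖
      + ‖H - hessian F x‖ * Δ + lam * Δ := by
  set d := y - x
  have htaylor : ‖gradient F y - gradient F x - hessian F x d‖
      ≤ (M₀ + M₁ * ‖gradient F x‖) * Δ ^ 2 := by
    have := h.norm_gradient_add_sub_le hM₀ hM₁ (hd.trans hΔδ) x
    rw [add_sub_cancel] at this
    exact this.trans (by gcongr)
  have hHd : ‖(H - hessian F x) d‖ ≤ ‖H - hessian F x‖ * Δ :=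
    (H - hessian F x).le_opNorm_of_le hd
  have hlamd : ‖lam • d‖ ≤ lam * Δ := by
    rw [norm_smul, Real.norm_of_nonneg hlam.nonneg]
    exact mul_le_mul_of_nonneg_left hd hlam.nonneg
  have hsplit : gradient F y = (gradient F y - gradient F x - hessian F x d)
      - (g - gradient F x) - (H - hessian F x) d - lam • d := by
    rw [← neg_eq_iff_eq_neg.mpr hlam.stationary, _root_.sub_apply]
    abel
  rw [hsplit]
  exact (norm_sub_le_of_le (norm_sub_le_of_le (norm_sub_le_of_le htaylor le_rfl) hHd) hlamd)

theorem IsMultiplier.neg_lambdaMin_le [NeZero n] (hlam : IsMultiplier g H Δ (y - x) lam)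
    (h : SecondOrderGeneralizedSmooth F δ M₀ M₁) (hM₀ : 0 ≤ M₀) (hM₁ : 0 ≤ M₁) (hΔδ : Δ ≤ δ)
    (hd : ‖y - x‖ ≤ Δ) :
    -lambdaMin (hessian F y)
      ≤ lam + ‖H - hessian F x‖ + (M₀ + M₁ * ‖gradient F x‖) * Δ := by
  have hlip : ‖hessian F y - hessian F x‖ ≤ (M₀ + M₁ * ‖gradient F x‖) * Δ := by
    rw [norm_sub_rev] at hd ⊢
    exact (h.2 x y (hd.trans hΔδ)).trans (by gcongr)
  rw [neg_le]
  refine le_lambdaMin (h.1.isSymmetric_hessian y) fun v => ?_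
  have hpsd := hlam.posSemidef v
  have hH := neg_norm_mul_norm_sq_le_inner (hessian F x - H) v
  have hF := neg_norm_mul_norm_sq_le_inner (hessian F y - hessian F x) v
  have hlipv := mul_le_mul_of_nonneg_right hlip (sq_nonneg ‖v‖)
  rw [norm_sub_rev] at hH
  simp only [_root_.sub_apply, inner_sub_right] at hH hF
  linarith

theorem IsTrustRegionStep.radius_mul_norm_gradient_le
    (hstep : IsTrustRegionStep (F x) g H Δ (y - x)) (hH : (H : E n →ₗ[ℝ] E n).IsSymmetric)
    (h : SecondOrderGeneralizedSmooth F δ M₀ M₁) (hM₀ : 0 ≤ M₀) (hM₁ : 0 ≤ M₁) (hΔ : 0 < Δ)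
    (hΔδ : Δ ≤ δ) :
    Δ * ‖gradient F y‖ ≤ 2 * (F x - F y) + stepError F M₀ M₁ Δ x g H := by
  obtain ⟨lam, hlam⟩ := hstep.exists_isMultiplier hΔ hH
  have hdecrease := hlam.mul_sq_le h hM₀ hM₁ hΔδ hstep.1
  have hgrad := mul_le_mul_of_nonneg_left (hlam.norm_gradient_le h hM₀ hM₁ hΔδ hstep.1) hΔ.le
  unfold stepError
  linarith

theorem IsTrustRegionStep.neg_radius_sq_mul_lambdaMin_le [NeZero n]
    (hstep : IsTrustRegionStep (F x) g H Δ (y - x)) (hH : (H : E n →ₗ[ℝ] E n).IsSymmetric)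
    (h : SecondOrderGeneralizedSmooth F δ M₀ M₁) (hM₀ : 0 ≤ M₀) (hM₁ : 0 ≤ M₁) (hΔ : 0 < Δ)
    (hΔδ : Δ ≤ δ) :
    -(Δ ^ 2 * lambdaMin (hessian F y)) ≤ 2 * (F x - F y) + stepError F M₀ M₁ Δ x g H := by
  obtain ⟨lam, hlam⟩ := hstep.exists_isMultiplier hΔ hH
  have hdecrease := hlam.mul_sq_le h hM₀ hM₁ hΔδ hstep.1
  have hcurv := mul_le_mul_of_nonneg_left (hlam.neg_lambdaMin_le h hM₀ hM₁ hΔδ hstep.1)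
    (sq_nonneg Δ)
  have hgrad : 0 ≤ Δ * ‖g - gradient F x‖ := by positivity
  unfold stepError
  linarith

end StepProgress

section Trace

variable {V : Type*} [NormedAddCommGroup V] [InnerProductSpace ℝ V] [FiniteDimensional ℝ V]
  {A X Y : Module.End ℝ V}

theorem pow_apply_eigenvectorBasis (hX : X.IsSymmetric) (k : ℕ)
    (i : Fin (Module.finrank ℝ V)) :
    (X ^ k) (hX.eigenvectorBasis rfl i)
      = hX.eigenvalues rfl i ^ k • hX.eigenvectorBasis rfl i := by
  induction k with
  | zero => simp
  | succ k ih =>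
    have happly : X (hX.eigenvectorBasis rfl i)
        = hX.eigenvalues rfl i • hX.eigenvectorBasis rfl i := hX.apply_eigenvectorBasis rfl i
    rw [pow_succ, Module.End.mul_apply, happly, map_smul, ih, smul_smul, pow_succ, mul_comm]

theorem inner_pow_apply_self (hX : X.IsSymmetric) (k : ℕ) (z : V) :
    ⟪z, (X ^ k) z⟫ = ∑ i, hX.eigenvalues rfl i ^ k * ⟪hX.eigenvectorBasis rfl i, z⟫ ^ 2 := by
  rw [← OrthonormalBasis.sum_inner_mul_inner (hX.eigenvectorBasis rfl)]
  refine Finset.sum_congr rfl fun i _ => ?_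
  rw [← hX.pow k, pow_apply_eigenvectorBasis hX, real_inner_smul_left, real_inner_comm]
  ring

theorem trace_pow_eq_sum_eigenvalues_pow (hX : X.IsSymmetric) (k : ℕ) :
    LinearMap.trace ℝ V (X ^ k) = ∑ i, hX.eigenvalues rfl i ^ k := by
  rw [LinearMap.trace_eq_sum_inner _ (hX.eigenvectorBasis rfl)]
  refine Finset.sum_congr rfl fun i _ => ?_
  rw [pow_apply_eigenvectorBasis hX, inner_smul_right, real_inner_self_eq_norm_sq,
    OrthonormalBasis.norm_eq_one, one_pow, mul_one]

theorem trace_pow_nonneg (hX : X.IsSymmetric) {k : ℕ} (hk : Even k) :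
    0 ≤ LinearMap.trace ℝ V (X ^ k) := by
  rw [trace_pow_eq_sum_eigenvalues_pow hX]
  exact Finset.sum_nonneg fun i _ => hk.pow_nonneg _

theorem trace_mul_pow_mul_mul_pow (hA : A.IsSymmetric) (hX : X.IsSymmetric) (hY : Y.IsSymmetric)
    (p q : ℕ) :
    LinearMap.trace ℝ V (A * X ^ p * (A * Y ^ q))
      = ∑ j, ∑ i, hX.eigenvalues rfl i ^ p * hY.eigenvalues rfl j ^ q
        * ⟪hX.eigenvectorBasis rfl i, A (hY.eigenvectorBasis rfl j)⟫ ^ 2 := by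
  rw [LinearMap.trace_eq_sum_inner _ (hY.eigenvectorBasis rfl)]
  refine Finset.sum_congr rfl fun j _ => ?_
  simp only [Module.End.mul_apply]
  rw [pow_apply_eigenvectorBasis hY, map_smul, map_smul, map_smul, inner_smul_right, ← hA,
    inner_pow_apply_self hX, Finset.mul_sum]
  exact Finset.sum_congr rfl fun i _ => by ring

theorem pow_mul_pow_add_pow_mul_pow_le {a b : ℝ} {p q : ℕ} (h : Even (p + q)) :
    a ^ p * b ^ q + a ^ q * b ^ p ≤ a ^ (p + q) + b ^ (p + q) := by
  have hmono : 0 ≤ (|a| ^ p - |b| ^ p) * (|a| ^ q - |b| ^ q) := by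
    rcases le_total |a| |b| with hab | hba
    · exact mul_nonneg_of_nonpos_of_nonpos (sub_nonpos.mpr (by gcongr)) (sub_nonpos.mpr (by gcongr))
    · exact mul_nonneg (sub_nonneg.mpr (by gcongr)) (sub_nonneg.mpr (by gcongr))
  have hle_abs (p q : ℕ) : a ^ p * b ^ q ≤ |a| ^ p * |b| ^ q := by
    rw [← abs_pow, ← abs_pow, ← abs_mul]
    exact le_abs_self _
  rw [← h.pow_abs a, ← h.pow_abs b, pow_add, pow_add]
  linarith [hle_abs p q, hle_abs q p]

theorem trace_mul_pow_mul_mul_pow_add_le (hA : A.IsSymmetric) (hX : X.IsSymmetric)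
    (hY : Y.IsSymmetric) {p q : ℕ} (h : Even (p + q)) :
    LinearMap.trace ℝ V (A * X ^ p * (A * Y ^ q)) + LinearMap.trace ℝ V (A * X ^ q * (A * Y ^ p))
      ≤ LinearMap.trace ℝ V (A * A * X ^ (p + q)) + LinearMap.trace ℝ V (A * A * Y ^ (p + q)) := by
  have htraceX : LinearMap.trace ℝ V (A * A * X ^ (p + q))
      = LinearMap.trace ℝ V (A * X ^ (p + q) * (A * Y ^ 0)) := by
    rw [pow_zero, mul_one, mul_assoc, LinearMap.trace_mul_comm, mul_assoc]
  have htraceY : LinearMap.trace ℝ V (A * A * Y ^ (p + q))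
      = LinearMap.trace ℝ V (A * X ^ 0 * (A * Y ^ (p + q))) := by
    rw [pow_zero, mul_one, mul_assoc]
  simp only [htraceX, htraceY, trace_mul_pow_mul_mul_pow hA hX hY, ← Finset.sum_add_distrib,
    ← add_mul]
  refine Finset.sum_le_sum fun j _ => Finset.sum_le_sum fun i _ =>
    mul_le_mul_of_nonneg_right ?_ (sq_nonneg _)
  rw [pow_zero, mul_one, pow_zero, one_mul]
  exact pow_mul_pow_add_pow_mul_pow_le h

theorem trace_mul_self_mul_pow_le (hA : A.IsSymmetric) (hX : X.IsSymmetric) {k : ℕ} (hk : Even k)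
    {c : ℝ} (hc : ∀ v, ‖A v‖ ≤ c * ‖v‖) :
    LinearMap.trace ℝ V (A * A * X ^ k) ≤ c ^ 2 * LinearMap.trace ℝ V (X ^ k) := by
  rw [trace_pow_eq_sum_eigenvalues_pow hX, LinearMap.trace_eq_sum_inner _ (hX.eigenvectorBasis rfl),
    Finset.mul_sum]
  refine Finset.sum_le_sum fun i _ => ?_
  have hnorm : ‖A (hX.eigenvectorBasis rfl i)‖ ≤ c := by
    simpa only [OrthonormalBasis.norm_eq_one, mul_one] using hc (hX.eigenvectorBasis rfl i)
  rw [Module.End.mul_apply, Module.End.mul_apply, pow_apply_eigenvectorBasis hX, map_smul, map_smul,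
    inner_smul_right, ← hA, real_inner_self_eq_norm_sq, mul_comm]
  exact mul_le_mul_of_nonneg_right (by gcongr) (hk.pow_nonneg _)

theorem pow_succ_sub_pow_succ_eq_sum {R : Type*} [Ring R] (x y : R) (k : ℕ) :
    x ^ (k + 1) - y ^ (k + 1) = ∑ j ∈ Finset.range (k + 1), x ^ j * (x - y) * y ^ (k - j) := by
  induction k with
  | zero => simp
  | succ k ih =>
    have hshift : ∑ j ∈ Finset.range (k + 1), x ^ (j + 1) * (x - y) * y ^ (k + 1 - (j + 1))
        = x * (x ^ (k + 1) - y ^ (k + 1)) := by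
      rw [ih, Finset.mul_sum]
      refine Finset.sum_congr rfl fun j _ => ?_
      rw [Nat.add_sub_add_right, pow_succ' x j]
      simp only [mul_assoc]
    rw [Finset.sum_range_succ', hshift, pow_zero, one_mul, Nat.sub_zero, mul_sub, sub_mul,
      ← pow_succ', ← pow_succ']
    abel

theorem trace_mul_pow_succ_sub_le (hA : A.IsSymmetric) (hX : X.IsSymmetric) (hY : Y.IsSymmetric)
    {s : ℝ} (hs : s * s = 1) (hXY : X - Y = (2 * s) • A) {k : ℕ} (hk : Even k) :
    s * LinearMap.trace ℝ V (A * X ^ (k + 1)) - s * LinearMap.trace ℝ V (A * Y ^ (k + 1))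
      ≤ (k + 1) * (LinearMap.trace ℝ V (A * A * X ^ k) + LinearMap.trace ℝ V (A * A * Y ^ k)) := by
  set φ : ℕ → ℝ := fun j => LinearMap.trace ℝ V (A * X ^ j * (A * Y ^ (k - j))) with hφ
  have htelescope : s * LinearMap.trace ℝ V (A * X ^ (k + 1))
      - s * LinearMap.trace ℝ V (A * Y ^ (k + 1)) = 2 * ∑ j ∈ Finset.range (k + 1), φ j := by
    rw [← mul_sub, ← map_sub, ← mul_sub, pow_succ_sub_pow_succ_eq_sum, hXY, Finset.mul_sum,
      map_sum, Finset.mul_sum, Finset.mul_sum]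
    refine Finset.sum_congr rfl fun j _ => ?_
    rw [mul_smul_comm, smul_mul_assoc, mul_smul_comm, map_smul, smul_eq_mul, ← mul_assoc,
      mul_left_comm, hs, mul_one]
    simp only [hφ, mul_assoc]
  have hpair : ∀ j ∈ Finset.range (k + 1), φ j + φ (k - j)
      ≤ LinearMap.trace ℝ V (A * A * X ^ k) + LinearMap.trace ℝ V (A * A * Y ^ k) := fun j hj => by
    have hjk : j + (k - j) = k := by grind
    have hle := trace_mul_pow_mul_mul_pow_add_le hA hX hY (p := j) (q := k - j) (by rwa [hjk])
    rw [hjk] at hle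
    simp only [hφ]
    rwa [show k - (k - j) = j by omega]
  have hreflect : ∑ j ∈ Finset.range (k + 1), φ (k - j) = ∑ j ∈ Finset.range (k + 1), φ j :=
    Finset.sum_range_reflect φ (k + 1)
  rw [htelescope, two_mul]
  nth_rewrite 2 [← hreflect]
  rw [← Finset.sum_add_distrib]
  refine (Finset.sum_le_sum hpair).trans_eq ?_
  rw [Finset.sum_const, Finset.card_range, nsmul_eq_mul, Nat.cast_succ]

theorem norm_le_abs_of_forall_abs_eigenvalues_le {T : V →L[ℝ] V}
    (hT : (T : Module.End ℝ V).IsSymmetric) {r : ℝ}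
    (hr : ∀ i, |hT.eigenvalues rfl i| ≤ |r|) : ‖T‖ ≤ |r| := by
  refine T.opNorm_le_bound (abs_nonneg _) fun v => ?_
  rw [← sq_le_sq₀ (norm_nonneg _) (by positivity), mul_pow, sq_abs]
  have hTv : ‖T v‖ ^ 2 = ⟪v, ((T : Module.End ℝ V) ^ 2) v⟫ := by
    rw [pow_two (T : Module.End ℝ V), Module.End.mul_apply, ← hT, real_inner_self_eq_norm_sq]
    rfl
  have hv : ‖v‖ ^ 2 = ∑ i, ⟪hT.eigenvectorBasis rfl i, v⟫ ^ 2 := by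
    simpa [real_inner_self_eq_norm_sq] using inner_pow_apply_self hT 0 v
  rw [hTv, inner_pow_apply_self hT, hv, Finset.mul_sum]
  exact Finset.sum_le_sum fun i _ => mul_le_mul_of_nonneg_right (sq_le_sq.mpr (hr i)) (sq_nonneg _)

theorem norm_pow_le_trace_pow [Nontrivial V] {T : V →L[ℝ] V}
    (hT : (T : Module.End ℝ V).IsSymmetric) {k : ℕ} (hk : Even k) :
    ‖T‖ ^ k ≤ LinearMap.trace ℝ V ((T : Module.End ℝ V) ^ k) := by
  have : Nonempty (Fin (Module.finrank ℝ V)) := ⟨⟨0, Module.finrank_pos⟩⟩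
  obtain ⟨j, hj⟩ := Finite.exists_max fun i => |hT.eigenvalues rfl i|
  rw [trace_pow_eq_sum_eigenvalues_pow hT]
  calc ‖T‖ ^ k ≤ |hT.eigenvalues rfl j| ^ k := by
        gcongr
        exact norm_le_abs_of_forall_abs_eigenvalues_le hT hj
    _ = hT.eigenvalues rfl j ^ k := hk.pow_abs _
    _ ≤ ∑ i, hT.eigenvalues rfl i ^ k :=
        Finset.single_le_sum (f := fun i => hT.eigenvalues rfl i ^ k)
          (fun i _ => hk.pow_nonneg _) (Finset.mem_univ j)

end Trace

section SignedSum

variable {ι : Type*} [Fintype ι]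

/-- The sum of the vectors `A i` with signs `σ i`. Averaging over all sign patterns `σ : ι → ℤˣ`
gives expectations of Rademacher series. -/
def signedSum {M : Type*} [AddCommGroup M] [Module ℝ M] (A : ι → M) (σ : ι → ℤˣ) : M :=
  ∑ i, ((σ i : ℤ) : ℝ) • A i

theorem map_signedSum {M N : Type*} [AddCommGroup M] [Module ℝ M] [AddCommGroup N] [Module ℝ N]
    (f : M →ₗ[ℝ] N) (A : ι → M) (σ : ι → ℤˣ) :
    f (signedSum A σ) = signedSum (fun i => f (A i)) σ := by
  simp only [signedSum, map_sum, map_smul]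

theorem signedSum_sub_signedSum_flip [DecidableEq ι] {M : Type*} [AddCommGroup M] [Module ℝ M]
    (A : ι → M) (σ : ι → ℤˣ) (i : ι) :
    signedSum A σ - signedSum A (σ * Pi.mulSingle i (-1)) = (2 * ((σ i : ℤ) : ℝ)) • A i := by
  simp only [signedSum]
  rw [← Finset.sum_sub_distrib, Finset.sum_eq_single i]
  · rw [← sub_smul]
    simp [two_mul]
  · intro j _ hj
    simp [Pi.mulSingle_eq_of_ne hj]
  · simp

theorem intUnit_cast_mul_self (u : ℤˣ) : ((u : ℤ) : ℝ) * ((u : ℤ) : ℝ) = 1 := by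
  rcases Int.units_eq_one_or u with rfl | rfl <;> simp

variable {V : Type*} [NormedAddCommGroup V] [InnerProductSpace ℝ V]

theorem isSymmetric_signedSum {A : ι → Module.End ℝ V} (hA : ∀ i, (A i).IsSymmetric)
    (σ : ι → ℤˣ) : (signedSum A σ).IsSymmetric :=
  LinearMap.isSymmetric_sum _ fun i _ => (hA i).smul (RCLike.conj_to_real)

variable [FiniteDimensional ℝ V] [DecidableEq ι]

/- Flipping the sign `σ i` permutes the sign patterns and changes the sign of the summand, so twice
the left-hand side is a sum of differences of powers of two operators that differ by
`± 2 • A i`. -/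
theorem sum_sign_mul_trace_mul_pow_succ_le {A : ι → Module.End ℝ V} (hA : ∀ i, (A i).IsSymmetric)
    {k : ℕ} (hk : Even k) (i : ι) :
    ∑ σ : ι → ℤˣ, ((σ i : ℤ) : ℝ) * LinearMap.trace ℝ V (A i * signedSum A σ ^ (k + 1))
      ≤ (k + 1) * ∑ σ : ι → ℤˣ, LinearMap.trace ℝ V (A i * A i * signedSum A σ ^ k) := by
  set flip : ι → ℤˣ := Pi.mulSingle i (-1)
  have sum_flip (φ : (ι → ℤˣ) → ℝ) : ∑ σ, φ (σ * flip) = ∑ σ, φ σ :=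
    Equiv.sum_comp (Equiv.mulRight flip) φ
  have hpairs := Finset.sum_le_sum fun σ (_ : σ ∈ Finset.univ) =>
    trace_mul_pow_succ_sub_le (hA i) (isSymmetric_signedSum hA σ)
      (isSymmetric_signedSum hA (σ * flip)) (intUnit_cast_mul_self (σ i))
      (signedSum_sub_signedSum_flip A σ i) hk
  have hneg : ∑ σ : ι → ℤˣ,
      ((σ i : ℤ) : ℝ) * LinearMap.trace ℝ V (A i * signedSum A (σ * flip) ^ (k + 1))
      = -∑ σ : ι → ℤˣ, ((σ i : ℤ) : ℝ) * LinearMap.trace ℝ V (A i * signedSum A σ ^ (k + 1)) := by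
    rw [← sum_flip fun σ => ((σ i : ℤ) : ℝ) * LinearMap.trace ℝ V (A i * signedSum A σ ^ (k + 1)),
      ← Finset.sum_neg_distrib]
    refine Finset.sum_congr rfl fun σ _ => ?_
    simp [flip]
  rw [Finset.sum_sub_distrib, hneg, ← Finset.mul_sum, Finset.sum_add_distrib,
    sum_flip fun σ => LinearMap.trace ℝ V (A i * A i * signedSum A σ ^ k)] at hpairs
  linarith

theorem sum_trace_signedSum_pow_add_two_le {A : ι → Module.End ℝ V} (hA : ∀ i, (A i).IsSymmetric)
    {c : ι → ℝ} (hc : ∀ i v, ‖A i v‖ ≤ c i * ‖v‖) {k : ℕ} (hk : Even k) :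
    ∑ σ : ι → ℤˣ, LinearMap.trace ℝ V (signedSum A σ ^ (k + 2))
      ≤ (k + 1) * (∑ i, c i ^ 2) * ∑ σ : ι → ℤˣ, LinearMap.trace ℝ V (signedSum A σ ^ k) := by
  have hexpand (σ : ι → ℤˣ) : LinearMap.trace ℝ V (signedSum A σ ^ (k + 2))
      = ∑ i, ((σ i : ℤ) : ℝ) * LinearMap.trace ℝ V (A i * signedSum A σ ^ (k + 1)) := by
    rw [pow_succ']
    nth_rewrite 1 [signedSum]
    rw [Finset.sum_mul, map_sum]
    exact Finset.sum_congr rfl fun i _ => by rw [smul_mul_assoc, map_smul, smul_eq_mul]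
  simp only [hexpand]
  rw [Finset.sum_comm, mul_assoc, Finset.sum_mul, Finset.mul_sum]
  refine Finset.sum_le_sum fun i _ => (sum_sign_mul_trace_mul_pow_succ_le hA hk i).trans ?_
  rw [Finset.mul_sum (a := c i ^ 2)]
  gcongr with σ
  exact trace_mul_self_mul_pow_le (hA i) (isSymmetric_signedSum hA σ) hk (hc i)

theorem sum_trace_signedSum_pow_le {A : ι → Module.End ℝ V} (hA : ∀ i, (A i).IsSymmetric)
    {c : ι → ℝ} (hc : ∀ i v, ‖A i v‖ ≤ c i * ‖v‖) {p r : ℕ} (hr : r ≤ p) :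
    ∑ σ : ι → ℤˣ, LinearMap.trace ℝ V (signedSum A σ ^ (2 * r))
      ≤ (2 * p * ∑ i, c i ^ 2) ^ r * (Fintype.card (ι → ℤˣ) * Module.finrank ℝ V) := by
  induction r with
  | zero => simp
  | succ r ih =>
    have hfactor : ((2 * r : ℕ) : ℝ) + 1 ≤ 2 * p := by exact_mod_cast (by omega)
    have htrace : 0 ≤ ∑ σ : ι → ℤˣ, LinearMap.trace ℝ V (signedSum A σ ^ (2 * r)) :=
      Finset.sum_nonneg fun σ _ => trace_pow_nonneg (isSymmetric_signedSum hA σ) (even_two_mul r)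
    calc ∑ σ : ι → ℤˣ, LinearMap.trace ℝ V (signedSum A σ ^ (2 * (r + 1)))
        ≤ ((2 * r : ℕ) + 1) * (∑ i, c i ^ 2)
            * ∑ σ : ι → ℤˣ, LinearMap.trace ℝ V (signedSum A σ ^ (2 * r)) :=
          sum_trace_signedSum_pow_add_two_le hA hc (even_two_mul r)
      _ ≤ 2 * p * (∑ i, c i ^ 2)
            * ((2 * p * ∑ i, c i ^ 2) ^ r * (Fintype.card (ι → ℤˣ) * Module.finrank ℝ V)) := by
          gcongr
          exact ih (by omega)
      _ = (2 * p * ∑ i, c i ^ 2) ^ (r + 1) * (Fintype.card (ι → ℤˣ) * Module.finrank ℝ V) := by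
          ring

theorem sum_norm_signedSum_pow_le [Nontrivial V] {A : ι → V →L[ℝ] V}
    (hA : ∀ i, (A i : Module.End ℝ V).IsSymmetric) (p : ℕ) :
    ∑ σ : ι → ℤˣ, ‖signedSum A σ‖ ^ (2 * p)
      ≤ (2 * p * ∑ i, ‖A i‖ ^ 2) ^ p * (Fintype.card (ι → ℤˣ) * Module.finrank ℝ V) := by
  refine le_trans (Finset.sum_le_sum fun σ _ => ?_)
    (sum_trace_signedSum_pow_le hA (fun i v => (A i).le_opNorm v) le_rfl)
  have hcoe : ((signedSum A σ : V →L[ℝ] V) : Module.End ℝ V)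
      = signedSum (fun i => (A i : Module.End ℝ V)) σ :=
    map_signedSum (ContinuousLinearMap.coeLM ℝ) A σ
  rw [← hcoe]
  exact norm_pow_le_trace_pow (hcoe ▸ isSymmetric_signedSum hA σ) (even_two_mul p)

theorem sum_norm_sq_signedSum_le_of_log_le (hV : 1 ≤ Module.finrank ℝ V) {A : ι → V →L[ℝ] V}
    (hA : ∀ i, (A i : Module.End ℝ V).IsSymmetric) {p : ℕ} (hp : p ≠ 0)
    (hlog : Real.log (Module.finrank ℝ V) ≤ p) :
    ∑ σ : ι → ℤˣ, ‖signedSum A σ‖ ^ 2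
      ≤ Fintype.card (ι → ℤˣ) * (2 * Real.exp 1 * p * ∑ i, ‖A i‖ ^ 2) := by
  have : Nontrivial V := Module.nontrivial_of_finrank_pos (R := ℝ) hV
  set N := (Fintype.card (ι → ℤˣ) : ℝ)
  have hN : 0 < N := Nat.cast_pos.mpr Fintype.card_pos
  have hdim : (Module.finrank ℝ V : ℝ) ≤ Real.exp 1 ^ p := by
    rwa [← Real.exp_nat_mul, mul_one, ← Real.log_le_iff_le_exp (by exact_mod_cast hV)]
  have hjensen : (N⁻¹ * ∑ σ : ι → ℤˣ, ‖signedSum A σ‖ ^ 2) ^ p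
      ≤ N⁻¹ * ∑ σ : ι → ℤˣ, ‖signedSum A σ‖ ^ (2 * p) := by
    simp only [Finset.mul_sum, pow_mul]
    refine Real.pow_arith_mean_le_arith_mean_pow _ _ _ (fun _ _ => by positivity) ?_
      (fun _ _ => by positivity) p
    rw [Finset.sum_const, nsmul_eq_mul, Finset.card_univ, mul_inv_cancel₀ hN.ne']
  have hpow : (N⁻¹ * ∑ σ : ι → ℤˣ, ‖signedSum A σ‖ ^ 2) ^ p
      ≤ (2 * Real.exp 1 * p * ∑ i, ‖A i‖ ^ 2) ^ p := by
    refine hjensen.trans ?_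
    rw [inv_mul_le_iff₀ hN]
    calc ∑ σ : ι → ℤˣ, ‖signedSum A σ‖ ^ (2 * p)
        ≤ (2 * p * ∑ i, ‖A i‖ ^ 2) ^ p * (N * Module.finrank ℝ V) := sum_norm_signedSum_pow_le hA p
      _ ≤ (2 * p * ∑ i, ‖A i‖ ^ 2) ^ p * (N * Real.exp 1 ^ p) := by gcongr
      _ = N * (2 * Real.exp 1 * p * ∑ i, ‖A i‖ ^ 2) ^ p := by ring
  rw [← inv_mul_le_iff₀ hN]
  exact le_of_pow_le_pow_left₀ hp (by positivity) hpow

theorem sum_norm_sq_signedSum_le (hV : 2 ≤ Module.finrank ℝ V) {A : ι → V →L[ℝ] V}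
    (hA : ∀ i, (A i : Module.End ℝ V).IsSymmetric) :
    ∑ σ : ι → ℤˣ, ‖signedSum A σ‖ ^ 2
      ≤ Fintype.card (ι → ℤˣ) * (14 * Real.log (Module.finrank ℝ V) * ∑ i, ‖A i‖ ^ 2) := by
  set ℓ := Real.log (Module.finrank ℝ V)
  have hℓ : 0.69 ≤ ℓ :=
    (by linarith [Real.log_two_gt_d9] : (0.69 : ℝ) ≤ Real.log 2).trans
      (Real.log_le_log (by norm_num) (by exact_mod_cast hV))
  have hceil : (⌈ℓ⌉₊ : ℝ) ≤ 2.5 * ℓ := by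
    linarith [Nat.ceil_lt_add_one (show 0 ≤ ℓ by linarith)]
  have hexp : Real.exp 1 ≤ 2.8 := Real.exp_one_lt_d9.le.trans (by norm_num)
  refine (sum_norm_sq_signedSum_le_of_log_le (one_le_two.trans hV) hA
    (Nat.ceil_pos.mpr (by linarith)).ne' (Nat.le_ceil ℓ)).trans ?_
  have hconst : 2 * Real.exp 1 * ⌈ℓ⌉₊ ≤ 14 * ℓ :=
    calc 2 * Real.exp 1 * ⌈ℓ⌉₊ ≤ 2 * 2.8 * (2.5 * ℓ) := by gcongr
      _ = 14 * ℓ := by ring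
  exact mul_le_mul_of_nonneg_left (mul_le_mul_of_nonneg_right hconst (by positivity))
    (by positivity)

end SignedSum
section Averages

variable {Ξ ι B H : Type*} [MeasurableSpace Ξ] {P : Measure Ξ}

theorem eLpNorm_two_sq [NormedAddCommGroup B] (Z : Ξ → B) :
    eLpNorm Z 2 P ^ 2 = ∫⁻ s, ‖Z s‖ₑ ^ 2 ∂P := by
  simpa using eLpNorm_nnreal_pow_eq_lintegral (f := Z) (μ := P) (p := 2) two_ne_zero

theorem eLpNorm_two_sq_eq_ofReal_integral [NormedAddCommGroup B] {Z : Ξ → B} (hZ : MemLp Z 2 P) :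
    eLpNorm Z 2 P ^ 2 = ENNReal.ofReal (∫ s, ‖Z s‖ ^ 2 ∂P) := by
  rw [eLpNorm_two_sq, ofReal_integral_eq_lintegral_ofReal (hZ.integrable_norm_pow two_ne_zero)
    (Filter.Eventually.of_forall fun _ => by positivity)]
  simp only [ENNReal.ofReal_pow (norm_nonneg _), ofReal_norm]

theorem eLpNorm_inv_natCast_smul_sq [NormedAddCommGroup B] [NormedSpace ℝ B] {m : ℕ} (hm : m ≠ 0)
    (Z : Ξ → B) :
    eLpNorm (fun s => (m : ℝ)⁻¹ • Z s) 2 P ^ 2 = (m : ENNReal)⁻¹ ^ 2 * eLpNorm Z 2 P ^ 2 := by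
  have hnorm : ‖(m : ℝ)⁻¹‖ₑ = (m : ENNReal)⁻¹ := by
    rw [enorm_inv (Nat.cast_ne_zero.mpr hm), Real.enorm_natCast]
  rw [← hnorm, ← mul_pow, ← eLpNorm_const_smul]
  rfl

theorem inv_natCast_sq_mul_natCast_mul {m : ℕ} (hm : m ≠ 0) (c : ENNReal) :
    (m : ENNReal)⁻¹ ^ 2 * (m * c) = (m : ENNReal)⁻¹ * c := by
  rw [← mul_assoc, sq, mul_assoc (m : ENNReal)⁻¹, ENNReal.inv_mul_cancel
    (Nat.cast_ne_zero.mpr hm) (ENNReal.natCast_ne_top m), mul_one]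

variable [IsProbabilityMeasure P]

theorem enorm_integral_le_eLpNorm_two [NormedAddCommGroup B] [NormedSpace ℝ B] {Z : Ξ → B}
    (hZ : AEStronglyMeasurable Z P) : ‖∫ s, Z s ∂P‖ₑ ≤ eLpNorm Z 2 P :=
  calc ‖∫ s, Z s ∂P‖ₑ ≤ ∫⁻ s, ‖Z s‖ₑ ∂P := enorm_integral_le_lintegral_enorm Z
    _ = eLpNorm Z 1 P := eLpNorm_one_eq_lintegral_enorm.symm
    _ ≤ eLpNorm Z 2 P := eLpNorm_le_eLpNorm_of_exponent_le one_le_two hZ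

theorem enorm_le_eLpNorm_const_sub [NormedAddCommGroup B] [NormedSpace ℝ B] [CompleteSpace B]
    {Z : Ξ → B} (hZ : Integrable Z P) (h0 : ∫ s, Z s ∂P = 0) (z : B) :
    ‖z‖ₑ ≤ eLpNorm (fun s => z - Z s) 2 P := by
  have hmean : ∫ s, (z - Z s) ∂P = z := by
    rw [integral_sub (integrable_const z) hZ, h0, integral_const, probReal_univ, one_smul, sub_zero]
  conv_lhs => rw [← hmean]
  exact enorm_integral_le_eLpNorm_two ((integrable_const z).sub hZ).aestronglyMeasurable

theorem eLpNorm_fst_sub_snd_le [NormedAddCommGroup B] {A : Ξ → B}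
    (hA : AEStronglyMeasurable A P) :
    eLpNorm (fun w : Ξ × Ξ => A w.1 - A w.2) 2 (P.prod P) ≤ 2 * eLpNorm A 2 P := by
  refine (eLpNorm_sub_le hA.comp_fst hA.comp_snd one_le_two).trans_eq ?_
  rw [two_mul]
  congr 1
  · exact eLpNorm_comp_measurePreserving hA measurePreserving_fst
  · exact eLpNorm_comp_measurePreserving hA measurePreserving_snd

section Symmetrization

variable [Fintype ι] [NormedAddCommGroup B] [NormedSpace ℝ B]

theorem integral_sum_comp_eval_eq_zero {A : Ξ → B} (hA : Integrable A P)
    (h0 : ∫ s, A s ∂P = 0) :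
    ∫ y, ∑ j, A (y j) ∂(Measure.pi fun _ : ι => P) = 0 := by
  rw [integral_finsetSum _ fun j _ => integrable_comp_eval hA]
  refine Finset.sum_eq_zero fun j _ => ?_
  rw [integral_comp_eval (μ := fun _ : ι => P) hA.aestronglyMeasurable, h0]

variable [MeasurableSpace B] [BorelSpace B] [SecondCountableTopology B]

theorem eLpNorm_sum_le_eLpNorm_sum_sub [CompleteSpace B] {A : Ξ → B} (hA : Measurable A)
    (hI : Integrable A P) (h0 : ∫ s, A s ∂P = 0) :
    eLpNorm (fun y => ∑ j, A (y j)) 2 (Measure.pi fun _ : ι => P)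
      ≤ eLpNorm (fun z => ∑ j, (A (z j).1 - A (z j).2)) 2
          (Measure.pi fun _ : ι => P.prod P) := by
  set π := Measure.pi fun _ : ι => P
  have hS : Integrable (fun y : ι → Ξ => ∑ j, A (y j)) π :=
    integrable_finsetSum _ fun j _ => integrable_comp_eval hI
  have hsplit := measurePreserving_arrowProdEquivProdArrow Ξ Ξ ι (fun _ => P) (fun _ => P)
  have hle : eLpNorm (fun y => ∑ j, A (y j)) 2 π ^ 2
      ≤ eLpNorm (fun w : (ι → Ξ) × (ι → Ξ) => ∑ j, A (w.1 j) - ∑ j, A (w.2 j)) 2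
        (π.prod π) ^ 2 := by
    rw [eLpNorm_two_sq, eLpNorm_two_sq, lintegral_prod _ (by fun_prop)]
    refine lintegral_mono fun y => ?_
    rw [← eLpNorm_two_sq]
    gcongr
    exact enorm_le_eLpNorm_const_sub hS (integral_sum_comp_eval_eq_zero hI h0) _
  refine ((ENNReal.pow_le_pow_left_iff two_ne_zero).mp hle).trans_eq ?_
  rw [← eLpNorm_comp_measurePreserving (by fun_prop) hsplit]
  simp only [Finset.sum_sub_distrib]
  rfl

theorem eLpNorm_signedSum_sub_eq {A : Ξ → B} (hA : Measurable A) (σ : ι → ℤˣ) :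
    eLpNorm (fun z => signedSum (fun j => A (z j).1 - A (z j).2) σ) 2
        (Measure.pi fun _ : ι => P.prod P)
      = eLpNorm (fun z => ∑ j, (A (z j).1 - A (z j).2)) 2 (Measure.pi fun _ : ι => P.prod P) := by
  have hswap : MeasurePreserving
      (fun (z : ι → Ξ × Ξ) j => (if σ j = 1 then id else Prod.swap) (z j))
      (Measure.pi fun _ : ι => P.prod P) (Measure.pi fun _ : ι => P.prod P) := by
    refine measurePreserving_pi _ _ fun j => ?_
    split_ifs
    · exact MeasurePreserving.id _
    · exact Measure.measurePreserving_swap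
  simp only [signedSum]
  rw [← eLpNorm_comp_measurePreserving (by fun_prop) hswap]
  congr 1 with z
  refine Finset.sum_congr rfl fun j _ => ?_
  rcases Int.units_eq_one_or (σ j) with h | h <;> simp [h]

end Symmetrization

theorem sum_enorm_sq_signedSum_le {V : Type*} [NormedAddCommGroup V] [InnerProductSpace ℝ V]
    [FiniteDimensional ℝ V] (hV : 2 ≤ Module.finrank ℝ V) [Fintype ι] [DecidableEq ι]
    {A : ι → V →L[ℝ] V} (hA : ∀ i, (A i : Module.End ℝ V).IsSymmetric) :
    ∑ σ : ι → ℤˣ, ‖signedSum A σ‖ₑ ^ 2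
      ≤ Fintype.card (ι → ℤˣ) *
        (ENNReal.ofReal (14 * Real.log (Module.finrank ℝ V)) * ∑ i, ‖A i‖ₑ ^ 2) := by
  simp only [← ofReal_norm, ← ENNReal.ofReal_pow (norm_nonneg _)]
  rw [← ENNReal.ofReal_sum_of_nonneg fun _ _ => by positivity,
    ← ENNReal.ofReal_sum_of_nonneg fun _ _ => by positivity, ← ENNReal.ofReal_natCast,
    ← ENNReal.ofReal_mul' (by positivity), ← ENNReal.ofReal_mul (by positivity)]
  exact ENNReal.ofReal_le_ofReal (sum_norm_sq_signedSum_le hV hA)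

section Operators

variable {V : Type*} [NormedAddCommGroup V] [InnerProductSpace ℝ V] [FiniteDimensional ℝ V]
  [Fintype ι] {A : Ξ → V →L[ℝ] V}

theorem eLpNorm_sum_sub_sq_le (hV : 2 ≤ Module.finrank ℝ V) (hA : Measurable A)
    (hsymm : ∀ s, (A s : Module.End ℝ V).IsSymmetric) :
    eLpNorm (fun z => ∑ j, (A (z j).1 - A (z j).2)) 2 (Measure.pi fun _ : ι => P.prod P) ^ 2
      ≤ ENNReal.ofReal (14 * Real.log (Module.finrank ℝ V)) *
        (Fintype.card ι * eLpNorm (fun w : Ξ × Ξ => A w.1 - A w.2) 2 (P.prod P) ^ 2) := by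
  classical
  have : ProperSpace (V →L[ℝ] V) := FiniteDimensional.proper_real _
  set ρ := Measure.pi fun _ : ι => P.prod P
  have hsigns : (Fintype.card (ι → ℤˣ) : ENNReal) ≠ 0 := Nat.cast_ne_zero.mpr Fintype.card_ne_zero
  have heval : ∀ j : ι, ∫⁻ z, ‖A (z j).1 - A (z j).2‖ₑ ^ 2 ∂ρ
      = eLpNorm (fun w : Ξ × Ξ => A w.1 - A w.2) 2 (P.prod P) ^ 2 := fun j => by
    rw [eLpNorm_two_sq]
    exact (measurePreserving_eval (fun _ : ι => P.prod P) j).lintegral_comp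
      (f := fun w : Ξ × Ξ => ‖A w.1 - A w.2‖ₑ ^ 2) (by fun_prop)
  refine (ENNReal.mul_le_mul_iff_right hsigns (ENNReal.natCast_ne_top _)).mp ?_
  calc (Fintype.card (ι → ℤˣ) : ENNReal)
        * eLpNorm (fun z : ι → Ξ × Ξ => ∑ j, (A (z j).1 - A (z j).2)) 2 ρ ^ 2
      = ∑ σ : ι → ℤˣ, ∫⁻ z, ‖signedSum (fun j => A (z j).1 - A (z j).2) σ‖ₑ ^ 2 ∂ρ := by
        simp only [← eLpNorm_two_sq, ρ, eLpNorm_signedSum_sub_eq hA, Finset.sum_const,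
          nsmul_eq_mul, Finset.card_univ]
    _ = ∫⁻ z, ∑ σ : ι → ℤˣ, ‖signedSum (fun j => A (z j).1 - A (z j).2) σ‖ₑ ^ 2 ∂ρ := by
        refine (lintegral_finsetSum _ fun σ _ => ?_).symm
        simp only [signedSum]
        fun_prop
    _ ≤ ∫⁻ z, (Fintype.card (ι → ℤˣ) : ENNReal) *
          (ENNReal.ofReal (14 * Real.log (Module.finrank ℝ V))
            * ∑ j, ‖A (z j).1 - A (z j).2‖ₑ ^ 2) ∂ρ :=
        lintegral_mono fun z => sum_enorm_sq_signedSum_le hV fun j =>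
          (hsymm (z j).1).sub (hsymm (z j).2)
    _ = _ := by
        rw [lintegral_const_mul _ (by fun_prop), lintegral_const_mul _ (by fun_prop),
          lintegral_finsetSum _ (by fun_prop)]
        simp only [heval, Finset.sum_const, nsmul_eq_mul, Finset.card_univ]

theorem eLpNorm_sum_operator_sq_le (hV : 2 ≤ Module.finrank ℝ V) (hA : Measurable A)
    (hI : Integrable A P) (h0 : ∫ s, A s ∂P = 0)
    (hsymm : ∀ s, (A s : Module.End ℝ V).IsSymmetric) :
    eLpNorm (fun y => ∑ j, A (y j)) 2 (Measure.pi fun _ : ι => P) ^ 2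
      ≤ ENNReal.ofReal (56 * Real.log (Module.finrank ℝ V))
        * (Fintype.card ι * eLpNorm A 2 P ^ 2) := by
  have : ProperSpace (V →L[ℝ] V) := FiniteDimensional.proper_real _
  calc eLpNorm (fun y => ∑ j, A (y j)) 2 (Measure.pi fun _ : ι => P) ^ 2
      ≤ eLpNorm (fun z => ∑ j, (A (z j).1 - A (z j).2)) 2
          (Measure.pi fun _ : ι => P.prod P) ^ 2 := by
        gcongr
        exact eLpNorm_sum_le_eLpNorm_sum_sub hA hI h0
    _ ≤ ENNReal.ofReal (14 * Real.log (Module.finrank ℝ V)) *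
        (Fintype.card ι * eLpNorm (fun w : Ξ × Ξ => A w.1 - A w.2) 2 (P.prod P) ^ 2) :=
        eLpNorm_sum_sub_sq_le hV hA hsymm
    _ ≤ ENNReal.ofReal (14 * Real.log (Module.finrank ℝ V)) *
        (Fintype.card ι * (2 * eLpNorm A 2 P) ^ 2) := by
        gcongr
        exact eLpNorm_fst_sub_snd_le hI.aestronglyMeasurable
    _ = ENNReal.ofReal (56 * Real.log (Module.finrank ℝ V))
        * (Fintype.card ι * eLpNorm A 2 P ^ 2) := by
        have hfour : ENNReal.ofReal (56 * Real.log (Module.finrank ℝ V))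
            = ENNReal.ofReal (14 * Real.log (Module.finrank ℝ V)) * 4 := by
          rw [← ENNReal.ofReal_ofNat 4, ← ENNReal.ofReal_mul (by positivity)]
          ring_nf
        rw [hfour]
        ring

theorem eLpNorm_operator_average_sq_le {A : Ξ → V →L[ℝ] V} (hV : 2 ≤ Module.finrank ℝ V)
    (hA : Measurable A) (hI : Integrable A P) (h0 : ∫ s, A s ∂P = 0)
    (hsymm : ∀ s, (A s : Module.End ℝ V).IsSymmetric) {m : ℕ} (hm : m ≠ 0) :
    eLpNorm (fun y => (m : ℝ)⁻¹ • ∑ j, A (y j)) 2 (Measure.pi fun _ : Fin m => P) ^ 2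
      ≤ (m : ENNReal)⁻¹ * (ENNReal.ofReal (56 * Real.log (Module.finrank ℝ V))
        * eLpNorm A 2 P ^ 2) := by
  rw [eLpNorm_inv_natCast_smul_sq hm fun y : Fin m → Ξ => ∑ j, A (y j),
    ← inv_natCast_sq_mul_natCast_mul hm, mul_left_comm (m : ENNReal)]
  gcongr
  simpa only [Fintype.card_fin] using eLpNorm_sum_operator_sq_le (ι := Fin m) hV hA hI h0 hsymm

end Operators

section Vectors

variable [NormedAddCommGroup H] [InnerProductSpace ℝ H] {Z : Ξ → H}

theorem integrable_inner_of_memLp_two {α : Type*} [MeasurableSpace α] {μ : Measure α}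
    {X Y : α → H} (hX : MemLp X 2 μ) (hY : MemLp Y 2 μ) : Integrable (fun a => ⟪X a, Y a⟫) μ :=
  (hX.norm.integrable_mul hY.norm).mono' (hX.1.inner hY.1)
    (Filter.Eventually.of_forall fun _ => norm_inner_le_norm _ _)

variable [CompleteSpace H]

theorem eLpNorm_const_add_sq (hZ : MemLp Z 2 P) (h0 : ∫ s, Z s ∂P = 0) (e : H) :
    eLpNorm (fun s => e + Z s) 2 P ^ 2 = ‖e‖ₑ ^ 2 + eLpNorm Z 2 P ^ 2 := by
  have hintegrable : Integrable Z P := hZ.integrable one_le_two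
  have hlin : Integrable (fun s => 2 * ⟪e, Z s⟫) P := (hintegrable.const_inner e).const_mul 2
  have hadd : MemLp (fun s => e + Z s) 2 P := (memLp_const e).add hZ
  have hmean : ∫ s, ‖e + Z s‖ ^ 2 ∂P = ‖e‖ ^ 2 + ∫ s, ‖Z s‖ ^ 2 ∂P := by
    have hconst_lin : Integrable (fun s => ‖e‖ ^ 2 + 2 * ⟪e, Z s⟫) P :=
      (integrable_const _).add hlin
    simp only [norm_add_sq_real]
    rw [integral_add hconst_lin (hZ.integrable_norm_pow two_ne_zero),
      integral_add (integrable_const _) hlin, integral_const_mul, integral_inner hintegrable, h0,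
      inner_zero_right, mul_zero, add_zero, integral_const, probReal_univ, one_smul]
  rw [eLpNorm_two_sq_eq_ofReal_integral hadd, eLpNorm_two_sq_eq_ofReal_integral hZ, hmean,
    ENNReal.ofReal_add (by positivity) (integral_nonneg fun _ => by positivity),
    ENNReal.ofReal_pow (norm_nonneg _), ofReal_norm]

variable [MeasurableSpace H] [BorelSpace H] [Fintype ι]

theorem integral_inner_comp_eval_of_ne (hZ : Integrable Z P) (h0 : ∫ s, Z s ∂P = 0) {i j : ι}
    (hij : i ≠ j) : ∫ y, ⟪Z (y i), Z (y j)⟫ ∂(Measure.pi fun _ : ι => P) = 0 := by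
  have hindep := iIndepFun_pi (μ := fun _ : ι => P) (X := fun _ => Z) fun _ => hZ.aemeasurable
  have hmul : ∫ y, ⟪Z (y i), Z (y j)⟫ ∂(Measure.pi fun _ : ι => P) = ⟪_, _⟫ :=
    (hindep.indepFun hij).integral_bilin (integrable_comp_eval hZ) (integrable_comp_eval hZ)
      (innerSL ℝ)
  rw [hmul, integral_comp_eval (μ := fun _ : ι => P) hZ.aestronglyMeasurable, h0, inner_zero_left]

theorem integral_norm_sum_comp_eval_sq (hZ : MemLp Z 2 P) (h0 : ∫ s, Z s ∂P = 0) :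
    ∫ y, ‖∑ j, Z (y j)‖ ^ 2 ∂(Measure.pi fun _ : ι => P)
      = Fintype.card ι * ∫ s, ‖Z s‖ ^ 2 ∂P := by
  have heval (j : ι) : MemLp (fun y : ι → Ξ => Z (y j)) 2 (Measure.pi fun _ : ι => P) :=
    hZ.comp_measurePreserving (measurePreserving_eval (fun _ : ι => P) j)
  have hinner (i j : ι) : Integrable (fun y : ι → Ξ => ⟪Z (y i), Z (y j)⟫)
      (Measure.pi fun _ : ι => P) := integrable_inner_of_memLp_two (heval i) (heval j)
  have hrow (j : ι) : ∫ y, ∑ i, ⟪Z (y i), Z (y j)⟫ ∂(Measure.pi fun _ : ι => P)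
      = ∫ s, ⟪Z s, Z s⟫ ∂P := by
    rw [integral_finsetSum _ fun i _ => hinner i j, Finset.sum_eq_single j
      (fun i _ hi => integral_inner_comp_eval_of_ne (hZ.integrable one_le_two) h0 hi)
      fun h => (h (Finset.mem_univ j)).elim]
    exact integral_comp_eval (μ := fun _ : ι => P) (f := fun s => ⟪Z s, Z s⟫) (hZ.1.inner hZ.1)
  simp only [← real_inner_self_eq_norm_sq, inner_sum, sum_inner]
  rw [integral_finsetSum _ fun j _ => integrable_finsetSum _ fun i _ => hinner i j]
  simp only [hrow, Finset.sum_const, nsmul_eq_mul, Finset.card_univ]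

theorem eLpNorm_const_add_average_sq (hZ : MemLp Z 2 P) (h0 : ∫ s, Z s ∂P = 0) (e : H) {m : ℕ}
    (hm : m ≠ 0) :
    eLpNorm (fun y => e + (m : ℝ)⁻¹ • ∑ j, Z (y j)) 2 (Measure.pi fun _ : Fin m => P) ^ 2
      = ‖e‖ₑ ^ 2 + (m : ENNReal)⁻¹ * eLpNorm Z 2 P ^ 2 := by
  set π := Measure.pi fun _ : Fin m => P
  have hsum : MemLp (fun y : Fin m → Ξ => ∑ j, Z (y j)) 2 π := memLp_finsetSum _ fun j _ =>
    hZ.comp_measurePreserving (measurePreserving_eval (fun _ : Fin m => P) j)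
  have haverage : MemLp (fun y : Fin m → Ξ => (m : ℝ)⁻¹ • ∑ j, Z (y j)) 2 π := hsum.const_smul _
  have hmean : ∫ y, (m : ℝ)⁻¹ • ∑ j, Z (y j) ∂π = 0 := by
    rw [integral_smul, integral_sum_comp_eval_eq_zero (hZ.integrable one_le_two) h0, smul_zero]
  have hsq : eLpNorm (fun y => ∑ j, Z (y j)) 2 π ^ 2 = m * eLpNorm Z 2 P ^ 2 := by
    rw [eLpNorm_two_sq_eq_ofReal_integral hsum, eLpNorm_two_sq_eq_ofReal_integral hZ,
      integral_norm_sum_comp_eval_sq hZ h0, Fintype.card_fin, ENNReal.ofReal_mul (by positivity),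
      ENNReal.ofReal_natCast]
  rw [eLpNorm_const_add_sq haverage hmean, eLpNorm_inv_natCast_smul_sq hm, hsq,
    inv_natCast_sq_mul_natCast_mul hm]

end Vectors

end Averages

section Measurability

theorem measurable_of_forall_inner {α V : Type*} [MeasurableSpace α] [NormedAddCommGroup V]
    [InnerProductSpace ℝ V] [FiniteDimensional ℝ V] [MeasurableSpace V] [BorelSpace V] {φ : α → V}
    (h : ∀ v : V, Measurable fun a => ⟪v, φ a⟫) : Measurable φ := by
  have hsum : φ = fun a => ∑ i, ⟪stdOrthonormalBasis ℝ V i, φ a⟫ • stdOrthonormalBasis ℝ V i :=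
    funext fun a => ((stdOrthonormalBasis ℝ V).sum_repr' (φ a)).symm
  rw [hsum]
  exact Finset.measurable_sum _ fun i _ => (h _).smul_const _

theorem measurable_of_forall_apply {α V W : Type*} [MeasurableSpace α] [NormedAddCommGroup V]
    [InnerProductSpace ℝ V] [FiniteDimensional ℝ V] [NormedAddCommGroup W] [NormedSpace ℝ W]
    [MeasurableSpace W] [BorelSpace W] [SecondCountableTopology (V →L[ℝ] W)] {A : α → V →L[ℝ] W}
    (h : ∀ v : V, Measurable fun a => A a v) : Measurable A := by
  let b := stdOrthonormalBasis ℝ V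
  have hsum :
      A = fun a => ∑ i, ContinuousLinearMap.smulRightL ℝ V W (innerSL ℝ (b i)) (A a (b i)) := by
    funext a
    ext1 v
    conv_lhs => rw [← b.sum_repr' v]
    simp
  rw [hsum]
  exact Finset.measurable_sum _ fun i _ =>
    (ContinuousLinearMap.continuous _).measurable.comp (h _)

theorem measurable_apply_of_hasFDerivAt {α V B : Type*} [MeasurableSpace α]
    [NormedAddCommGroup V] [NormedSpace ℝ V] [NormedAddCommGroup B] [NormedSpace ℝ B]
    [MeasurableSpace B] [BorelSpace B] [SecondCountableTopology B] {φ : α → V → B}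
    {φ' : α → V →L[ℝ] B} {x : α → V} (hφ : ∀ a, HasFDerivAt (φ a) (φ' a) (x a)) (v : V)
    (hmeas : ∀ c : ℝ, Measurable fun a => φ a (x a + c • v)) : Measurable fun a => φ' a v := by
  refine measurable_of_tendsto_metrizable
    (f := fun (k : ℕ) a => (k : ℝ) • (φ a (x a + (k : ℝ)⁻¹ • v) - φ a (x a))) (fun k => ?_) ?_
  · have hx : Measurable fun a => φ a (x a) := by simpa using hmeas 0
    exact ((hmeas _).sub hx).const_smul _
  · exact tendsto_pi_nhds.2 fun a =>
      (hφ a).lim v (tendsto_norm_atTop_atTop.comp tendsto_natCast_atTop_atTop)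

variable {n : ℕ} {Ξ : Type*} [MeasurableSpace Ξ] {P : Measure Ξ} {f : E n → Ξ → ℝ} {F : E n → ℝ}

theorem IsStochasticObjective.measurable_gradient (h : IsStochasticObjective P f F) :
    Measurable fun p : E n × Ξ => gradient (fun y => f y p.2) p.1 := by
  refine measurable_uncurry_of_continuous_of_measurable
    (u := fun (x : E n) (s : Ξ) => gradient (fun y => f y s) x)
    (fun s => (h.twiceDifferentiable s).continuous_gradient) fun x => ?_
  refine measurable_of_forall_inner fun v => ?_
  simp only [real_inner_comm _ v]
  exact measurable_apply_of_hasFDerivAt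
    (fun s => ((h.twiceDifferentiable s).hasGradientAt x).hasFDerivAt) v fun c => h.measurable _

theorem IsStochasticObjective.measurable_hessian (h : IsStochasticObjective P f F) :
    Measurable fun p : E n × Ξ => hessian (fun y => f y p.2) p.1 :=
  measurable_of_forall_apply fun v => measurable_apply_of_hasFDerivAt
    (fun p : E n × Ξ => (h.twiceDifferentiable p.2).hasFDerivAt_gradient p.1) v fun c =>
      h.measurable_gradient.comp ((measurable_fst.add_const (c • v)).prodMk measurable_snd)

end Measurability

section Batch

variable {n m : ℕ} {Ξ : Type*} {f : E n → Ξ → ℝ}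

theorem gradient_batchFun (h : ∀ s, TwiceDifferentiable fun x => f x s) (S : Fin m → Ξ) (x : E n) :
    gradient (batchFun f S) x = (m : ℝ)⁻¹ • ∑ j, gradient (fun y => f y (S j)) x := by
  refine HasGradientAt.gradient (hasGradientAt_iff_hasFDerivAt.2 ?_)
  refine ((HasFDerivAt.fun_sum (u := Finset.univ) fun j _ =>
    ((h (S j)).hasGradientAt x).hasFDerivAt).const_mul (m : ℝ)⁻¹).congr_fderiv ?_
  ext v
  simp

theorem hessian_batchFun (h : ∀ s, TwiceDifferentiable fun x => f x s) (S : Fin m → Ξ) (x : E n) :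
    hessian (batchFun f S) x = (m : ℝ)⁻¹ • ∑ j, hessian (fun y => f y (S j)) x := by
  rw [hessian, funext (gradient_batchFun h S)]
  exact ((HasFDerivAt.fun_sum (u := Finset.univ) fun j _ =>
    (h (S j)).hasFDerivAt_gradient x).const_smul (m : ℝ)⁻¹).fderiv

theorem isSymmetric_hessian_batchFun (h : ∀ s, TwiceDifferentiable fun x => f x s)
    (S : Fin m → Ξ) (x : E n) : (hessian (batchFun f S) x : E n →ₗ[ℝ] E n).IsSymmetric := by
  rw [hessian_batchFun h, ContinuousLinearMap.toLinearMap_smul, ContinuousLinearMap.toLinearMap_sum]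
  exact (LinearMap.isSymmetric_sum _ fun j _ => (h (S j)).isSymmetric_hessian x).smul
    (RCLike.conj_to_real)

variable [MeasurableSpace Ξ] {P : Measure Ξ} {F : E n → ℝ} {α : Type*} {mα : MeasurableSpace α}
  {X : α → E n} {S : Fin m → α → Ξ}

theorem IsStochasticObjective.measurable_gradient_batchFun (h : IsStochasticObjective P f F)
    (hX : Measurable X) (hS : ∀ j, Measurable (S j)) :
    Measurable fun a => gradient (batchFun f fun j => S j a) (X a) := by
  simp only [gradient_batchFun h.twiceDifferentiable]
  exact (Finset.measurable_sum Finset.univ fun j _ =>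
    h.measurable_gradient.comp (hX.prodMk (hS j))).const_smul (m : ℝ)⁻¹

theorem IsStochasticObjective.measurable_hessian_batchFun (h : IsStochasticObjective P f F)
    (hX : Measurable X) (hS : ∀ j, Measurable (S j)) :
    Measurable fun a => hessian (batchFun f fun j => S j a) (X a) := by
  simp only [hessian_batchFun h.twiceDifferentiable]
  exact (Finset.measurable_sum Finset.univ fun j _ =>
    h.measurable_hessian.comp (hX.prodMk (hS j))).const_smul (m : ℝ)⁻¹

end Batch

section MeanSquare

theorem enorm_sub_le_eLpNorm_deriv {B : Type*} [NormedAddCommGroup B] [NormedSpace ℝ B]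
    [CompleteSpace B] {γ γ' : ℝ → B} (h : ∀ u, HasDerivAt γ (γ' u) u) :
    ‖γ 1 - γ 0‖ₑ ≤ eLpNorm γ' 2 (volume.restrict (Set.Ioc 0 1)) := by
  have : IsProbabilityMeasure ((volume : Measure ℝ).restrict (Set.Ioc 0 1)) := ⟨by simp⟩
  have hmeas : AEStronglyMeasurable γ' (volume.restrict (Set.Ioc 0 1)) := by
    rw [← funext fun u => (h u).deriv]
    exact (stronglyMeasurable_deriv γ).aestronglyMeasurable
  rcases eq_top_or_lt_top (eLpNorm γ' 2 (volume.restrict (Set.Ioc 0 1))) with htop | hfin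
  · exact htop ▸ le_top
  have hintegrable : IntervalIntegrable γ' volume 0 1 :=
    (intervalIntegrable_iff_integrableOn_Ioc_of_le zero_le_one).2
      (MemLp.integrable one_le_two ⟨hmeas, hfin⟩)
  rw [← intervalIntegral.integral_eq_sub_of_hasDerivAt (fun u _ => h u) hintegrable,
    intervalIntegral.integral_of_le zero_le_one]
  exact enorm_integral_le_eLpNorm_two hmeas

theorem enorm_sub_sq_le_lintegral_fderiv {V B : Type*} [NormedAddCommGroup V] [NormedSpace ℝ V]
    [NormedAddCommGroup B] [NormedSpace ℝ B] [CompleteSpace B] {φ : V → B} {φ' : V → V →L[ℝ] B}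
    (hφ : ∀ z, HasFDerivAt φ (φ' z) z) (x y : V) :
    ‖φ y - φ x‖ₑ ^ 2
      ≤ ∫⁻ u in Set.Ioc (0 : ℝ) 1, ‖y - x‖ₑ ^ 2 * ‖φ' (x + u • (y - x))‖ₑ ^ 2 := by
  have hline (u : ℝ) : HasDerivAt (fun u : ℝ => x + u • (y - x)) (y - x) u := by
    simpa using ((hasDerivAt_id u).smul_const (y - x)).const_add x
  have hftc := enorm_sub_le_eLpNorm_deriv fun u => (hφ _).comp_hasDerivAt u (hline u)
  simp only [Function.comp_apply, one_smul, zero_smul, add_zero, add_sub_cancel] at hftc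
  refine (pow_le_pow_left' hftc 2).trans ?_
  rw [eLpNorm_two_sq]
  refine lintegral_mono fun u => ?_
  rw [← mul_pow, mul_comm]
  exact pow_le_pow_left' (ContinuousLinearMap.le_opENorm _ _) 2

/- The fundamental theorem of calculus along the segment, followed by Tonelli. -/
theorem eLpNorm_sub_le_of_hasFDerivAt {Ξ V B : Type*} [MeasurableSpace Ξ] {P : Measure Ξ}
    [SFinite P] [NormedAddCommGroup V] [NormedSpace ℝ V] [MeasurableSpace V] [BorelSpace V]
    [NormedAddCommGroup B] [NormedSpace ℝ B] [CompleteSpace B] {φ : V → Ξ → B}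
    {φ' : V → Ξ → V →L[ℝ] B} (hφ : ∀ z s, HasFDerivAt (fun z => φ z s) (φ' z s) z)
    (hmeas : Measurable (Function.uncurry φ')) {x y : V} {c : ENNReal}
    (hc : ∀ z ∈ segment ℝ x y, eLpNorm (φ' z) 2 P ≤ c) :
    eLpNorm (fun s => φ y s - φ x s) 2 P ≤ ‖y - x‖ₑ * c := by
  have hline : Continuous fun u : ℝ => x + u • (y - x) := by fun_prop
  have hpath : Measurable fun q : Ξ × ℝ => ‖φ' (x + q.2 • (y - x)) q.1‖ₑ ^ 2 :=
    (hmeas.comp ((hline.measurable.comp measurable_snd).prodMk measurable_fst)).enorm.pow_const 2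
  refine (ENNReal.pow_le_pow_left_iff two_ne_zero).1 ?_
  calc eLpNorm (fun s => φ y s - φ x s) 2 P ^ 2
      ≤ ∫⁻ s, (∫⁻ u in Set.Ioc (0 : ℝ) 1,
          ‖y - x‖ₑ ^ 2 * ‖φ' (x + u • (y - x)) s‖ₑ ^ 2) ∂P := by
        rw [eLpNorm_two_sq]
        exact lintegral_mono fun s => enorm_sub_sq_le_lintegral_fderiv (hφ · s) x y
    _ = ∫⁻ u in Set.Ioc (0 : ℝ) 1, ‖y - x‖ₑ ^ 2 * eLpNorm (φ' (x + u • (y - x))) 2 P ^ 2 := by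
        rw [lintegral_lintegral_swap (hpath.const_mul _).aemeasurable]
        refine lintegral_congr fun u => ?_
        rw [eLpNorm_two_sq, lintegral_const_mul' _ _ (by finiteness)]
    _ ≤ ∫⁻ _ in Set.Ioc (0 : ℝ) 1, (‖y - x‖ₑ * c) ^ 2 := by
        refine setLIntegral_mono measurable_const fun u hu => ?_
        rw [mul_pow]
        gcongr
        refine hc _ ?_
        rw [segment_eq_image']
        exact ⟨u, ⟨hu.1.le, hu.2⟩, rfl⟩
    _ = (‖y - x‖ₑ * c) ^ 2 := by simp

theorem eLpNorm_two_le_ofReal {Ξ B : Type*} [MeasurableSpace Ξ] {P : Measure Ξ}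
    [NormedAddCommGroup B] {Z : Ξ → B} (hZ : MemLp Z 2 P) {c : ℝ} (hc : 0 ≤ c)
    (hle : ∫ s, ‖Z s‖ ^ 2 ∂P ≤ c ^ 2) : eLpNorm Z 2 P ≤ ENNReal.ofReal c := by
  refine (ENNReal.pow_le_pow_left_iff two_ne_zero).1 ?_
  rw [eLpNorm_two_sq_eq_ofReal_integral hZ, ← ENNReal.ofReal_pow hc]
  exact ENNReal.ofReal_le_ofReal hle

end MeanSquare

section Noise

variable {n : ℕ} {Ξ : Type*} {f : E n → Ξ → ℝ} {F : E n → ℝ}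

/-- The error `∇f(x; ξ) - ∇F(x)` of the stochastic gradient at `x`, as a function of the
sample `ξ`. -/
noncomputable def gradientNoise (f : E n → Ξ → ℝ) (F : E n → ℝ) (x : E n) (s : Ξ) : E n :=
  gradient (fun y => f y s) x - gradient F x

/-- The error `∇²f(x; ξ) - ∇²F(x)` of the stochastic Hessian at `x`, as a function of the
sample `ξ`. -/
noncomputable def hessianNoise (f : E n → Ξ → ℝ) (F : E n → ℝ) (x : E n) (s : Ξ) : E n →L[ℝ] E n :=
  hessian (fun y => f y s) x - hessian F x

theorem hasFDerivAt_gradientNoise {s : Ξ} (hf : TwiceDifferentiable fun x => f x s)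
    (hF : TwiceDifferentiable F) (x : E n) :
    HasFDerivAt (fun x => gradientNoise f F x s) (hessianNoise f F x s) x :=
  (hf.hasFDerivAt_gradient x).sub (hF.hasFDerivAt_gradient x)

theorem isSymmetric_hessianNoise {s : Ξ} (hf : TwiceDifferentiable fun x => f x s)
    (hF : TwiceDifferentiable F) (x : E n) :
    (hessianNoise f F x s : E n →ₗ[ℝ] E n).IsSymmetric :=
  (hf.isSymmetric_hessian x).sub (hF.isSymmetric_hessian x)

theorem gradient_batchFun_sub (h : ∀ s, TwiceDifferentiable fun x => f x s) {m : ℕ} (hm : m ≠ 0)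
    (S : Fin m → Ξ) (x : E n) :
    gradient (batchFun f S) x - gradient F x = (m : ℝ)⁻¹ • ∑ j, gradientNoise f F x (S j) := by
  simp only [gradient_batchFun h, gradientNoise, Finset.sum_sub_distrib, Finset.sum_const,
    Finset.card_univ, Fintype.card_fin, smul_sub, ← Nat.cast_smul_eq_nsmul ℝ,
    inv_smul_smul₀ (Nat.cast_ne_zero.2 hm : (m : ℝ) ≠ 0)]

theorem hessian_batchFun_sub (h : ∀ s, TwiceDifferentiable fun x => f x s) {m : ℕ} (hm : m ≠ 0)
    (S : Fin m → Ξ) (x : E n) :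
    hessian (batchFun f S) x - hessian F x = (m : ℝ)⁻¹ • ∑ j, hessianNoise f F x (S j) := by
  simp only [hessian_batchFun h, hessianNoise, Finset.sum_sub_distrib, Finset.sum_const,
    Finset.card_univ, Fintype.card_fin, smul_sub, ← Nat.cast_smul_eq_nsmul ℝ,
    inv_smul_smul₀ (Nat.cast_ne_zero.2 hm : (m : ℝ) ≠ 0)]

variable [MeasurableSpace Ξ] {P : Measure Ξ} {G₀ G₁ K₀ K₁ L₀ L₁ Δ : ℝ}

theorem IsStochasticObjective.measurable_hessianNoise (h : IsStochasticObjective P f F) :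
    Measurable (Function.uncurry (hessianNoise f F)) :=
  h.measurable_hessian.sub ((measurable_fderiv ℝ (gradient F)).comp measurable_fst)

theorem GradientVarianceBounded.memLp_gradientNoise [IsFiniteMeasure P]
    (h : GradientVarianceBounded P f F G₀ G₁) (x : E n) : MemLp (gradientNoise f F x) 2 P :=
  (memLp_two_iff_integrable_sq_norm
    ((h.integrable x).sub (integrable_const _)).aestronglyMeasurable).2 (h.integrable_sq x)

theorem HessianVarianceBounded.memLp_hessianNoise [IsFiniteMeasure P]
    (h : HessianVarianceBounded P f F K₀ K₁) (x : E n) : MemLp (hessianNoise f F x) 2 P :=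
  (memLp_two_iff_integrable_sq_norm
    ((h.integrable x).sub (integrable_const _)).aestronglyMeasurable).2 (h.integrable_sq x)

variable [IsProbabilityMeasure P]

theorem GradientVarianceBounded.integral_gradientNoise (h : GradientVarianceBounded P f F G₀ G₁)
    (x : E n) : ∫ s, gradientNoise f F x s ∂P = 0 := by
  simp only [gradientNoise]
  rw [integral_sub (h.integrable x) (integrable_const _), h.unbiased, integral_const,
    probReal_univ, one_smul, sub_self]

theorem HessianVarianceBounded.integral_hessianNoise (h : HessianVarianceBounded P f F K₀ K₁)
    (x : E n) : ∫ s, hessianNoise f F x s ∂P = 0 := by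
  simp only [hessianNoise]
  rw [integral_sub (h.integrable x) (integrable_const _), h.unbiased, integral_const,
    probReal_univ, one_smul, sub_self]

theorem GradientVarianceBounded.eLpNorm_gradientNoise_le
    (h : GradientVarianceBounded P f F G₀ G₁) (hG₀ : 0 ≤ G₀) (hG₁ : 0 ≤ G₁) (x : E n) :
    eLpNorm (gradientNoise f F x) 2 P ≤ ENNReal.ofReal (G₀ + G₁ * ‖gradient F x‖) := by
  refine eLpNorm_two_le_ofReal (h.memLp_gradientNoise x) (by positivity)
    ((h.variance_le x).trans ?_)
  have hcross : 0 ≤ G₀ * (G₁ * ‖gradient F x‖) := by positivity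
  linarith [add_sq G₀ (G₁ * ‖gradient F x‖), mul_pow G₁ ‖gradient F x‖ 2]

theorem HessianVarianceBounded.eLpNorm_hessianNoise_le
    (h : HessianVarianceBounded P f F K₀ K₁) (hK₀ : 0 ≤ K₀) (hK₁ : 0 ≤ K₁) (x : E n) :
    eLpNorm (hessianNoise f F x) 2 P ≤ ENNReal.ofReal (K₀ + K₁ * ‖gradient F x‖) := by
  refine eLpNorm_two_le_ofReal (h.memLp_hessianNoise x) (by positivity)
    ((h.variance_le x).trans ?_)
  have hcross : 0 ≤ K₀ * (K₁ * ‖gradient F x‖) := by positivity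
  linarith [add_sq K₀ (K₁ * ‖gradient F x‖), mul_pow K₁ ‖gradient F x‖ 2]

/- The Hessian noise is the derivative of the gradient noise. -/
theorem HessianVarianceBounded.eLpNorm_gradientNoise_sub_le
    (hK : HessianVarianceBounded P f F K₀ K₁) (h : IsStochasticObjective P f F)
    (hF : TwiceDifferentiable F) (hsmooth : GeneralizedSmooth F L₀ L₁)
    (hK₀ : 0 ≤ K₀) (hK₁ : 0 ≤ K₁) (hL₀ : 0 ≤ L₀) (hL₁ : 0 ≤ L₁) (hΔ : Δ ≤ 1) (hLΔ : L₁ * Δ ≤ 1)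
    {x y : E n} (hxy : ‖y - x‖ ≤ Δ) :
    eLpNorm (fun s => gradientNoise f F y s - gradientNoise f F x s) 2 P
      ≤ ENNReal.ofReal (Δ * (K₀ + K₁ * (2 * ‖gradient F x‖ + L₀))) := by
  have hgradient {z : E n} (hz : z ∈ segment ℝ x y) : ‖gradient F z‖ ≤ 2 * ‖gradient F x‖ + L₀ := by
    refine (hsmooth.norm_gradient_le (x := x) hL₀ hL₁ hLΔ ?_).trans ?_
    · rw [norm_sub_rev]
      exact (norm_sub_le_of_mem_segment hz).trans hxy
    · linarith [mul_le_mul_of_nonneg_right hLΔ (norm_nonneg (gradient F x)),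
        mul_le_mul_of_nonneg_left hΔ hL₀]
  have hderiv := eLpNorm_sub_le_of_hasFDerivAt (P := P)
    (fun z s => hasFDerivAt_gradientNoise (h.twiceDifferentiable s) hF z) h.measurable_hessianNoise
    fun z hz => (hK.eLpNorm_hessianNoise_le hK₀ hK₁ z).trans <| ENNReal.ofReal_le_ofReal <|
      add_le_add_right (mul_le_mul_of_nonneg_left (hgradient hz) hK₁) K₀
  refine hderiv.trans ?_
  rw [← ofReal_norm, ← ENNReal.ofReal_mul (norm_nonneg _)]
  exact ENNReal.ofReal_le_ofReal (mul_le_mul_of_nonneg_right hxy (by positivity))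

end Noise

section Fresh

theorem indepFun_pi_of_indep_iSup_comap {Ω Ξ α ι κ : Type*} {𝒢 : MeasurableSpace Ω}
    [MeasurableSpace Ω] [MeasurableSpace Ξ] [MeasurableSpace α] {μ : Measure Ω} {S : ι → Ω → Ξ}
    (hpast : Indep (⨆ i, MeasurableSpace.comap (S i) inferInstance) 𝒢 μ) (e : κ → ι) {Z : Ω → α}
    (hZ : Measurable[𝒢] Z) : IndepFun Z (fun ω k => S (e k) ω) μ := by
  rw [IndepFun_iff_Indep]
  refine indep_of_indep_of_le_left (indep_of_indep_of_le_right hpast.symm ?_) hZ.comap_le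
  refine Measurable.comap_le (@measurable_pi_lambda _ _ _ (_) _ _ fun k => ?_)
  exact (comap_measurable (S (e k))).mono
    (le_iSup (fun i => MeasurableSpace.comap (S i) inferInstance) (e k)) le_rfl

theorem lintegral_fresh_batch {Ω Ξ α ι κ : Type*} [Fintype κ] {𝒢 : MeasurableSpace Ω}
    [mΩ : MeasurableSpace Ω] [MeasurableSpace Ξ] [MeasurableSpace α] {μ : Measure Ω}
    [IsProbabilityMeasure μ] {P : Measure Ξ} {S : ι → Ω → Ξ} (hS : ∀ i, Measurable (S i))
    (hlaw : ∀ i, μ.map (S i) = P) (hindep : iIndepFun S μ) (h𝒢 : 𝒢 ≤ mΩ)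
    (hpast : Indep (⨆ i, MeasurableSpace.comap (S i) inferInstance) 𝒢 μ) {e : κ → ι}
    (he : Function.Injective e) {Z : Ω → α} (hZ : Measurable[𝒢] Z) {h : α × (κ → Ξ) → ENNReal}
    (hh : Measurable h) :
    ∫⁻ ω, h (Z ω, fun k => S (e k) ω) ∂μ
      = ∫⁻ ω, ∫⁻ y, h (Z ω, y) ∂(Measure.pi fun _ : κ => P) ∂μ := by
  have hZ' : Measurable Z := hZ.mono h𝒢 le_rfl
  have hbatch : Measurable fun ω k => S (e k) ω := measurable_pi_lambda _ fun k => hS (e k)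
  have hbatch_law : μ.map (fun ω k => S (e k) ω) = Measure.pi fun _ : κ => P := by
    rw [(iIndepFun_iff_map_fun_eq_pi_map fun k => (hS (e k)).aemeasurable).mp (hindep.precomp he)]
    simp only [hlaw]
  have : IsProbabilityMeasure (Measure.pi fun _ : κ => P) :=
    hbatch_law ▸ Measure.isProbabilityMeasure_map hbatch.aemeasurable
  have hjoint := (indepFun_iff_map_prod_eq_prod_map_map hZ'.aemeasurable hbatch.aemeasurable).mp
    (indepFun_pi_of_indep_iSup_comap hpast e hZ)
  rw [← lintegral_map (f := h) hh (hZ'.prodMk hbatch), hjoint, hbatch_law,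
    lintegral_prod _ hh.aemeasurable, lintegral_map hh.lintegral_prod_right' hZ']

theorem lintegral_fresh_batch_sq_div {Ω Ξ α ι κ B : Type*} [Fintype κ] {𝒢 : MeasurableSpace Ω}
    [mΩ : MeasurableSpace Ω] [MeasurableSpace Ξ] [MeasurableSpace α] [NormedAddCommGroup B]
    [MeasurableSpace B] [OpensMeasurableSpace B] {μ : Measure Ω} [IsProbabilityMeasure μ]
    {P : Measure Ξ} {S : ι → Ω → Ξ} (hS : ∀ i, Measurable (S i)) (hlaw : ∀ i, μ.map (S i) = P)
    (hindep : iIndepFun S μ) (h𝒢 : 𝒢 ≤ mΩ)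
    (hpast : Indep (⨆ i, MeasurableSpace.comap (S i) inferInstance) 𝒢 μ) {e : κ → ι}
    (he : Function.Injective e) {Z : Ω → α} (hZ : Measurable[𝒢] Z) {W : Ω → ENNReal}
    (hW : Measurable[𝒢] W) {Φ : α × (κ → Ξ) → B} (hΦ : Measurable Φ) :
    ∫⁻ ω, ‖Φ (Z ω, fun k => S (e k) ω)‖ₑ ^ 2 / W ω ∂μ
      = ∫⁻ ω, eLpNorm (fun y => Φ (Z ω, y)) 2 (Measure.pi fun _ : κ => P) ^ 2 / W ω ∂μ := by
  have hweighted : Measurable fun q : (α × ENNReal) × (κ → Ξ) => ‖Φ (q.1.1, q.2)‖ₑ ^ 2 / q.1.2 :=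
    ((hΦ.comp (measurable_fst.fst.prodMk measurable_snd)).enorm.pow_const 2).div measurable_fst.snd
  rw [lintegral_fresh_batch hS hlaw hindep h𝒢 hpast he (hZ.prodMk hW) hweighted]
  refine lintegral_congr fun ω => ?_
  have hslice : Measurable fun y => ‖Φ (Z ω, y)‖ₑ ^ 2 :=
    (hΦ.comp measurable_prodMk_left).enorm.pow_const 2
  simp only [div_eq_mul_inv]
  rw [lintegral_mul_const _ hslice, eLpNorm_two_sq]

variable {n : ℕ} {Ξ Ω : Type*} [MeasurableSpace Ξ] [mΩ : MeasurableSpace Ω] {P : Measure Ξ}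
  {f : E n → Ξ → ℝ} {F : E n → ℝ} {x₀ : E n} {p : Params} {T t : ℕ} {μ : Measure Ω}

theorem Run.measurable_sample (R : Run P f F x₀ p T μ) (ht : t < T)
    (i : Fin (p.gradBatch t) ⊕ Fin p.S₂) :
    Measurable (Sum.elim (R.gradSample t) (R.hessSample t) i) := by
  cases i with
  | inl j => exact (R.gradSample_measurable t ht j).mono (R.ℱ.le _) le_rfl
  | inr j => exact (R.hessSample_measurable t ht j).mono (R.ℱ.le _) le_rfl

theorem Run.map_sample (R : Run P f F x₀ p T μ) (ht : t < T)
    (i : Fin (p.gradBatch t) ⊕ Fin p.S₂) :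
    μ.map (Sum.elim (R.gradSample t) (R.hessSample t) i) = P := by
  cases i with
  | inl j => exact R.gradSample_law t ht j
  | inr j => exact R.hessSample_law t ht j

theorem Run.lintegral_gradSample_sq_div [IsProbabilityMeasure μ] (R : Run P f F x₀ p T μ)
    (ht : t < T) {α B : Type*} [MeasurableSpace α] [NormedAddCommGroup B] [MeasurableSpace B]
    [OpensMeasurableSpace B] {Z : Ω → α} (hZ : Measurable[R.ℱ t] Z) {W : Ω → ENNReal}
    (hW : Measurable[R.ℱ t] W) {Φ : α × (Fin (p.gradBatch t) → Ξ) → B} (hΦ : Measurable Φ) :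
    ∫⁻ ω, ‖Φ (Z ω, fun j => R.gradSample t j ω)‖ₑ ^ 2 / W ω ∂μ
      = ∫⁻ ω, eLpNorm (fun y => Φ (Z ω, y)) 2 (Measure.pi fun _ => P) ^ 2 / W ω ∂μ :=
  lintegral_fresh_batch_sq_div (R.measurable_sample ht) (R.map_sample ht) (R.samples_iIndep t ht)
    (R.ℱ.le t) (R.samples_indep_past t ht) Sum.inl_injective hZ hW hΦ

theorem Run.lintegral_hessSample_sq_div [IsProbabilityMeasure μ] (R : Run P f F x₀ p T μ)
    (ht : t < T) {α B : Type*} [MeasurableSpace α] [NormedAddCommGroup B] [MeasurableSpace B]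
    [OpensMeasurableSpace B] {Z : Ω → α} (hZ : Measurable[R.ℱ t] Z) {W : Ω → ENNReal}
    (hW : Measurable[R.ℱ t] W) {Φ : α × (Fin p.S₂ → Ξ) → B} (hΦ : Measurable Φ) :
    ∫⁻ ω, ‖Φ (Z ω, fun j => R.hessSample t j ω)‖ₑ ^ 2 / W ω ∂μ
      = ∫⁻ ω, eLpNorm (fun y => Φ (Z ω, y)) 2 (Measure.pi fun _ => P) ^ 2 / W ω ∂μ :=
  lintegral_fresh_batch_sq_div (R.measurable_sample ht) (R.map_sample ht) (R.samples_iIndep t ht)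
    (R.ℱ.le t) (R.samples_indep_past t ht) Sum.inr_injective hZ hW hΦ

theorem Run.measurable_gradient_batchFun (R : Run P f F x₀ p T μ) (h : IsStochasticObjective P f F)
    {t' : ℕ} (ht' : t' ≤ t) (ht : t < T) : Measurable[R.ℱ (t + 1)]
      fun ω => gradient (batchFun f fun j => R.gradSample t j ω) (R.x t' ω) :=
  h.measurable_gradient_batchFun
    ((R.x_measurable t' (ht'.trans ht.le)).mono (R.ℱ.mono (ht'.trans t.le_succ)) le_rfl)
    (R.gradSample_measurable t ht)

theorem Run.measurable_g (R : Run P f F x₀ p T μ) (h : IsStochasticObjective P f F) (ht : t < T) :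
    Measurable[R.ℱ (t + 1)] (R.g t) := by
  induction t with
  | zero =>
    rw [funext (R.g_restart 0 ht (Nat.zero_mod _))]
    exact R.measurable_gradient_batchFun h le_rfl ht
  | succ t ih =>
    by_cases hq : (t + 1) % p.q = 0
    · rw [funext (R.g_restart (t + 1) ht hq)]
      exact R.measurable_gradient_batchFun h le_rfl ht
    · rw [funext (R.g_spider t ht hq)]
      exact (((ih (t.lt_succ_self.trans ht)).mono (R.ℱ.mono (Nat.le_succ _)) le_rfl).add
        (R.measurable_gradient_batchFun h le_rfl ht)).sub
        (R.measurable_gradient_batchFun h t.le_succ ht)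

theorem Run.g_succ_sub_gradient (R : Run P f F x₀ p T μ) (ht : t + 1 < T)
    (hq : (t + 1) % p.q ≠ 0) (ω : Ω) :
    R.g (t + 1) ω - gradient F (R.x (t + 1) ω) = (R.g t ω - gradient F (R.x t ω))
      + ((gradient (batchFun f fun j => R.gradSample (t + 1) j ω) (R.x (t + 1) ω)
          - gradient F (R.x (t + 1) ω))
        - (gradient (batchFun f fun j => R.gradSample (t + 1) j ω) (R.x t ω)
          - gradient F (R.x t ω))) := by
  rw [R.g_spider t ht hq ω]
  abel

end Fresh

section Errors

theorem two_mul_le_add_sq_div (a x : ENNReal) : 2 * a ≤ x + a ^ 2 / x := by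
  rcases eq_or_ne x 0 with rfl | hx
  · rcases eq_or_ne a 0 with rfl | ha
    · simp
    · simp [ENNReal.div_zero, ha]
  rcases eq_or_ne x ⊤ with rfl | hx'
  · simp
  rcases eq_or_ne a ⊤ with rfl | ha
  · simp [ENNReal.top_div, hx']
  lift x to NNReal using hx'
  lift a to NNReal using ha
  have hx : x ≠ 0 := by simpa using hx
  rw [← ENNReal.coe_pow, ← ENNReal.coe_div hx]
  norm_cast
  rw [← NNReal.coe_le_coe]
  push_cast
  have hsq : (0 : ℝ) ≤ (x - a) ^ 2 / x := by positivity
  have hx' : (x : ℝ) ≠ 0 := by exact_mod_cast hx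
  have hexpand : ((x : ℝ) - a) ^ 2 / x = x + a ^ 2 / x - 2 * a := by field_simp; ring
  linarith

theorem lintegral_le_of_lintegral_sq_div_le {α : Type*} [MeasurableSpace α] {μ : Measure α}
    {a W : α → ENNReal} (hW : Measurable W) {c : ENNReal} (hc₀ : c ≠ 0) (hc : c ≠ ⊤)
    (h : ∫⁻ x, a x ^ 2 / W x ∂μ ≤ c ^ 2 * ∫⁻ x, W x ∂μ) :
    ∫⁻ x, a x ∂μ ≤ c * ∫⁻ x, W x ∂μ := by
  have hdiv : ∀ x, a x ^ 2 / (c * W x) = c⁻¹ * (a x ^ 2 / W x) := fun x => by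
    rw [div_eq_mul_inv, ENNReal.mul_inv (.inl hc₀) (.inl hc), div_eq_mul_inv]
    ring
  have hdouble : 2 * ∫⁻ x, a x ∂μ ≤ 2 * (c * ∫⁻ x, W x ∂μ) :=
    calc 2 * ∫⁻ x, a x ∂μ = ∫⁻ x, 2 * a x ∂μ := (lintegral_const_mul' _ _ (by finiteness)).symm
      _ ≤ ∫⁻ x, (c * W x + c⁻¹ * (a x ^ 2 / W x)) ∂μ :=
        lintegral_mono fun x => (two_mul_le_add_sq_div (a x) (c * W x)).trans_eq (by rw [hdiv])
      _ = c * ∫⁻ x, W x ∂μ + c⁻¹ * ∫⁻ x, a x ^ 2 / W x ∂μ := by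
        rw [lintegral_add_left (hW.const_mul c), lintegral_const_mul' _ _ hc,
          lintegral_const_mul' _ _ (ENNReal.inv_ne_top.2 hc₀)]
      _ ≤ c * ∫⁻ x, W x ∂μ + c⁻¹ * (c ^ 2 * ∫⁻ x, W x ∂μ) := by gcongr
      _ = 2 * (c * ∫⁻ x, W x ∂μ) := by
        rw [pow_two, mul_assoc c c, ENNReal.inv_mul_cancel_left hc₀ hc, two_mul]
  exact (ENNReal.mul_le_mul_iff_right two_ne_zero (by finiteness)).1 hdouble

theorem sq_div_self_le (x : ENNReal) : x ^ 2 / x ≤ x := by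
  rw [pow_two, mul_div_assoc]
  exact mul_le_of_le_one_right' ENNReal.div_self_le_one

theorem inv_natCast_le_ofReal {m : ℕ} {c : ℝ} (h : 1 ≤ m * c) :
    (m : ENNReal)⁻¹ ≤ ENNReal.ofReal c := by
  have hm : (0 : ℝ) < m := Nat.cast_pos.2 (Nat.pos_of_ne_zero (by rintro rfl; simp at h; linarith))
  rw [← ENNReal.ofReal_natCast, ← ENNReal.ofReal_inv_of_pos hm]
  exact ENNReal.ofReal_le_ofReal ((inv_le_iff_one_le_mul₀' hm).2 h)

variable {n m : ℕ} {Ξ Ω : Type*} [MeasurableSpace Ξ] [mΩ : MeasurableSpace Ω] {P : Measure Ξ}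
  [IsProbabilityMeasure P] {f : E n → Ξ → ℝ} {F : E n → ℝ} {x₀ : E n} {p : Params} {T t k : ℕ}
  {μ : Measure Ω} [IsProbabilityMeasure μ] {L₀ L₁ G₀ G₁ K₀ K₁ Δ c : ℝ}

theorem GradientVarianceBounded.eLpNorm_gradient_batchFun_sub_sq_le
    (hG : GradientVarianceBounded P f F G₀ G₁) (h : IsStochasticObjective P f F) (hG₀ : 0 ≤ G₀)
    (hG₁ : 0 ≤ G₁) (hm : 1 ≤ m * c) (x : E n) :
    eLpNorm (fun S : Fin m → Ξ => gradient (batchFun f S) x - gradient F x) 2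
        (Measure.pi fun _ => P) ^ 2
      ≤ ENNReal.ofReal c * ENNReal.ofReal (G₀ + G₁ * ‖gradient F x‖) ^ 2 := by
  have hm₀ : m ≠ 0 := by rintro rfl; simp at hm; linarith
  have haverage := eLpNorm_const_add_average_sq (hG.memLp_gradientNoise x)
    (hG.integral_gradientNoise x) 0 hm₀
  simp only [gradient_batchFun_sub h.twiceDifferentiable hm₀]
  simp only [zero_add, enorm_zero, ne_eq, two_ne_zero, not_false_eq_true, zero_pow] at haverage
  rw [haverage]
  gcongr
  · exact inv_natCast_le_ofReal hm
  · exact hG.eLpNorm_gradientNoise_le hG₀ hG₁ x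

theorem HessianVarianceBounded.eLpNorm_hessian_batchFun_sub_sq_le
    (hK : HessianVarianceBounded P f F K₀ K₁) (h : IsStochasticObjective P f F)
    (hF : TwiceDifferentiable F) (hn : 2 ≤ n) (hK₀ : 0 ≤ K₀) (hK₁ : 0 ≤ K₁)
    (hm₀ : m ≠ 0) (hm : 56 * Real.log n ≤ m * c) (x : E n) :
    eLpNorm (fun S : Fin m → Ξ => hessian (batchFun f S) x - hessian F x) 2
        (Measure.pi fun _ => P) ^ 2
      ≤ ENNReal.ofReal c * ENNReal.ofReal (K₀ + K₁ * ‖gradient F x‖) ^ 2 := by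
  have hfinrank : Module.finrank ℝ (E n) = n := finrank_euclideanSpace_fin
  have haverage := eLpNorm_operator_average_sq_le (hfinrank.symm ▸ hn)
    (h.measurable_hessianNoise.comp measurable_prodMk_left)
    ((hK.memLp_hessianNoise x).integrable one_le_two) (hK.integral_hessianNoise x)
    (fun s => isSymmetric_hessianNoise (h.twiceDifferentiable s) hF x) hm₀
  have hm_pos : (0 : ℝ) < m := by exact_mod_cast Nat.pos_of_ne_zero hm₀
  have hfactor : (m : ENNReal)⁻¹ * ENNReal.ofReal (56 * Real.log n) ≤ ENNReal.ofReal c := by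
    rw [← ENNReal.ofReal_natCast, ← ENNReal.ofReal_inv_of_pos hm_pos,
      ← ENNReal.ofReal_mul (by positivity)]
    exact ENNReal.ofReal_le_ofReal ((inv_mul_le_iff₀ hm_pos).2 hm)
  simp only [hessian_batchFun_sub h.twiceDifferentiable hm₀]
  rw [hfinrank, ← mul_assoc] at haverage
  refine haverage.trans ?_
  gcongr
  exact hK.eLpNorm_hessianNoise_le hK₀ hK₁ x

theorem HessianVarianceBounded.eLpNorm_add_gradient_batchFun_sub_sq_le
    (hK : HessianVarianceBounded P f F K₀ K₁) (hG : GradientVarianceBounded P f F G₀ G₁)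
    (h : IsStochasticObjective P f F) (hF : TwiceDifferentiable F)
    (hsmooth : GeneralizedSmooth F L₀ L₁) (hK₀ : 0 ≤ K₀) (hK₁ : 0 ≤ K₁) (hL₀ : 0 ≤ L₀)
    (hL₁ : 0 ≤ L₁) (hΔ : Δ ≤ 1) (hLΔ : L₁ * Δ ≤ 1) (hm : 1 ≤ m * c) {x y : E n}
    (hxy : ‖y - x‖ ≤ Δ) (e : E n) :
    eLpNorm (fun S : Fin m → Ξ => e + ((gradient (batchFun f S) y - gradient F y)
        - (gradient (batchFun f S) x - gradient F x))) 2 (Measure.pi fun _ => P) ^ 2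
      ≤ ‖e‖ₑ ^ 2 + ENNReal.ofReal c
        * ENNReal.ofReal (Δ * (K₀ + K₁ * (2 * ‖gradient F x‖ + L₀))) ^ 2 := by
  have hm₀ : m ≠ 0 := by rintro rfl; simp at hm; linarith
  have hmean : ∫ s, (gradientNoise f F y s - gradientNoise f F x s) ∂P = 0 := by
    rw [integral_sub ((hG.memLp_gradientNoise y).integrable one_le_two)
      ((hG.memLp_gradientNoise x).integrable one_le_two), hG.integral_gradientNoise,
      hG.integral_gradientNoise, sub_zero]
  have haverage := eLpNorm_const_add_average_sq
    ((hG.memLp_gradientNoise y).sub (hG.memLp_gradientNoise x)) hmean e hm₀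
  simp only [gradient_batchFun_sub h.twiceDifferentiable hm₀, ← smul_sub,
    ← Finset.sum_sub_distrib]
  refine haverage.trans_le ?_
  gcongr
  · exact inv_natCast_le_ofReal hm
  · exact hK.eLpNorm_gradientNoise_sub_le h hF hsmooth hK₀ hK₁ hL₀ hL₁ hΔ hLΔ hxy

theorem Run.lintegral_hessian_error_le (R : Run P f F x₀ p T μ) (h : IsStochasticObjective P f F)
    (hF : TwiceDifferentiable F) (hF' : Continuous (hessian F))
    (hK : HessianVarianceBounded P f F K₀ K₁) (hn : 2 ≤ n) (hK₀ : 0 ≤ K₀) (hK₁ : 0 ≤ K₁)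
    (hΔ : 0 < Δ) (hS : 22 * Real.log n ≤ p.S₂ * Δ ^ 2) (ht : t < T) :
    ∫⁻ ω, ‖R.H t ω - hessian F (R.x t ω)‖ₑ ∂μ
      ≤ ENNReal.ofReal (2 * Δ)
        * ∫⁻ ω, ENNReal.ofReal (K₀ + K₁ * ‖gradient F (R.x t ω)‖) ∂μ := by
  have hlog : 0 < Real.log n := Real.log_pos (by exact_mod_cast hn)
  have hS₂ : p.S₂ ≠ 0 := by intro h₀; simp only [h₀, Nat.cast_zero, zero_mul] at hS; linarith
  have hweight : Measurable fun x => ENNReal.ofReal (K₀ + K₁ * ‖gradient F x‖) :=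
    ((hF.continuous_gradient.measurable.norm.const_mul K₁).const_add K₀).ennreal_ofReal
  have hW : Measurable[R.ℱ t] fun ω => ENNReal.ofReal (K₀ + K₁ * ‖gradient F (R.x t ω)‖) :=
    hweight.comp (R.x_measurable t ht.le)
  have hΦ : Measurable fun q : E n × (Fin p.S₂ → Ξ) => hessian (batchFun f q.2) q.1
      - hessian F q.1 :=
    (h.measurable_hessian_batchFun measurable_fst fun j => by fun_prop).sub
      (hF'.measurable.comp measurable_fst)
  refine lintegral_le_of_lintegral_sq_div_le (hW.mono (R.ℱ.le t) le_rfl)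
    (by simpa using hΔ) ENNReal.ofReal_ne_top ?_
  simp only [R.H_eq t ht]
  rw [R.lintegral_hessSample_sq_div ht (R.x_measurable t ht.le) hW hΦ,
    ← lintegral_const_mul' _ _ (by finiteness)]
  refine lintegral_mono fun ω => ?_
  have hbatch := hK.eLpNorm_hessian_batchFun_sub_sq_le (c := (2 * Δ) ^ 2) h hF hn hK₀ hK₁ hS₂
    (by nlinarith) (R.x t ω)
  rw [← ENNReal.ofReal_pow (by positivity)]
  refine (ENNReal.div_le_div_right hbatch _).trans ?_
  rw [mul_div_assoc]
  gcongr
  exact sq_div_self_le _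

theorem Run.lintegral_restart_error_le (R : Run P f F x₀ p T μ)
    (h : IsStochasticObjective P f F) (hF : TwiceDifferentiable F)
    (hG : GradientVarianceBounded P f F G₀ G₁) (hG₀ : 0 ≤ G₀) (hG₁ : 0 ≤ G₁)
    (hS : 1 ≤ p.S₁ * c) (ht : t < T) (hq : t % p.q = 0) {W : Ω → ENNReal}
    (hW : Measurable[R.ℱ t] W)
    (hWG : ∀ ω, ENNReal.ofReal (G₀ + G₁ * ‖gradient F (R.x t ω)‖) ≤ W ω) :
    ∫⁻ ω, ‖R.g t ω - gradient F (R.x t ω)‖ₑ ^ 2 / W ω ∂μ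
      ≤ ENNReal.ofReal c * ∫⁻ ω, W ω ∂μ := by
  have hS' : 1 ≤ p.gradBatch t * c := by rwa [Params.gradBatch, if_pos hq]
  have hΦ : Measurable fun q : E n × (Fin (p.gradBatch t) → Ξ) => gradient (batchFun f q.2) q.1
      - gradient F q.1 :=
    (h.measurable_gradient_batchFun measurable_fst fun j => by fun_prop).sub
      (hF.continuous_gradient.measurable.comp measurable_fst)
  simp only [R.g_restart t ht hq]
  rw [R.lintegral_gradSample_sq_div ht (R.x_measurable t ht.le) hW hΦ,
    ← lintegral_const_mul' _ _ (by finiteness)]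
  refine lintegral_mono fun ω => ?_
  refine (ENNReal.div_le_div_right
    (hG.eLpNorm_gradient_batchFun_sub_sq_le h hG₀ hG₁ hS' (R.x t ω)) _).trans ?_
  rw [mul_div_assoc]
  gcongr
  exact (ENNReal.div_le_div_right (pow_le_pow_left' (hWG ω) 2) _).trans (sq_div_self_le _)

theorem Run.lintegral_spider_error_le (R : Run P f F x₀ p T μ)
    (h : IsStochasticObjective P f F) (hF : TwiceDifferentiable F)
    (hsmooth : GeneralizedSmooth F L₀ L₁) (hG : GradientVarianceBounded P f F G₀ G₁)
    (hK : HessianVarianceBounded P f F K₀ K₁) (hK₀ : 0 ≤ K₀) (hK₁ : 0 ≤ K₁) (hL₀ : 0 ≤ L₀)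
    (hL₁ : 0 ≤ L₁) (hΔ : p.radius ≤ 1) (hLΔ : L₁ * p.radius ≤ 1) (hc : 0 ≤ c)
    (hS : 1 ≤ p.S₃ * c) (ht : t + 1 < T) (hq : (t + 1) % p.q ≠ 0) {W : Ω → ENNReal}
    (hW : Measurable[R.ℱ (t + 1)] W)
    (hWK : ∀ ω, ENNReal.ofReal (K₀ + K₁ * (2 * ‖gradient F (R.x t ω)‖ + L₀)) ≤ W ω) :
    ∫⁻ ω, ‖R.g (t + 1) ω - gradient F (R.x (t + 1) ω)‖ₑ ^ 2 / W ω ∂μ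
      ≤ ∫⁻ ω, ‖R.g t ω - gradient F (R.x t ω)‖ₑ ^ 2 / W ω ∂μ
        + ENNReal.ofReal (p.radius ^ 2 * c) * ∫⁻ ω, W ω ∂μ := by
  have hS' : 1 ≤ p.gradBatch (t + 1) * c := by rwa [Params.gradBatch, if_neg hq]
  have hF' : Measurable (gradient F) := hF.continuous_gradient.measurable
  have hx : Measurable[R.ℱ (t + 1)] (R.x t) :=
    (R.x_measurable t (t.le_succ.trans ht.le)).mono (R.ℱ.mono t.le_succ) le_rfl
  have hx' : Measurable[R.ℱ (t + 1)] (R.x (t + 1)) := R.x_measurable (t + 1) ht.le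
  have he : Measurable[R.ℱ (t + 1)] fun ω => R.g t ω - gradient F (R.x t ω) :=
    (R.measurable_g h (t.lt_succ_self.trans ht)).sub (hF'.comp hx)
  have hΦ : Measurable fun q : (E n × E n × E n) × (Fin (p.gradBatch (t + 1)) → Ξ) =>
      q.1.1 + ((gradient (batchFun f q.2) q.1.2.2 - gradient F q.1.2.2)
        - (gradient (batchFun f q.2) q.1.2.1 - gradient F q.1.2.1)) :=
    measurable_fst.fst.add
      (((h.measurable_gradient_batchFun measurable_fst.snd.snd fun j => by fun_prop).sub
        (hF'.comp measurable_fst.snd.snd)).sub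
        ((h.measurable_gradient_batchFun measurable_fst.snd.fst fun j => by fun_prop).sub
        (hF'.comp measurable_fst.snd.fst)))
  simp only [R.g_succ_sub_gradient ht hq]
  rw [R.lintegral_gradSample_sq_div ht (he.prodMk (hx.prodMk hx')) hW hΦ,
    ← lintegral_const_mul' _ _ (by finiteness),
    ← lintegral_add_right _ ((hW.mono (R.ℱ.le _) le_rfl).const_mul _)]
  refine lintegral_mono fun ω => ?_
  have hstep := (R.step t (t.lt_succ_self.trans ht) ω).1
  refine (ENNReal.div_le_div_right (hK.eLpNorm_add_gradient_batchFun_sub_sq_le hG h hF hsmooth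
    hK₀ hK₁ hL₀ hL₁ hΔ hLΔ hS' hstep _) _).trans ?_
  rw [ENNReal.add_div, ENNReal.ofReal_mul ((norm_nonneg _).trans hstep), mul_pow, ← mul_assoc,
    ← ENNReal.ofReal_pow ((norm_nonneg _).trans hstep), ← ENNReal.ofReal_mul hc, mul_div_assoc,
    mul_comm c]
  refine add_le_add le_rfl (mul_le_mul' le_rfl ?_)
  exact (ENNReal.div_le_div_right (pow_le_pow_left' (hWK ω) 2) _).trans (sq_div_self_le _)

theorem Run.lintegral_epoch_error_le (R : Run P f F x₀ p T μ)
    (h : IsStochasticObjective P f F) (hF : TwiceDifferentiable F)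
    (hsmooth : GeneralizedSmooth F L₀ L₁) (hG : GradientVarianceBounded P f F G₀ G₁)
    (hK : HessianVarianceBounded P f F K₀ K₁) (hG₀ : 0 ≤ G₀) (hG₁ : 0 ≤ G₁) (hK₀ : 0 ≤ K₀)
    (hK₁ : 0 ≤ K₁) (hL₀ : 0 ≤ L₀) (hL₁ : 0 ≤ L₁) (hΔ₀ : 0 < p.radius) (hΔ : p.radius ≤ 1)
    (hLΔ : L₁ * p.radius ≤ 1) (hS₁ : 1 ≤ p.S₁ * p.radius ^ 4) (hS₃ : 1 ≤ p.S₃ * p.radius ^ 3)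
    (hq : t % p.q = 0) (hkq : k < p.q) (hk : k * p.radius ≤ 2) (ht : t + k < T)
    {W : Ω → ENNReal} (hW : Measurable[R.ℱ t] W)
    (hWG : ∀ ω, ENNReal.ofReal (G₀ + G₁ * ‖gradient F (R.x t ω)‖) ≤ W ω)
    (hWK : ∀ j < k, ∀ ω,
      ENNReal.ofReal (K₀ + K₁ * (2 * ‖gradient F (R.x (t + j) ω)‖ + L₀)) ≤ W ω) :
    ∫⁻ ω, ‖R.g (t + k) ω - gradient F (R.x (t + k) ω)‖ₑ ∂μ
      ≤ ENNReal.ofReal (2 * p.radius ^ 2) * ∫⁻ ω, W ω ∂μ := by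
  have haccumulated : ∀ j ≤ k,
      ∫⁻ ω, ‖R.g (t + j) ω - gradient F (R.x (t + j) ω)‖ₑ ^ 2 / W ω ∂μ
        ≤ ENNReal.ofReal (p.radius ^ 4 + j * p.radius ^ 5) * ∫⁻ ω, W ω ∂μ := by
    intro j
    induction j with
    | zero =>
      intro _
      simpa only [add_zero, Nat.cast_zero, zero_mul] using
        R.lintegral_restart_error_le h hF hG hG₀ hG₁ hS₁ (by omega) hq hW hWG
    | succ j ih =>
      intro hj
      have hq' : (t + j + 1) % p.q ≠ 0 := by
        rw [add_assoc, Nat.add_mod, hq, zero_add, Nat.mod_mod, Nat.mod_eq_of_lt (by omega)]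
        omega
      calc _ ≤ _ := R.lintegral_spider_error_le h hF hsmooth hG hK hK₀ hK₁ hL₀ hL₁ hΔ hLΔ
            (by positivity) hS₃ (by omega) hq' (hW.mono (R.ℱ.mono (by omega)) le_rfl)
            (hWK j (by omega))
        _ ≤ _ := add_le_add_left (ih (by omega)) _
        _ = _ := by
          rw [← add_mul, ← ENNReal.ofReal_add (by positivity) (by positivity)]
          congr 2
          push_cast
          ring
  refine lintegral_le_of_lintegral_sq_div_le (hW.mono (R.ℱ.le t) le_rfl)
    (ENNReal.ofReal_pos.2 (by positivity)).ne' ENNReal.ofReal_ne_top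
    ((haccumulated k le_rfl).trans ?_)
  rw [← ENNReal.ofReal_pow (by positivity)]
  gcongr
  nlinarith [mul_le_mul_of_nonneg_right hk (pow_nonneg hΔ₀.le 4), pow_nonneg hΔ₀.le 4]

end Errors

section Progress

theorem le_exp_mul_of_affine_growth {a : ℕ → ℝ} {u v : ℝ} {k : ℕ} (hu : 0 ≤ u) (hv : 0 ≤ v)
    (ha : 0 ≤ a 0) (h : ∀ j < k, a (j + 1) ≤ (1 + u) * a j + v) :
    a k ≤ Real.exp (u * k) * (a 0 + v * k) := by
  induction k with
  | zero => simp
  | succ k ih =>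
    have hexp : 1 + u ≤ Real.exp u := by linarith [Real.add_one_le_exp u]
    have hone : 1 ≤ Real.exp (u * (k + 1)) := Real.one_le_exp (by positivity)
    calc a (k + 1)
      _ ≤ (1 + u) * a k + v := h k k.lt_succ_self
      _ ≤ Real.exp u * (Real.exp (u * k) * (a 0 + v * k)) + Real.exp (u * (k + 1)) * v :=
        add_le_add
          ((mul_le_mul_of_nonneg_left (ih fun j hj => h j (hj.trans k.lt_succ_self))
            (by positivity)).trans (mul_le_mul_of_nonneg_right hexp (by positivity)))
          (le_mul_of_one_le_left hv hone)
      _ = Real.exp (u * (k + 1)) * (a 0 + v * (k + 1)) := by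
        rw [← mul_assoc, ← Real.exp_add]
        ring_nf
      _ = Real.exp (u * (k + 1 : ℕ)) * (a 0 + v * (k + 1 : ℕ)) := by push_cast; rfl

theorem GeneralizedSmooth.norm_gradient_le_exp_mul {n k : ℕ} {F : E n → ℝ} {L₀ L₁ Δ D : ℝ}
    (h : GeneralizedSmooth F L₀ L₁) (hL₀ : 0 ≤ L₀) (hL₁ : 0 ≤ L₁) (hΔ : 0 ≤ Δ)
    (hLΔ : L₁ * Δ ≤ 1) (hk : k * Δ ≤ D) {y : ℕ → E n} (hy : ∀ j < k, ‖y j - y (j + 1)‖ ≤ Δ) :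
    ‖gradient F (y k)‖ ≤ Real.exp (D * L₁) * (‖gradient F (y 0)‖ + D * L₀) := by
  have hgrowth := le_exp_mul_of_affine_growth (a := fun j => ‖gradient F (y j)‖)
    (mul_nonneg hL₁ hΔ) (mul_nonneg hL₀ hΔ) (norm_nonneg _)
    fun j hj => h.norm_gradient_le hL₀ hL₁ hLΔ (hy j hj)
  have hkL₁ : L₁ * Δ * k ≤ D * L₁ := by linarith [mul_le_mul_of_nonneg_left hk hL₁]
  have hkL₀ : L₀ * Δ * k ≤ D * L₀ := by linarith [mul_le_mul_of_nonneg_left hk hL₀]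
  exact hgrowth.trans (by gcongr)

theorem integral_norm_le_of_lintegral_enorm_le {Ω B : Type*} [MeasurableSpace Ω]
    [NormedAddCommGroup B] {μ : Measure Ω} {A : Ω → B} {w : Ω → ℝ} {c : ℝ}
    (hA : AEStronglyMeasurable A μ) (hw : Integrable w μ) (hw₀ : ∀ ω, 0 ≤ w ω) (hc : 0 ≤ c)
    (h : ∫⁻ ω, ‖A ω‖ₑ ∂μ ≤ ENNReal.ofReal c * ∫⁻ ω, ENNReal.ofReal (w ω) ∂μ) :
    Integrable (fun ω => ‖A ω‖) μ ∧ ∫ ω, ‖A ω‖ ∂μ ≤ c * ∫ ω, w ω ∂μ := by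
  rw [← ofReal_integral_eq_lintegral_ofReal hw (Filter.Eventually.of_forall hw₀),
    ← ENNReal.ofReal_mul hc] at h
  refine ⟨Integrable.norm ⟨hA, h.trans_lt ENNReal.ofReal_lt_top⟩, ?_⟩
  rw [integral_norm_eq_lintegral_enorm hA]
  exact ENNReal.toReal_le_of_le_ofReal (mul_nonneg hc (integral_nonneg hw₀)) h

/-- The assumptions on the objective and on its stochastic gradients and Hessians that enter the
analysis of a run. -/
structure Assumptions {n : ℕ} {Ξ : Type*} [MeasurableSpace Ξ] (P : Measure Ξ)
    (f : E n → Ξ → ℝ) (F : E n → ℝ) (L₀ L₁ G₀ G₁ M₀ M₁ K₀ K₁ δ : ℝ) : Prop where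
  L₀_nonneg : 0 ≤ L₀
  L₁_nonneg : 0 ≤ L₁
  G₀_nonneg : 0 ≤ G₀
  G₁_nonneg : 0 ≤ G₁
  M₀_nonneg : 0 ≤ M₀
  M₁_nonneg : 0 ≤ M₁
  K₀_nonneg : 0 ≤ K₀
  K₁_nonneg : 0 ≤ K₁
  δ_pos : 0 < δ
  objective : IsStochasticObjective P f F
  smooth : GeneralizedSmooth F L₀ L₁
  gradient_variance : GradientVarianceBounded P f F G₀ G₁
  second_order : SecondOrderGeneralizedSmooth F δ M₀ M₁
  hessian_variance : HessianVarianceBounded P f F K₀ K₁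

/-- Compatibility of the trust radius with the batch sizes, the epoch length and the smoothness
constants: the batches are large enough for gradient errors of order `Δ²` and Hessian errors of
order `Δ`, and the iterates move by at most `2` within an epoch. -/
structure Params.Balanced (p : Params) (n : ℕ) (L₁ δ : ℝ) : Prop where
  pos : 0 < p.radius
  le_one : p.radius ≤ 1
  mul_le_one : L₁ * p.radius ≤ 1
  le_δ : p.radius ≤ δ
  le_S₁ : 1 ≤ p.S₁ * p.radius ^ 4
  le_S₂ : 22 * Real.log n ≤ p.S₂ * p.radius ^ 2
  le_S₃ : 1 ≤ p.S₃ * p.radius ^ 3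
  q_pos : 0 < p.q
  q_mul_le : p.q * p.radius ≤ 2

/-- The coefficient of the gradient norm at the start of an epoch in the bound on the noise level
during the epoch; `exp (2 * L₁)` is the growth of the gradient norm along a path of length `2`. -/
noncomputable def epochSlope (L₁ G₁ K₁ : ℝ) : ℝ :=
  G₁ + 2 * Real.exp (2 * L₁) * K₁

/-- The constant term in the bound on the noise level during an epoch. -/
noncomputable def epochOffset (L₀ L₁ G₀ K₀ K₁ : ℝ) : ℝ :=
  G₀ + K₀ + K₁ * (4 * Real.exp (2 * L₁) * L₀ + L₀)

/-- The coefficient of the expected gradient norm at `x_{t+1}` in the bound on the expected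
`stepError` of iteration `t`, in units of `Δ³`. -/
noncomputable def stepSlope (L₁ G₁ M₁ K₁ : ℝ) : ℝ :=
  6 * epochSlope L₁ G₁ K₁ * Real.exp (2 * L₁) + 8 * K₁ + 6 * M₁

/-- The constant term in the bound on the expected `stepError`, in units of `Δ³`. -/
noncomputable def stepOffset (L₀ L₁ G₀ G₁ M₀ M₁ K₀ K₁ : ℝ) : ℝ :=
  6 * (epochOffset L₀ L₁ G₀ K₀ K₁ + 2 * epochSlope L₁ G₁ K₁ * Real.exp (2 * L₁) * L₀)
    + 4 * (K₀ + K₁ * L₀) + 3 * (M₀ + M₁ * L₀)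

variable {n : ℕ} {Ξ Ω : Type*} [MeasurableSpace Ξ] [mΩ : MeasurableSpace Ω] {P : Measure Ξ}
  {f : E n → Ξ → ℝ} {F : E n → ℝ} {x₀ : E n} {p : Params} {T s t k : ℕ} {μ : Measure Ω}
  {L₀ L₁ G₀ G₁ M₀ M₁ K₀ K₁ δ D : ℝ}

theorem epochSlope_nonneg (hG₁ : 0 ≤ G₁) (hK₁ : 0 ≤ K₁) : 0 ≤ epochSlope L₁ G₁ K₁ := by
  unfold epochSlope
  positivity

theorem epochOffset_nonneg (hL₀ : 0 ≤ L₀) (hG₀ : 0 ≤ G₀) (hK₀ : 0 ≤ K₀) (hK₁ : 0 ≤ K₁) :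
    0 ≤ epochOffset L₀ L₁ G₀ K₀ K₁ := by
  unfold epochOffset
  positivity

theorem stepOffset_nonneg (hL₀ : 0 ≤ L₀) (hG₀ : 0 ≤ G₀) (hG₁ : 0 ≤ G₁) (hM₀ : 0 ≤ M₀)
    (hM₁ : 0 ≤ M₁) (hK₀ : 0 ≤ K₀) (hK₁ : 0 ≤ K₁) :
    0 ≤ stepOffset L₀ L₁ G₀ G₁ M₀ M₁ K₀ K₁ := by
  have hslope := epochSlope_nonneg (L₁ := L₁) hG₁ hK₁
  have hoffset := epochOffset_nonneg (L₁ := L₁) hL₀ hG₀ hK₀ hK₁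
  unfold stepOffset
  positivity

theorem Run.norm_sub_le (R : Run P f F x₀ p T μ) (ht : t ≤ T) (ω : Ω) :
    ‖R.x t ω - x₀‖ ≤ t * p.radius := by
  induction t with
  | zero => simp [R.x_zero]
  | succ t ih =>
    calc ‖R.x (t + 1) ω - x₀‖
      _ ≤ ‖R.x (t + 1) ω - R.x t ω‖ + ‖R.x t ω - x₀‖ := norm_sub_le_norm_sub_add_norm_sub _ _ _
      _ ≤ p.radius + t * p.radius := add_le_add (R.step t ht ω).1 (ih (t.le_succ.trans ht))
      _ = (t + 1 : ℕ) * p.radius := by push_cast; ring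

theorem Run.integrable_comp [IsFiniteMeasure μ] (R : Run P f F x₀ p T μ) (ht : t ≤ T)
    {φ : E n → ℝ} (hφ : Continuous φ) : Integrable (fun ω => φ (R.x t ω)) μ := by
  obtain ⟨C, hC⟩ := (isCompact_closedBall x₀ (t * p.radius)).exists_bound_of_continuousOn
    hφ.continuousOn
  refine Integrable.of_bound (C := C)
    (hφ.measurable.comp ((R.x_measurable t ht).mono (R.ℱ.le t) le_rfl)).aestronglyMeasurable
    (Filter.Eventually.of_forall fun ω => hC _ (mem_closedBall_iff_norm.2 (R.norm_sub_le ht ω)))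

theorem Run.norm_gradient_x_add_le (R : Run P f F x₀ p T μ) (h : GeneralizedSmooth F L₀ L₁)
    (hL₀ : 0 ≤ L₀) (hL₁ : 0 ≤ L₁) (hΔ : 0 ≤ p.radius) (hLΔ : L₁ * p.radius ≤ 1)
    (hk : k * p.radius ≤ D) (ht : t + k ≤ T) (ω : Ω) :
    ‖gradient F (R.x (t + k) ω)‖
      ≤ Real.exp (D * L₁) * (‖gradient F (R.x t ω)‖ + D * L₀) :=
  h.norm_gradient_le_exp_mul hL₀ hL₁ hΔ hLΔ hk (y := fun j => R.x (t + j) ω) fun j hj => by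
    rw [norm_sub_rev]
    exact (R.step (t + j) (by omega) ω).1

theorem Run.norm_gradient_x_le_of_add (R : Run P f F x₀ p T μ) (h : GeneralizedSmooth F L₀ L₁)
    (hL₀ : 0 ≤ L₀) (hL₁ : 0 ≤ L₁) (hΔ : 0 ≤ p.radius) (hLΔ : L₁ * p.radius ≤ 1)
    (hk : k * p.radius ≤ D) (ht : t + k ≤ T) (ω : Ω) :
    ‖gradient F (R.x t ω)‖
      ≤ Real.exp (D * L₁) * (‖gradient F (R.x (t + k) ω)‖ + D * L₀) := by
  have hbackward := h.norm_gradient_le_exp_mul hL₀ hL₁ hΔ hLΔ hk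
    (y := fun j => R.x (t + (k - j)) ω) fun j hj => by
      have hstep := (R.step (t + (k - (j + 1))) (by omega) ω).1
      rwa [show t + (k - (j + 1)) + 1 = t + (k - j) by omega] at hstep
  simpa only [Nat.sub_self, add_zero, Nat.sub_zero] using hbackward

theorem Run.hessian_noise_le_epoch_noise (R : Run P f F x₀ p T μ)
    (h : Assumptions P f F L₀ L₁ G₀ G₁ M₀ M₁ K₀ K₁ δ) (hp : p.Balanced n L₁ δ)
    (hk : k * p.radius ≤ 2) (ht : t + k ≤ T) (ω : Ω) :
    K₀ + K₁ * (2 * ‖gradient F (R.x (t + k) ω)‖ + L₀)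
      ≤ epochOffset L₀ L₁ G₀ K₀ K₁ + epochSlope L₁ G₁ K₁ * ‖gradient F (R.x t ω)‖ := by
  have hgrowth := mul_le_mul_of_nonneg_left (R.norm_gradient_x_add_le h.smooth h.L₀_nonneg
    h.L₁_nonneg hp.pos.le hp.mul_le_one hk ht ω) h.K₁_nonneg
  have hG₁ := mul_nonneg h.G₁_nonneg (norm_nonneg (gradient F (R.x t ω)))
  unfold epochOffset epochSlope
  linarith [h.G₀_nonneg]

theorem Run.integral_norm_gradient_le [IsProbabilityMeasure μ] (R : Run P f F x₀ p T μ)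
    (h : Assumptions P f F L₀ L₁ G₀ G₁ M₀ M₁ K₀ K₁ δ) (hp : p.Balanced n L₁ δ) (ht : t < T) :
    ∫ ω, ‖gradient F (R.x t ω)‖ ∂μ ≤ 2 * ∫ ω, ‖gradient F (R.x (t + 1) ω)‖ ∂μ + L₀ := by
  have hgrad : Continuous fun x => ‖gradient F x‖ := h.second_order.1.continuous_gradient.norm
  have hnow := R.integrable_comp ht.le hgrad
  have hnext := R.integrable_comp (t := t + 1) ht hgrad
  have hstep : ∀ ω, ‖gradient F (R.x t ω)‖ ≤ 2 * ‖gradient F (R.x (t + 1) ω)‖ + L₀ := by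
    intro ω
    refine (h.smooth.norm_gradient_le h.L₀_nonneg h.L₁_nonneg hp.mul_le_one
      (R.step t ht ω).1).trans ?_
    exact add_le_add (mul_le_mul_of_nonneg_right (by linarith [hp.mul_le_one]) (norm_nonneg _))
      (mul_le_of_le_one_right h.L₀_nonneg hp.le_one)
  refine (integral_mono hnow ((hnext.const_mul 2).add (integrable_const L₀)) hstep).trans_eq ?_
  simp only [Pi.add_apply]
  rw [integral_add (hnext.const_mul _) (integrable_const _), integral_const_mul, integral_const,
    probReal_univ, one_smul]

variable [IsProbabilityMeasure P] [IsProbabilityMeasure μ]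

theorem Run.integral_epoch_error_le (R : Run P f F x₀ p T μ)
    (h : Assumptions P f F L₀ L₁ G₀ G₁ M₀ M₁ K₀ K₁ δ) (hp : p.Balanced n L₁ δ)
    (hs : s % p.q = 0) (hk : k < p.q) (ht : s + k < T) :
    Integrable (fun ω => ‖R.g (s + k) ω - gradient F (R.x (s + k) ω)‖) μ ∧
    ∫ ω, ‖R.g (s + k) ω - gradient F (R.x (s + k) ω)‖ ∂μ ≤ 2 * p.radius ^ 2 *
      ∫ ω, epochOffset L₀ L₁ G₀ K₀ K₁ + epochSlope L₁ G₁ K₁ * ‖gradient F (R.x s ω)‖ ∂μ := by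
  have hslope := epochSlope_nonneg (L₁ := L₁) h.G₁_nonneg h.K₁_nonneg
  have hoffset := epochOffset_nonneg (L₁ := L₁) h.L₀_nonneg h.G₀_nonneg h.K₀_nonneg h.K₁_nonneg
  have hgrad : Continuous (gradient F) := h.second_order.1.continuous_gradient
  have hweight : Continuous fun x =>
      epochOffset L₀ L₁ G₀ K₀ K₁ + epochSlope L₁ G₁ K₁ * ‖gradient F x‖ := by fun_prop
  have hmul_le_two : ∀ j ≤ k, j * p.radius ≤ 2 := fun j hj =>
    (mul_le_mul_of_nonneg_right (by exact_mod_cast hj.trans hk.le) hp.pos.le).trans hp.q_mul_le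
  have hmeas : Measurable fun ω => R.g (s + k) ω - gradient F (R.x (s + k) ω) :=
    ((R.measurable_g h.objective ht).mono (R.ℱ.le _) le_rfl).sub
      (hgrad.measurable.comp ((R.x_measurable _ ht.le).mono (R.ℱ.le _) le_rfl))
  refine integral_norm_le_of_lintegral_enorm_le hmeas.aestronglyMeasurable
    (R.integrable_comp (by omega) hweight) (fun ω => by positivity) (by positivity) ?_
  refine R.lintegral_epoch_error_le h.objective h.second_order.1 h.smooth h.gradient_variance
    h.hessian_variance h.G₀_nonneg h.G₁_nonneg h.K₀_nonneg h.K₁_nonneg h.L₀_nonneg h.L₁_nonneg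
    hp.pos hp.le_one hp.mul_le_one hp.le_S₁ hp.le_S₃ hs hk (hmul_le_two k le_rfl) ht
    (hweight.measurable.ennreal_ofReal.comp (R.x_measurable s (by omega)))
    (fun ω => ENNReal.ofReal_le_ofReal ?_)
    (fun j hj ω => ENNReal.ofReal_le_ofReal
      (R.hessian_noise_le_epoch_noise h hp (hmul_le_two j hj.le) (by omega) ω))
  have hK₀ := h.K₀_nonneg
  have hK₁ := h.K₁_nonneg
  have hL₀ := h.L₀_nonneg
  unfold epochOffset epochSlope
  gcongr
  · exact le_add_of_le_of_nonneg (le_add_of_nonneg_right hK₀) (by positivity)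
  · exact le_add_of_nonneg_right (by positivity)

theorem Run.integral_gradient_error_le (R : Run P f F x₀ p T μ)
    (h : Assumptions P f F L₀ L₁ G₀ G₁ M₀ M₁ K₀ K₁ δ) (hp : p.Balanced n L₁ δ) (ht : t < T) :
    Integrable (fun ω => ‖R.g t ω - gradient F (R.x t ω)‖) μ ∧
    ∫ ω, ‖R.g t ω - gradient F (R.x t ω)‖ ∂μ ≤ 2 * p.radius ^ 2 *
      (epochOffset L₀ L₁ G₀ K₀ K₁ + epochSlope L₁ G₁ K₁ *
        (Real.exp (2 * L₁) * (∫ ω, ‖gradient F (R.x (t + 1) ω)‖ ∂μ + 2 * L₀))) := by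
  have hΔ := hp.pos
  have hslope := epochSlope_nonneg (L₁ := L₁) h.G₁_nonneg h.K₁_nonneg
  have hgrad : Continuous fun x => ‖gradient F x‖ := h.second_order.1.continuous_gradient.norm
  obtain ⟨s, k, hs, hk, rfl⟩ : ∃ s k, s % p.q = 0 ∧ k < p.q ∧ s + k = t :=
    ⟨_, _, Nat.mul_mod_right _ _, Nat.mod_lt _ hp.q_pos, Nat.div_add_mod t p.q⟩
  obtain ⟨hintegrable, hle⟩ := R.integral_epoch_error_le h hp hs hk ht
  refine ⟨hintegrable, hle.trans (mul_le_mul_of_nonneg_left ?_ (by positivity))⟩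
  have hnow := R.integrable_comp (t := s) (by omega) hgrad
  have hnext := R.integrable_comp (t := s + k + 1) ht hgrad
  have hgrowth : ∫ ω, ‖gradient F (R.x s ω)‖ ∂μ
      ≤ ∫ ω, Real.exp (2 * L₁) * (‖gradient F (R.x (s + k + 1) ω)‖ + 2 * L₀) ∂μ := by
    refine integral_mono hnow ((hnext.add (integrable_const _)).const_mul _) fun ω => ?_
    refine R.norm_gradient_x_le_of_add (k := k + 1) h.smooth h.L₀_nonneg h.L₁_nonneg hΔ.le
      hp.mul_le_one ?_ ht ω
    exact (mul_le_mul_of_nonneg_right (by exact_mod_cast hk) hΔ.le).trans hp.q_mul_le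
  rw [integral_const_mul, integral_add hnext (integrable_const _), integral_const,
    probReal_univ, one_smul] at hgrowth
  rw [integral_add (integrable_const _) (hnow.const_mul _), integral_const, probReal_univ,
    one_smul, integral_const_mul]
  gcongr

theorem Run.integral_hessian_error_le (R : Run P f F x₀ p T μ) (hn : 2 ≤ n)
    (h : Assumptions P f F L₀ L₁ G₀ G₁ M₀ M₁ K₀ K₁ δ) (hp : p.Balanced n L₁ δ) (ht : t < T) :
    Integrable (fun ω => ‖R.H t ω - hessian F (R.x t ω)‖) μ ∧
    ∫ ω, ‖R.H t ω - hessian F (R.x t ω)‖ ∂μ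
      ≤ 2 * p.radius * (K₀ + K₁ * ∫ ω, ‖gradient F (R.x t ω)‖ ∂μ) := by
  have hK₀ := h.K₀_nonneg
  have hK₁ := h.K₁_nonneg
  have hΔ := hp.pos
  have hhess := h.second_order.continuous_hessian h.δ_pos
  have hx : Measurable (R.x t) := (R.x_measurable t ht.le).mono (R.ℱ.le _) le_rfl
  have hH : Measurable (R.H t) := by
    rw [funext (R.H_eq t ht)]
    exact h.objective.measurable_hessian_batchFun hx
      fun j => (R.hessSample_measurable t ht j).mono (R.ℱ.le _) le_rfl
  have hgrad : Integrable (fun ω => ‖gradient F (R.x t ω)‖) μ :=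
    R.integrable_comp ht.le h.second_order.1.continuous_gradient.norm
  obtain ⟨hintegrable, hle⟩ := integral_norm_le_of_lintegral_enorm_le
    (hH.sub (hhess.measurable.comp hx)).aestronglyMeasurable
    ((integrable_const K₀).add (hgrad.const_mul K₁))
    (fun ω => add_nonneg hK₀ (mul_nonneg hK₁ (norm_nonneg _))) (by positivity)
    (R.lintegral_hessian_error_le h.objective h.second_order.1 hhess h.hessian_variance hn hK₀ hK₁
      hΔ hp.le_S₂ ht)
  refine ⟨hintegrable, hle.trans_eq ?_⟩
  simp only [Pi.add_apply]
  rw [integral_add (integrable_const _) (hgrad.const_mul _), integral_const_mul, integral_const,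
    probReal_univ, one_smul]

theorem Run.integral_stepError_le (R : Run P f F x₀ p T μ) (hn : 2 ≤ n)
    (h : Assumptions P f F L₀ L₁ G₀ G₁ M₀ M₁ K₀ K₁ δ) (hp : p.Balanced n L₁ δ) (ht : t < T) :
    Integrable (fun ω => stepError F M₀ M₁ p.radius (R.x t ω) (R.g t ω) (R.H t ω)) μ ∧
    ∫ ω, stepError F M₀ M₁ p.radius (R.x t ω) (R.g t ω) (R.H t ω) ∂μ
      ≤ p.radius ^ 3 * (stepOffset L₀ L₁ G₀ G₁ M₀ M₁ K₀ K₁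
        + stepSlope L₁ G₁ M₁ K₁ * ∫ ω, ‖gradient F (R.x (t + 1) ω)‖ ∂μ) := by
  obtain ⟨hint_grad, hgrad⟩ := R.integral_gradient_error_le h hp ht
  obtain ⟨hint_hess, hhess⟩ := R.integral_hessian_error_le hn h hp ht
  have hint_norm : Integrable (fun ω => ‖gradient F (R.x t ω)‖) μ :=
    R.integrable_comp ht.le h.second_order.1.continuous_gradient.norm
  have hint_taylor : Integrable (fun ω => M₀ + M₁ * ‖gradient F (R.x t ω)‖) μ :=
    (integrable_const _).add (hint_norm.const_mul _)
  have hint_errors := (hint_grad.const_mul (3 * p.radius)).add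
    (hint_hess.const_mul (2 * p.radius ^ 2))
  refine ⟨hint_errors.add (hint_taylor.const_mul (3 * p.radius ^ 3)), ?_⟩
  have hsplit : ∫ ω, stepError F M₀ M₁ p.radius (R.x t ω) (R.g t ω) (R.H t ω) ∂μ
      = 3 * p.radius * ∫ ω, ‖R.g t ω - gradient F (R.x t ω)‖ ∂μ
        + 2 * p.radius ^ 2 * ∫ ω, ‖R.H t ω - hessian F (R.x t ω)‖ ∂μ
        + 3 * p.radius ^ 3 * (M₀ + M₁ * ∫ ω, ‖gradient F (R.x t ω)‖ ∂μ) := by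
    unfold stepError
    rw [integral_add (by exact hint_errors) (hint_taylor.const_mul _),
      integral_add (hint_grad.const_mul _) (hint_hess.const_mul _), integral_const_mul,
      integral_const_mul, integral_const_mul,
      integral_add (integrable_const _) (hint_norm.const_mul _), integral_const_mul,
      integral_const, probReal_univ, one_smul]
  have hΔ := hp.pos
  have hnorm := R.integral_norm_gradient_le h hp ht
  have hgrad' := mul_le_mul_of_nonneg_left hgrad (by positivity : 0 ≤ 3 * p.radius)
  have hhess' := mul_le_mul_of_nonneg_left hhess (by positivity : 0 ≤ 2 * p.radius ^ 2)
  have hK₁ := mul_le_mul_of_nonneg_left (mul_le_mul_of_nonneg_left hnorm h.K₁_nonneg)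
    (by positivity : 0 ≤ 4 * p.radius ^ 3)
  have hM₁ := mul_le_mul_of_nonneg_left (mul_le_mul_of_nonneg_left hnorm h.M₁_nonneg)
    (by positivity : 0 ≤ 3 * p.radius ^ 3)
  rw [hsplit, stepOffset, stepSlope]
  linarith

theorem Run.integral_le_of_le_stepError (R : Run P f F x₀ p T μ) (hn : 2 ≤ n)
    (h : Assumptions P f F L₀ L₁ G₀ G₁ M₀ M₁ K₀ K₁ δ) (hp : p.Balanced n L₁ δ) (ht : t < T)
    {φ : E n → ℝ} (hφ : Continuous φ)
    (hstep : ∀ ω, φ (R.x (t + 1) ω) ≤ 2 * (F (R.x t ω) - F (R.x (t + 1) ω))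
      + stepError F M₀ M₁ p.radius (R.x t ω) (R.g t ω) (R.H t ω)) :
    ∫ ω, φ (R.x (t + 1) ω) ∂μ
      ≤ 2 * (∫ ω, F (R.x t ω) ∂μ - ∫ ω, F (R.x (t + 1) ω) ∂μ)
        + p.radius ^ 3 * (stepOffset L₀ L₁ G₀ G₁ M₀ M₁ K₀ K₁
          + stepSlope L₁ G₁ M₁ K₁ * ∫ ω, ‖gradient F (R.x (t + 1) ω)‖ ∂μ) := by
  have hF : Continuous F := h.second_order.1.1.continuous
  have hnow := R.integrable_comp ht.le hF
  have hnext := R.integrable_comp (t := t + 1) ht hF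
  obtain ⟨hintegrable, hle⟩ := R.integral_stepError_le hn h hp ht
  have hdecrease : Integrable (fun ω => 2 * (F (R.x t ω) - F (R.x (t + 1) ω))) μ :=
    (hnow.sub hnext).const_mul 2
  refine (integral_mono (R.integrable_comp ht hφ) (hdecrease.add hintegrable) hstep).trans ?_
  simp only [Pi.add_apply]
  rw [integral_add hdecrease hintegrable, integral_const_mul, integral_sub hnow hnext]
  exact add_le_add le_rfl hle

end Progress

section RandomIndex

variable {ι Ω : Type*} [MeasurableSpace ι] [MeasurableSingletonClass ι] [MeasurableSpace Ω]
  {μ : Measure Ω} {I : Finset ι} {τ : Ω → ι} {Y : ι → Ω → ℝ}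

theorem measureReal_preimage_singleton_of_map_eq_uniformOn (hτ : Measurable τ)
    (hlaw : μ.map τ = uniformOn (I : Set ι)) {i : ι} (hi : i ∈ I) :
    μ.real (τ ⁻¹' {i}) = (I.card : ℝ)⁻¹ := by
  classical
  rw [← map_measureReal_apply hτ (measurableSet_singleton i), hlaw, Measure.real,
    ← Finset.coe_singleton, uniformOn_apply_finset, Finset.inter_singleton_of_mem hi]
  simp

theorem biUnion_preimage_singleton_ae_eq_univ (hτ : Measurable τ)
    (hlaw : μ.map τ = uniformOn (I : Set ι)) :
    (⋃ i ∈ I, τ ⁻¹' {i} : Set Ω) =ᵐ[μ] Set.univ := by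
  have hmem : ∀ᵐ i ∂μ.map τ, i ∈ (I : Set ι) := by
    rw [hlaw]
    exact ae_cond_mem I.measurableSet
  filter_upwards [ae_of_ae_map hτ.aemeasurable hmem] with ω hω
  exact eq_true (Set.mem_biUnion hω rfl)

theorem integral_comp_uniform_index (hτ : Measurable τ)
    (hlaw : μ.map τ = uniformOn (I : Set ι)) (hindep : ∀ i ∈ I, IndepFun τ (Y i) μ)
    (hY : ∀ i ∈ I, Integrable (Y i) μ) :
    Integrable (fun ω => Y (τ ω) ω) μ ∧
    ∫ ω, Y (τ ω) ω ∂μ = (I.card : ℝ)⁻¹ * ∑ i ∈ I, ∫ ω, Y i ω ∂μ := by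
  have hfiber : ∀ i, MeasurableSet (τ ⁻¹' {i}) := fun i => hτ (measurableSet_singleton i)
  have heq : ∀ i, Set.EqOn (Y i) (fun ω => Y (τ ω) ω) (τ ⁻¹' {i}) := by
    rintro _ ω rfl
    rfl
  have hintegrable : ∀ i ∈ I, IntegrableOn (fun ω => Y (τ ω) ω) (τ ⁻¹' {i}) μ := fun i hi =>
    (hY i hi).integrableOn.congr_fun (heq i) (hfiber i)
  have hcover := biUnion_preimage_singleton_ae_eq_univ hτ hlaw
  refine ⟨integrableOn_univ.1
    ((integrableOn_finset_iUnion.2 hintegrable).congr_set_ae hcover.symm), ?_⟩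
  rw [← setIntegral_univ, ← setIntegral_congr_set hcover,
    integral_biUnion_finset I (fun i _ => hfiber i) (Set.pairwiseDisjoint_fiber τ _) hintegrable,
    Finset.mul_sum]
  refine Finset.sum_congr rfl fun i hi => ?_
  rw [← setIntegral_congr_fun (hfiber i) (heq i),
    ← measureReal_preimage_singleton_of_map_eq_uniformOn hτ hlaw hi]
  exact Indep.setIntegral_eq_mul (f := id) hτ.comap_le (hindep i hi)
    (hY i hi).aemeasurable ⟨_, measurableSet_singleton i, rfl⟩ (by fun_prop)

end RandomIndex

section Average

variable {n : ℕ} {Ξ Ω : Type*} [MeasurableSpace Ξ] [MeasurableSpace Ω] {P : Measure Ξ}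
  {f : E n → Ξ → ℝ} {F : E n → ℝ} {x₀ : E n} {p : Params} {T t : ℕ} {μ : Measure Ω}
  {L₀ L₁ G₀ G₁ M₀ M₁ K₀ K₁ δ c : ℝ} {τ : Ω → ℕ}

theorem Run.isSymmetric_H (R : Run P f F x₀ p T μ) (h : IsStochasticObjective P f F)
    (ht : t < T) (ω : Ω) : (R.H t ω : E n →ₗ[ℝ] E n).IsSymmetric := by
  rw [R.H_eq t ht ω]
  exact isSymmetric_hessian_batchFun h.twiceDifferentiable _ _

variable [IsProbabilityMeasure μ]

theorem Run.iInf_le_integral (R : Run P f F x₀ p T μ) (hF : Continuous F)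
    (hbdd : BddBelow (Set.range F)) (ht : t ≤ T) : ⨅ x, F x ≤ ∫ ω, F (R.x t ω) ∂μ := by
  simpa using integral_mono (integrable_const (⨅ x, F x)) (R.integrable_comp ht hF)
    fun ω => ciInf_le hbdd (R.x t ω)

theorem Run.integral_uniform_index (R : Run P f F x₀ p T μ) (hτ : Measurable τ)
    (hlaw : μ.map τ = uniformOn (Finset.range T : Set ℕ))
    (hindep : IndepFun τ (fun ω (t : Fin (T + 1)) => R.x t ω) μ) {φ : E n → ℝ}
    (hφ : Continuous φ) :
    Integrable (fun ω => φ (R.x (τ ω + 1) ω)) μ ∧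
    ∫ ω, φ (R.x (τ ω + 1) ω) ∂μ
      = (T : ℝ)⁻¹ * ∑ t ∈ Finset.range T, ∫ ω, φ (R.x (t + 1) ω) ∂μ := by
  have hlt : ∀ {t}, t ∈ Finset.range T → t + 1 ≤ T := Finset.mem_range.1
  simpa only [Finset.card_range] using integral_comp_uniform_index
    (Y := fun t ω => φ (R.x (t + 1) ω)) hτ hlaw
    (fun t ht => hindep.comp (φ := id)
      (ψ := fun v : Fin (T + 1) → E n => φ (v ⟨t + 1, Nat.lt_succ_of_le (hlt ht)⟩))
      measurable_id (by fun_prop))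
    fun t ht => R.integrable_comp (hlt ht) hφ

variable [IsProbabilityMeasure P]

theorem Run.sum_integral_le_of_le_stepError (R : Run P f F x₀ p T μ) (hn : 2 ≤ n)
    (h : Assumptions P f F L₀ L₁ G₀ G₁ M₀ M₁ K₀ K₁ δ) (hp : p.Balanced n L₁ δ)
    {φ : E n → ℝ} (hφ : Continuous φ)
    (hstep : ∀ t < T, ∀ ω, φ (R.x (t + 1) ω) ≤ 2 * (F (R.x t ω) - F (R.x (t + 1) ω))
      + stepError F M₀ M₁ p.radius (R.x t ω) (R.g t ω) (R.H t ω)) :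
    ∑ t ∈ Finset.range T, ∫ ω, φ (R.x (t + 1) ω) ∂μ
      ≤ 2 * (F x₀ - ⨅ x, F x) + p.radius ^ 3 * (T * stepOffset L₀ L₁ G₀ G₁ M₀ M₁ K₀ K₁
        + stepSlope L₁ G₁ M₁ K₁ *
          ∑ t ∈ Finset.range T, ∫ ω, ‖gradient F (R.x (t + 1) ω)‖ ∂μ) := by
  have hsum := Finset.sum_le_sum fun t (ht : t ∈ Finset.range T) =>
    R.integral_le_of_le_stepError hn h hp (Finset.mem_range.1 ht) hφ
      (hstep t (Finset.mem_range.1 ht))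
  rw [Finset.sum_add_distrib, ← Finset.mul_sum, ← Finset.mul_sum, Finset.sum_add_distrib,
    ← Finset.mul_sum, Finset.sum_const, Finset.card_range, nsmul_eq_mul,
    Finset.sum_range_sub' fun t => ∫ ω, F (R.x t ω) ∂μ] at hsum
  have hinitial : ∫ ω, F (R.x 0 ω) ∂μ = F x₀ := by simp [R.x_zero]
  have hfinal := R.iInf_le_integral h.second_order.1.1.continuous h.objective.bddBelow le_rfl
  linarith

theorem Run.radius_mul_sum_integral_norm_gradient_le (R : Run P f F x₀ p T μ) (hn : 2 ≤ n)
    (h : Assumptions P f F L₀ L₁ G₀ G₁ M₀ M₁ K₀ K₁ δ) (hp : p.Balanced n L₁ δ)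
    (hslope : stepSlope L₁ G₁ M₁ K₁ * p.radius ^ 2 ≤ 1 / 2) :
    p.radius * ∑ t ∈ Finset.range T, ∫ ω, ‖gradient F (R.x (t + 1) ω)‖ ∂μ
      ≤ 4 * (F x₀ - ⨅ x, F x)
        + 2 * (T * p.radius ^ 3 * stepOffset L₀ L₁ G₀ G₁ M₀ M₁ K₀ K₁) := by
  have hsum := R.sum_integral_le_of_le_stepError hn h hp
    (φ := fun x => p.radius * ‖gradient F x‖)
    (h.second_order.1.continuous_gradient.norm.const_mul _) fun t ht ω =>
      (R.step t ht ω).radius_mul_norm_gradient_le (R.isSymmetric_H h.objective ht ω)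
        h.second_order h.M₀_nonneg h.M₁_nonneg hp.pos hp.le_δ
  simp_rw [integral_const_mul] at hsum
  rw [← Finset.mul_sum] at hsum
  have hnonneg : 0 ≤ ∑ t ∈ Finset.range T, ∫ ω, ‖gradient F (R.x (t + 1) ω)‖ ∂μ :=
    Finset.sum_nonneg fun t _ => integral_nonneg fun ω => norm_nonneg _
  have habsorb := mul_le_mul_of_nonneg_right hslope (mul_nonneg hp.pos.le hnonneg)
  linarith

theorem Run.neg_radius_sq_mul_sum_integral_lambdaMin_le (R : Run P f F x₀ p T μ) (hn : 2 ≤ n)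
    (h : Assumptions P f F L₀ L₁ G₀ G₁ M₀ M₁ K₀ K₁ δ) (hp : p.Balanced n L₁ δ)
    (hslope : stepSlope L₁ G₁ M₁ K₁ * p.radius ^ 2 ≤ 1 / 2) :
    -(p.radius ^ 2 * ∑ t ∈ Finset.range T, ∫ ω, lambdaMin (hessian F (R.x (t + 1) ω)) ∂μ)
      ≤ 4 * (F x₀ - ⨅ x, F x)
        + 2 * (T * p.radius ^ 3 * stepOffset L₀ L₁ G₀ G₁ M₀ M₁ K₀ K₁) := by
  have : NeZero n := ⟨by omega⟩
  have hsum := R.sum_integral_le_of_le_stepError hn h hp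
    (φ := fun x => -(p.radius ^ 2 * lambdaMin (hessian F x)))
    ((h.second_order.continuous_lambdaMin_hessian h.δ_pos).const_mul _).neg fun t ht ω =>
      (R.step t ht ω).neg_radius_sq_mul_lambdaMin_le (R.isSymmetric_H h.objective ht ω)
        h.second_order h.M₀_nonneg h.M₁_nonneg hp.pos hp.le_δ
  simp_rw [integral_neg, integral_const_mul] at hsum
  rw [Finset.sum_neg_distrib, ← Finset.mul_sum] at hsum
  have hgrad := R.radius_mul_sum_integral_norm_gradient_le hn h hp hslope
  have hnonneg : 0 ≤ ∑ t ∈ Finset.range T, ∫ ω, ‖gradient F (R.x (t + 1) ω)‖ ∂μ :=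
    Finset.sum_nonneg fun t _ => integral_nonneg fun ω => norm_nonneg _
  have habsorb := mul_le_mul_of_nonneg_right hslope (mul_nonneg hp.pos.le hnonneg)
  linarith

theorem Run.integral_norm_gradient_uniform_index_le (R : Run P f F x₀ p T μ) (hn : 2 ≤ n)
    (h : Assumptions P f F L₀ L₁ G₀ G₁ M₀ M₁ K₀ K₁ δ) (hp : p.Balanced n L₁ δ)
    (hslope : stepSlope L₁ G₁ M₁ K₁ * p.radius ^ 2 ≤ 1 / 2) (hc : 0 ≤ c)
    (hT : F x₀ - ⨅ x, F x ≤ c * (T * p.radius ^ 3)) (hτ : Measurable τ)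
    (hlaw : μ.map τ = uniformOn (Finset.range T : Set ℕ))
    (hindep : IndepFun τ (fun ω (t : Fin (T + 1)) => R.x t ω) μ) :
    Integrable (fun ω => ‖gradient F (R.x (τ ω + 1) ω)‖) μ ∧
    ∫ ω, ‖gradient F (R.x (τ ω + 1) ω)‖ ∂μ
      ≤ (4 * c + 2 * stepOffset L₀ L₁ G₀ G₁ M₀ M₁ K₀ K₁) * p.radius ^ 2 := by
  obtain ⟨hintegrable, heq⟩ := R.integral_uniform_index hτ hlaw hindep
    h.second_order.1.continuous_gradient.norm
  have hΔ := hp.pos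
  have hoffset := stepOffset_nonneg (L₁ := L₁) h.L₀_nonneg h.G₀_nonneg h.G₁_nonneg h.M₀_nonneg
    h.M₁_nonneg h.K₀_nonneg h.K₁_nonneg
  refine ⟨hintegrable, heq.trans_le (inv_mul_le_of_le_mul₀ T.cast_nonneg (by positivity)
    (le_of_mul_le_mul_left ?_ hΔ))⟩
  linarith [R.radius_mul_sum_integral_norm_gradient_le hn h hp hslope]

theorem Run.neg_le_integral_lambdaMin_uniform_index (R : Run P f F x₀ p T μ) (hn : 2 ≤ n)
    (h : Assumptions P f F L₀ L₁ G₀ G₁ M₀ M₁ K₀ K₁ δ) (hp : p.Balanced n L₁ δ)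
    (hslope : stepSlope L₁ G₁ M₁ K₁ * p.radius ^ 2 ≤ 1 / 2) (hc : 0 ≤ c)
    (hT : F x₀ - ⨅ x, F x ≤ c * (T * p.radius ^ 3)) (hτ : Measurable τ)
    (hlaw : μ.map τ = uniformOn (Finset.range T : Set ℕ))
    (hindep : IndepFun τ (fun ω (t : Fin (T + 1)) => R.x t ω) μ) :
    Integrable (fun ω => lambdaMin (hessian F (R.x (τ ω + 1) ω))) μ ∧
    -((4 * c + 2 * stepOffset L₀ L₁ G₀ G₁ M₀ M₁ K₀ K₁) * p.radius)
      ≤ ∫ ω, lambdaMin (hessian F (R.x (τ ω + 1) ω)) ∂μ := by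
  have : NeZero n := ⟨by omega⟩
  obtain ⟨hintegrable, heq⟩ := R.integral_uniform_index hτ hlaw hindep
    (h.second_order.continuous_lambdaMin_hessian h.δ_pos)
  have hΔ := hp.pos
  have hoffset := stepOffset_nonneg (L₁ := L₁) h.L₀_nonneg h.G₀_nonneg h.G₁_nonneg h.M₀_nonneg
    h.M₁_nonneg h.K₀_nonneg h.K₁_nonneg
  refine ⟨hintegrable, ?_⟩
  rw [heq, neg_le, ← mul_neg]
  refine inv_mul_le_of_le_mul₀ T.cast_nonneg (by positivity)
    (le_of_mul_le_mul_left ?_ (pow_pos hΔ 2))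
  linarith [R.neg_radius_sq_mul_sum_integral_lambdaMin_le hn h hp hslope]

end Average

section Parameters

variable {n T : ℕ} {L₁ δ ε b ΔF : ℝ}

theorem rpow_neg_natCast_div_two (hε : 0 ≤ ε) (k : ℕ) : ε ^ (-(k : ℝ) / 2) = (√ε ^ k)⁻¹ := by
  rw [Real.rpow_div_two_eq_sqrt _ hε, Real.rpow_neg (Real.sqrt_nonneg ε), Real.rpow_natCast]

theorem one_le_ceil_rpow_mul_sqrt_pow (hε : 0 < ε) (k : ℕ) :
    1 ≤ (⌈ε ^ (-(k : ℝ) / 2)⌉₊ : ℝ) * √ε ^ k := by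
  rw [← inv_le_iff_one_le_mul₀ (pow_pos (Real.sqrt_pos.2 hε) k),
    ← rpow_neg_natCast_div_two hε.le]
  exact Nat.le_ceil _

theorem ceil_rpow_le_two_mul (hε : 0 < ε) (hε₁ : ε ≤ 1) {r : ℝ} (hr : r ≤ 0) :
    (⌈ε ^ r⌉₊ : ℝ) ≤ 2 * ε ^ r := by
  have hone := Real.one_le_rpow_of_pos_of_le_one_of_nonpos hε hε₁ hr
  exact Nat.ceil_le_two_mul (by linarith)

theorem balanced_soParams (hε : 0 < ε) (hε₁ : ε ≤ 1) (hL : L₁ * √ε ≤ 1) (hδ : √ε ≤ δ) :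
    (soParams n ε).Balanced n L₁ δ where
  pos := Real.sqrt_pos.2 hε
  le_one := Real.sqrt_le_one.2 hε₁
  mul_le_one := hL
  le_δ := hδ
  le_S₁ := by
    have hceil := one_le_ceil_rpow_mul_sqrt_pow hε 4
    rwa [show -((4 : ℕ) : ℝ) / 2 = -2 by norm_num] at hceil
  le_S₂ := by
    have hsq : (soParams n ε).radius ^ 2 = ε := Real.sq_sqrt hε.le
    rw [hsq, ← div_le_iff₀ hε, div_eq_mul_inv]
    exact Nat.le_ceil _
  le_S₃ := one_le_ceil_rpow_mul_sqrt_pow hε 3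
  q_pos := Nat.ceil_pos.2 (by positivity)
  q_mul_le := by
    have hinv : ε ^ (-1 / 2 : ℝ) = (√ε)⁻¹ := by simpa using rpow_neg_natCast_div_two hε.le 1
    have hceil := ceil_rpow_le_two_mul hε hε₁ (r := -1 / 2) (by norm_num)
    rwa [hinv, ← div_eq_mul_inv, le_div_iff₀ (Real.sqrt_pos.2 hε), ← hinv] at hceil

theorem gap_le_of_le_natCast {a : ℝ} (hε : 0 < ε) (ha : 0 < a)
    (hT : a * ΔF * ε ^ (-3 / 2 : ℝ) ≤ T) : ΔF ≤ a⁻¹ * (T * √ε ^ 3) := by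
  have hrpow : ε ^ (-3 / 2 : ℝ) = (√ε ^ 3)⁻¹ := rpow_neg_natCast_div_two hε.le 3
  rwa [hrpow, ← div_eq_mul_inv, div_le_iff₀ (pow_pos (Real.sqrt_pos.2 hε) 3),
    ← le_inv_mul_iff₀ ha] at hT

theorem exists_balanced_soParams (L₁ Q : ℝ) (hδ : 0 < δ) :
    ∃ ε₀ > (0 : ℝ), ∀ ε, 0 < ε → ε ≤ ε₀ →
      ε ≤ 1 ∧ Q * √ε ^ 2 ≤ 1 / 2 ∧ ∀ n, (soParams n ε).Balanced n L₁ δ := by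
  have hcont : ∀ {φ : ℝ → ℝ} {c : ℝ}, Continuous φ → φ 0 < c → ∀ᶠ ε in nhds 0, φ ε ≤ c :=
    fun hφ hlt => (hφ.tendsto 0).eventually (Iic_mem_nhds hlt)
  have hsmall : ∀ᶠ ε in nhds (0 : ℝ), ε ≤ 1 ∧ L₁ * √ε ≤ 1 ∧ √ε ≤ δ ∧ Q * √ε ^ 2 ≤ 1 / 2 :=
    (hcont continuous_id one_pos).and <| (hcont (by fun_prop) (by simp)).and <|
      (hcont (by fun_prop) (by simpa)).and (hcont (by fun_prop) (by simp))
  obtain ⟨r, hr, hball⟩ := Metric.eventually_nhds_iff.1 hsmall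
  refine ⟨r / 2, half_pos hr, fun ε hε hle => ?_⟩
  obtain ⟨hε₁, hL, hle_δ, hQ⟩ := hball (y := ε) (by
    rw [Real.dist_0_eq_abs, abs_of_pos hε]
    exact hle.trans_lt (half_lt_self hr))
  exact ⟨hε₁, hQ, fun n => balanced_soParams hε hε₁ hL hle_δ⟩

theorem Params.sum_gradBatch_le (p : Params) (hq : 0 < p.q) (T : ℕ) :
    ∑ t ∈ Finset.range T, p.gradBatch t ≤ (T / p.q + 1) * p.S₁ + T * p.S₃ := by
  have hepochs : Nat.count (fun t => t % p.q = 0) T ≤ T / p.q + 1 := by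
    refine (Nat.count_modEq_card T hq 0).le.trans ?_
    split_ifs <;> omega
  calc ∑ t ∈ Finset.range T, p.gradBatch t
    _ ≤ ∑ t ∈ Finset.range T, ((if t % p.q = 0 then p.S₁ else 0) + p.S₃) := by
      refine Finset.sum_le_sum fun t _ => ?_
      unfold Params.gradBatch
      split_ifs <;> omega
    _ = Nat.count (fun t => t % p.q = 0) T * p.S₁ + T * p.S₃ := by
      rw [Finset.sum_add_distrib, ← Finset.sum_filter, Finset.sum_const, Finset.sum_const,
        Finset.card_range, Nat.count_eq_card_filter_range, smul_eq_mul, smul_eq_mul]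
    _ ≤ (T / p.q + 1) * p.S₁ + T * p.S₃ := by gcongr

theorem Params.totalSamples_le (p : Params) (hq : 0 < p.q) (T : ℕ) :
    p.totalSamples T ≤ (T / p.q + 1) * p.S₁ + T * p.S₃ + T * p.S₂ := by
  rw [Params.totalSamples, Finset.sum_add_distrib, Finset.sum_const, Finset.card_range,
    smul_eq_mul]
  exact Nat.add_le_add_right (p.sum_gradBatch_le hq T) _

theorem soParams_S₂_le (hn : 2 ≤ n) (hε : 0 < ε) (hε₁ : ε ≤ 1) :
    ((soParams n ε).S₂ : ℝ) ≤ 44 * Real.log n * ε⁻¹ := by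
  have hlog : Real.log 2 ≤ Real.log n := Real.log_le_log two_pos (by exact_mod_cast hn)
  have hinv : 1 ≤ ε⁻¹ := (one_le_inv₀ hε).2 hε₁
  have hceil : ((soParams n ε).S₂ : ℝ) ≤ 2 * (22 * Real.log n * ε⁻¹) :=
    Nat.ceil_le_two_mul (by nlinarith [Real.log_two_gt_d9])
  linarith

theorem div_soParams_q_le (hε : 0 < ε) (hT : (T : ℝ) ≤ b * ΔF * ε ^ (-3 / 2 : ℝ)) :
    ((T / (soParams n ε).q : ℕ) : ℝ) ≤ b * ΔF * ε⁻¹ := by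
  have hq : ε ^ (-1 / 2 : ℝ) ≤ (soParams n ε).q := Nat.le_ceil _
  have hpos := Real.rpow_pos_of_pos hε (-1 / 2)
  have hsplit : ε ^ (-3 / 2 : ℝ) = ε⁻¹ * ε ^ (-1 / 2 : ℝ) := by
    rw [← Real.rpow_neg_one, ← Real.rpow_add hε]
    norm_num
  calc ((T / (soParams n ε).q : ℕ) : ℝ)
    _ ≤ T / (soParams n ε).q := Nat.cast_div_le
    _ ≤ T / ε ^ (-1 / 2 : ℝ) := div_le_div_of_nonneg_left T.cast_nonneg hpos hq
    _ ≤ b * ΔF * ε⁻¹ := by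
      rw [div_le_iff₀ hpos, mul_assoc, ← hsplit]
      exact hT

theorem totalSamples_soParams_le (hn : 2 ≤ n) (hε : 0 < ε) (hε₁ : ε ≤ 1) (hb : 0 ≤ b)
    (hT : (T : ℝ) ≤ b * ΔF * ε ^ (-3 / 2 : ℝ)) (hΔF : ε ≤ ΔF) :
    ((soParams n ε).totalSamples T : ℝ)
      ≤ (48 * b + 2) * (ΔF * ε ^ (-3 : ℝ) + Real.log n * ΔF * ε ^ (-5 / 2 : ℝ)) := by
  have hΔF_pos : 0 < ΔF := hε.trans_le hΔF
  have hone : 1 ≤ ΔF * ε⁻¹ := by rwa [← div_eq_mul_inv, one_le_div hε]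
  have htotal : ((soParams n ε).totalSamples T : ℝ)
      ≤ ((T / (soParams n ε).q : ℕ) + 1) * (soParams n ε).S₁ + T * (soParams n ε).S₃
        + T * (soParams n ε).S₂ := by
    exact_mod_cast (soParams n ε).totalSamples_le (Nat.ceil_pos.2 (by positivity)) T
  calc ((soParams n ε).totalSamples T : ℝ)
    _ ≤ (b * ΔF * ε⁻¹ + ΔF * ε⁻¹) * (2 * ε ^ (-2 : ℝ))
        + b * ΔF * ε ^ (-3 / 2 : ℝ) * (2 * ε ^ (-3 / 2 : ℝ))
        + b * ΔF * ε ^ (-3 / 2 : ℝ) * (44 * Real.log n * ε⁻¹) := by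
      refine htotal.trans (add_le_add (add_le_add ?_ ?_) ?_)
      · gcongr
        · exact div_soParams_q_le hε hT
        · exact ceil_rpow_le_two_mul hε hε₁ (by norm_num)
      · gcongr
        exact ceil_rpow_le_two_mul hε hε₁ (by norm_num)
      · gcongr
        exact soParams_S₂_le hn hε hε₁
    _ = (4 * b + 2) * (ΔF * ε ^ (-3 : ℝ))
        + 44 * b * (Real.log n * ΔF * ε ^ (-5 / 2 : ℝ)) := by
      have hS₁ : ε⁻¹ * ε ^ (-2 : ℝ) = ε ^ (-3 : ℝ) := by
        rw [← Real.rpow_neg_one, ← Real.rpow_add hε]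
        norm_num
      have hS₂ : ε ^ (-3 / 2 : ℝ) * ε⁻¹ = ε ^ (-5 / 2 : ℝ) := by
        rw [← Real.rpow_neg_one, ← Real.rpow_add hε]
        norm_num
      have hS₃ : ε ^ (-3 / 2 : ℝ) * ε ^ (-3 / 2 : ℝ) = ε ^ (-3 : ℝ) := by
        rw [← Real.rpow_add hε]
        norm_num
      linear_combination (2 * b * ΔF + 2 * ΔF) * hS₁ + 44 * b * ΔF * Real.log n * hS₂
        + 2 * b * ΔF * hS₃
    _ ≤ (48 * b + 2) * (ΔF * ε ^ (-3 : ℝ) + Real.log n * ΔF * ε ^ (-5 / 2 : ℝ)) := by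
      rw [mul_add]
      gcongr <;> linarith

end Parameters

end TrustRegion

open TrustRegion in
theorem mainTheorem1_general (L₁ G₁ M₁ K₁ δ : ℝ) (hL₁ : 0 ≤ L₁) (hG₁ : 0 ≤ G₁) (hM₁ : 0 ≤ M₁)
    (hK₁ : 0 ≤ K₁) (hδ : 0 < δ) :
    ∃ ε₀ > (0 : ℝ), ∀ L₀ G₀ M₀ K₀ a b : ℝ, 0 ≤ L₀ → 0 ≤ G₀ → 0 ≤ M₀ → 0 ≤ K₀ → 0 < a → 0 < b →
    ∃ C > (0 : ℝ), ∀ (n : ℕ), 2 ≤ n →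
    ∀ (Ξ : Type*) [MeasurableSpace Ξ] (P : Measure Ξ) [IsProbabilityMeasure P]
      (f : E n → Ξ → ℝ) (F : E n → ℝ),
      IsStochasticObjective P f F →
      GeneralizedSmooth F L₀ L₁ →
      GradientVarianceBounded P f F G₀ G₁ →
      SecondOrderGeneralizedSmooth F δ M₀ M₁ →
      HessianVarianceBounded P f F K₀ K₁ →
    ∀ (x₀ : E n) (ΔF : ℝ), ΔF = F x₀ - ⨅ x, F x →
    ∀ (ε : ℝ), 0 < ε → ε ≤ ε₀ →
    ∀ (T : ℕ), a * ΔF * ε ^ (-3 / 2 : ℝ) ≤ T →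
      (∀ (Ω : Type*) [MeasurableSpace Ω] (μ : Measure Ω) [IsProbabilityMeasure μ]
        (R : Run P f F x₀ (soParams n ε) T μ) (tbar : Ω → ℕ),
        Measurable tbar →
        μ.map tbar = uniformOn (Finset.range T : Set ℕ) →
        IndepFun tbar (fun ω (t : Fin (T + 1)) => R.x t ω) μ →
        Integrable (fun ω => ‖gradient F (R.x (tbar ω + 1) ω)‖) μ ∧
        ∫ ω, ‖gradient F (R.x (tbar ω + 1) ω)‖ ∂μ ≤ C * ε ∧
        Integrable (fun ω => lambdaMin (hessian F (R.x (tbar ω + 1) ω))) μ ∧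
        -(C * √ε) ≤ ∫ ω, lambdaMin (hessian F (R.x (tbar ω + 1) ω)) ∂μ) ∧
      ((T : ℝ) ≤ b * ΔF * ε ^ (-3 / 2 : ℝ) → ε ≤ ΔF →
        ((soParams n ε).totalSamples T : ℝ)
          ≤ C * (ΔF * ε ^ (-3 : ℝ) + Real.log n * ΔF * ε ^ (-5 / 2 : ℝ))) := by
  obtain ⟨ε₀, hε₀, hbalanced⟩ := exists_balanced_soParams L₁ (stepSlope L₁ G₁ M₁ K₁) hδ
  refine ⟨ε₀, hε₀, fun L₀ G₀ M₀ K₀ a b hL₀ hG₀ hM₀ hK₀ ha hb => ?_⟩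
  have hoffset := stepOffset_nonneg (L₁ := L₁) hL₀ hG₀ hG₁ hM₀ hM₁ hK₀ hK₁
  have hC₁ : 0 ≤ 4 * a⁻¹ + 2 * stepOffset L₀ L₁ G₀ G₁ M₀ M₁ K₀ K₁ := by positivity
  set C₁ := 4 * a⁻¹ + 2 * stepOffset L₀ L₁ G₀ G₁ M₀ M₁ K₀ K₁
  have hC₁_le : C₁ ≤ C₁ + (48 * b + 2) := by linarith
  refine ⟨C₁ + (48 * b + 2), by positivity, ?_⟩
  rintro n hn Ξ _ P _ f F hobj hsmooth hgrad hsecond hhess x₀ _ rfl ε hε hle T hT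
  obtain ⟨hε₁, hslope, hp⟩ := hbalanced ε hε hle
  refine ⟨fun Ω _ μ _ R τ hτ hlaw hindep => ?_, fun hTb hgap => ?_⟩
  · have h : Assumptions P f F L₀ L₁ G₀ G₁ M₀ M₁ K₀ K₁ δ :=
      ⟨hL₀, hL₁, hG₀, hG₁, hM₀, hM₁, hK₀, hK₁, hδ, hobj, hsmooth, hgrad, hsecond, hhess⟩
    have hT' := gap_le_of_le_natCast hε ha hT
    obtain ⟨hint_grad, hgrad_le⟩ := R.integral_norm_gradient_uniform_index_le hn h (hp n) hslope
      (inv_nonneg.2 ha.le) hT' hτ hlaw hindep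
    obtain ⟨hint_lam, hlam_ge⟩ := R.neg_le_integral_lambdaMin_uniform_index hn h (hp n) hslope
      (inv_nonneg.2 ha.le) hT' hτ hlaw hindep
    have hsq : (soParams n ε).radius ^ 2 = ε := Real.sq_sqrt hε.le
    rw [hsq] at hgrad_le
    exact ⟨hint_grad, hgrad_le.trans (mul_le_mul_of_nonneg_right hC₁_le hε.le), hint_lam,
      (neg_le_neg (mul_le_mul_of_nonneg_right hC₁_le (Real.sqrt_nonneg ε))).trans hlam_ge⟩
  · have hgap_nonneg := hε.le.trans hgap
    exact (totalSamples_soParams_le hn hε hε₁ hb.le hTb hgap).trans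
      (mul_le_mul_of_nonneg_right (le_add_of_nonneg_left hC₁) (by positivity))

open TrustRegion in
theorem mainTheorem1 (L₁ G₁ M₁ K₁ δ : ℝ) (hL₁ : 0 ≤ L₁) (hG₁ : 0 ≤ G₁) (hM₁ : 0 ≤ M₁)
    (hK₁ : 0 ≤ K₁) (hδ : 0 < δ) :
    ∃ ε₀ > (0 : ℝ), ∀ L₀ G₀ M₀ K₀ a b : ℝ, 0 < L₀ → 0 ≤ G₀ → 0 < M₀ → 0 ≤ K₀ → 0 < a → 0 < b →
    ∃ C > (0 : ℝ), ∀ (n : ℕ), 2 ≤ n →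
    ∀ (Ξ : Type*) [MeasurableSpace Ξ] (P : Measure Ξ) [IsProbabilityMeasure P]
      (f : E n → Ξ → ℝ) (F : E n → ℝ),
      IsStochasticObjective P f F →
      GeneralizedSmooth F L₀ L₁ →
      GradientVarianceBounded P f F G₀ G₁ →
      SecondOrderGeneralizedSmooth F δ M₀ M₁ →
      HessianVarianceBounded P f F K₀ K₁ →
      AveragedSmooth P f F L₀ L₁ →
    ∀ (x₀ : E n) (ΔF : ℝ), ΔF = F x₀ - ⨅ x, F x →
    ∀ (ε : ℝ), 0 < ε → ε ≤ ε₀ →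
    ∀ (T : ℕ), 1 ≤ T → a * ΔF * ε ^ (-3 / 2 : ℝ) ≤ T →
      (∀ (Ω : Type*) [MeasurableSpace Ω] (μ : Measure Ω) [IsProbabilityMeasure μ]
        (R : Run P f F x₀ (soParams n ε) T μ) (tbar : Ω → ℕ),
        Measurable tbar →
        μ.map tbar = uniformOn (Finset.range T : Set ℕ) →
        IndepFun tbar (fun ω (t : Fin (T + 1)) => R.x t ω) μ →
        Integrable (fun ω => ‖gradient F (R.x (tbar ω + 1) ω)‖) μ ∧
        ∫ ω, ‖gradient F (R.x (tbar ω + 1) ω)‖ ∂μ ≤ C * ε ∧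
        Integrable (fun ω => lambdaMin (hessian F (R.x (tbar ω + 1) ω))) μ ∧
        -(C * √ε) ≤ ∫ ω, lambdaMin (hessian F (R.x (tbar ω + 1) ω)) ∂μ) ∧
      ((T : ℝ) ≤ b * ΔF * ε ^ (-3 / 2 : ℝ) → ε ≤ ΔF →
        ((soParams n ε).totalSamples T : ℝ)
          ≤ C * (ΔF * ε ^ (-3 : ℝ) + Real.log n * ΔF * ε ^ (-5 / 2 : ℝ))) := by
  obtain ⟨ε₀, hε₀, hgeneral⟩ := mainTheorem1_general L₁ G₁ M₁ K₁ δ hL₁ hG₁ hM₁ hK₁ hδ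
  refine ⟨ε₀, hε₀, fun L₀ G₀ M₀ K₀ a b hL₀ hG₀ hM₀ hK₀ ha hb => ?_⟩
  obtain ⟨C, hC, h⟩ := hgeneral L₀ G₀ M₀ K₀ a b hL₀.le hG₀ hM₀.le hK₀ ha hb
  exact ⟨C, hC, fun n hn Ξ _ P _ f F hobj hsmooth hgrad hsecond hhess _ x₀ ΔF hΔF ε hε hle T _ =>
    h n hn Ξ P f F hobj hsmooth hgrad hsecond hhess x₀ ΔF hΔF ε hε hle T⟩
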